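/- Let $A$ be a self-adjoint operator with compact resolvent in a complex separable Hilbert space $\mathcal H$, with positive eigenvalues $\{\mu_k\}_{k\in\mathbb N}$, $\mathbb N=\{1,2,\dots\}$, and an orthonormal basis of eigenvectors $A\psi_k=\mu_k\psi_k$, such that for some $\gamma,\kappa>0$ and $N_0\in\mathbb N$ $$\mu_{k+1}-\mu_k\ge\kappa k^{\gamma-1},\qquad k\ge N_0 .\tag{A}$$ Let $a(f,g)=\langle A^{1/2}f,A^{1/2}g\rangle$ on $\operatorname{Dom}(a)=\operatorname{Dom}(A^{1/2})$ and let $b$ be a sesquilinear form on $\operatorname{Dom}(a)$ (linear in the first argument) that is determined by its values on the eigenvectors, i.e. $b(f,g)=\lim_{n\to\infty}\sum_{j,k\le n}\langle f,\psi_j\rangle\overline{\langle g,\psi_k\rangle}\,b(\psi_j,\psi_k)$, and satisfies, with some $\alpha\in\mathbb R$, $2\alpha+\gamma>1$, and $M_b>0$, $$|b(\psi_m,\psi_n)|\le \frac{M_b}{m^{\alpha}n^{\alpha}},\qquad m,n\in\mathbb N .\tag{B}$$ Let $T$ be the operator associated with the form $a+b$. For $z\in\rho(A)$ put $K(z)f=\sum_k(z-\mu_k)^{-1/2}\langle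 f,\psi_k\rangle\psi_k$ (principal branch). Then for every $z\in\rho(A)$ there is a bounded operator $B(z)$, determined by $\langle B(z)f,g\rangle=b(K(z)f,K(z)^*g)$ for all $f,g\in\mathcal H$, and $T=A^{1/2}(I-B(0))A^{1/2}$. Let $$\Pi_n=\{z:\ \mu_n-\tfrac\kappa2(n-1)^{\gamma-1}<\operatorname{Re}z<\mu_n+\tfrac\kappa2n^{\gamma-1},\ |\operatorname{Im}z|<\tfrac\kappa2n^{\gamma-1}\},\qquad\Gamma_n=\partial\Pi_n,$$ $$\Pi_0(N,h)=\{z:\ -h<\operatorname{Re}z<\mu_N+\tfrac\kappa2N^{\gamma-1},\ |\operatorname{Im}z|<h\},$$ $$\sigma(n)=\sigma_{2\alpha,\gamma}(n)=\begin{cases}n^{-2\alpha-\gamma+1}\log(en),&2\alpha\le1,\\ n^{-\gamma},&2\alpha>1.\end{cases}$$ **Theorem.** There are $N>N_0$ and $h>0$ such that the spectrum of $T$ is contained in $\Pi_0(N,h)\cup\bigcup_{n>N}\Pi_n$ and, for each $n>N$, $\Gamma_n\subset\rho(A)\cap\rho(T)$ and $\Pi_n$ contains exactly one point $\lambda_n$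 of the spectrum of $T$, an eigenvalue whose Riesz projection $\frac1{2\pi i}\int_{\Gamma_n}(z-T)^{-1}dz$ has rank one. Moreover, for every $j\in\mathbb N$, $$\lambda_n=\mu_n+\sum_{k=1}^j\lambda_n^{(k)}+r_n^{(j)},\quad n>N,\qquad \lambda_n^{(k)}=\operatorname{Tr}\,\frac1{2\pi i}\int_{\Gamma_n}(z-\mu_n)K(z)B(z)^kK(z)\,dz,$$ where for $n>N$ and $k\ge1$ the integrand $K(z)B(z)^kK(z)$ is norm continuous on $\Gamma_n$ and the operator under the trace is of trace class, and, as $n\to\infty$, $$|\lambda_n^{(k)}|=O\big(n^{\gamma-1}\sigma(n)^k\big)\ (k\ge1),\qquad |r_n^{(j)}|=O\big(n^{\gamma-1}\sigma(n)^{j+1}\big).$$ The vectors $$\phi_n:=\frac1{2\pi i}\int_{\Gamma_n}(z-T)^{-1}\psi_n\,dz=\psi_n+\sum_{k=1}^j\phi_n^{(k)}+\rho_n^{(j)},\quad n>N,\qquad \phi_n^{(k)}=\frac1{2\pi i}\int_{\Gamma_n}K(z)B(z)^kK(z)\psi_n\,dz,$$ satisfy $\|\phi_n^{(k)}\|=O(\sigma(n)^k)$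 ($k\ge1$) and $\|\rho_n^{(j)}\|=O(\sigma(n)^{j+1})$ as $n\to\infty$, and there is $N_1\ge N$ such that $T\phi_n=\lambda_n\phi_n$ and $\phi_n\neq0$ for all $n>N_1$. -/

import Mathlib

open Filter Topology Asymptotics Complex

namespace LocalSub

noncomputable section

variable {H : Type*} [NormedAddCommGroup H] [InnerProductSpace ℂ H] [CompleteSpace H]

/-! ### Unbounded operators: resolvent, eigenvalues, compact resolvent -/

/-- `R` is a bounded two-sided inverse of `z - T : Dom T → H`. -/
def IsResolventAt (T : H →ₗ.[ℂ] H) (z : ℂ) (R : H →L[ℂ] H) : Prop :=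
  (∀ f : H, ∃ h : R f ∈ T.domain, z • R f - T ⟨R f, h⟩ = f) ∧
    ∀ f : T.domain, R (z • (f : H) - T f) = f

/-- The resolvent set `ρ(T)`. -/
def resSet (T : H →ₗ.[ℂ] H) : Set ℂ := {z | ∃ R : H →L[ℂ] H, IsResolventAt T z R}

open Classical in
/-- The resolvent `(z - T)⁻¹`, for `z ∈ ρ(T)` (and `0` otherwise). -/
def resolv (T : H →ₗ.[ℂ] H) (z : ℂ) : H →L[ℂ] H :=
  if h : ∃ R : H →L[ℂ] H, IsResolventAt T z R then h.choose else 0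

/-- The spectrum `σ(T)`. -/
def spec (T : H →ₗ.[ℂ] H) : Set ℂ := (resSet T)ᶜ

/-- `(z - T)⁻¹` is compact for some `z ∈ ρ(T)`. -/
def HasCompactResolvent (T : H →ₗ.[ℂ] H) : Prop :=
  ∃ z : ℂ, ∃ R : H →L[ℂ] H, IsResolventAt T z R ∧ IsCompactOperator R

/-- `f ≠ 0` lies in `Dom T` and `T f = c f`. -/
def IsEigenvector (T : H →ₗ.[ℂ] H) (c : ℂ) (f : H) : Prop :=
  f ≠ 0 ∧ ∃ h : f ∈ T.domain, T ⟨f, h⟩ = c • f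

/-! ### Trace class operators -/

/-- `C = ∑ k, ⟨·, x k⟩ y k` with `∑ k, ‖x k‖ ‖y k‖ < ∞`; on a Hilbert space this is the
trace class. -/
def IsTraceClass (C : H →L[ℂ] H) : Prop :=
  ∃ x y : ℕ → H, Summable (fun k => ‖x k‖ * ‖y k‖) ∧
    ∀ f : H, HasSum (fun k => inner ℂ (x k) f • y k) (C f)

/-- The trace `∑ k, ⟨C ψ k, ψ k⟩` (for trace class `C` it does not depend on the basis). -/
def trace (ψ : HilbertBasis ℕ+ ℂ H) (C : H →L[ℂ] H) : ℂ :=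
  ∑' k, inner ℂ (ψ k) (C (ψ k))

/-! ### Functions of the self-adjoint operator `A`, with `A ψ k = μ k ψ k` -/

open Classical in
/-- The bounded operator `f ↦ ∑ k, c k ⟨f, ψ k⟩ ψ k`, for a bounded sequence `c`
(and `0` otherwise). -/
def diagOp (ψ : HilbertBasis ℕ+ ℂ H) (c : ℕ+ → ℂ) : H →L[ℂ] H :=
  if h : ∃ M : ℝ, 0 ≤ M ∧ ∀ k, ‖c k‖ ≤ M then
    (ψ.repr.symm.toContinuousLinearEquiv : _ →L[ℂ] H) ∘L
      (lp.mapCLM 2 (E := fun _ : ℕ+ => ℂ) (F := fun _ : ℕ+ => ℂ)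
        (fun k => c k • ContinuousLinearMap.id ℂ ℂ) h.choose_spec.1
        (fun k => by
          have h1 := h.choose_spec.2 k
          calc ‖c k • ContinuousLinearMap.id ℂ ℂ‖
              = ‖c k‖ := by rw [norm_smul, ContinuousLinearMap.norm_id, mul_one]
            _ ≤ _ := h1)) ∘L
      (ψ.repr.toContinuousLinearEquiv : H →L[ℂ] _)
  else 0

/-- `K(z) f = ∑ k, (z - μ k) ^ (-1/2) ⟨f, ψ k⟩ ψ k`, with the branch `-π < arg ≤ π`. -/
def opK (μ : ℕ+ → ℝ) (ψ : HilbertBasis ℕ+ ℂ H) (z : ℂ) : H →L[ℂ] H :=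
  diagOp ψ (fun k => (z - (μ k : ℂ)) ^ (-(1 / 2) : ℂ))

/-- `Dom(a) = Dom(A^{1/2})`, the vectors `f` with `∑ k, μ k |⟨f, ψ k⟩|² < ∞`. -/
def formDomain (μ : ℕ+ → ℝ) (ψ : HilbertBasis ℕ+ ℂ H) : Submodule ℂ H where
  carrier := {f | Memℓp (fun k => ((√(μ k) : ℝ) : ℂ) * ψ.repr f k) 2}
  add_mem' {f g} hf hg := by
    have h := Memℓp.add hf hg
    refine Memℓp.of_norm (?_ : Memℓp _ 2)
    refine (h.norm.mono fun k => ?_)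
    simp [mul_add]
  zero_mem' := by
    have h : Memℓp (fun _ : ℕ+ => (0 : ℂ)) 2 := zero_memℓp
    simpa using h
  smul_mem' c f hf := by
    have h := Memℓp.const_smul hf c
    refine (h.norm.mono fun k => ?_).of_norm
    simp [mul_left_comm]

/-- `A^{1/2} : Dom(A^{1/2}) → H`. -/
def sqrtA (μ : ℕ+ → ℝ) (ψ : HilbertBasis ℕ+ ℂ H) : formDomain μ ψ →ₗ[ℂ] H where
  toFun f := ψ.repr.symm ⟨fun k => ((√(μ k) : ℝ) : ℂ) * ψ.repr f k, f.2⟩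
  map_add' f g := by
    rw [← map_add]
    congr 1
    ext k
    exact (by simp [mul_add] :
      ((√(μ k) : ℝ) : ℂ) * ψ.repr ((f + g : formDomain μ ψ) : H) k =
        ((√(μ k) : ℝ) : ℂ) * ψ.repr f k + ((√(μ k) : ℝ) : ℂ) * ψ.repr g k)
  map_smul' c f := by
    rw [RingHom.id_apply, ← map_smul]
    congr 1
    ext k
    simp [mul_left_comm]

theorem basis_mem_formDomain (μ : ℕ+ → ℝ) (ψ : HilbertBasis ℕ+ ℂ H) (m : ℕ+) :
    ψ m ∈ formDomain μ ψ := by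
  have h := (lp.memℓp (ψ.repr (ψ m))).const_smul (((√(μ m) : ℝ) : ℂ))
  refine (h.norm.mono fun k => ?_).of_norm
  classical
  by_cases hk : k = m
  · subst hk; simp
  · simp [HilbertBasis.repr_self, hk]

/-- `ψ m` as an element of `Dom(a)`. -/
def basisVec (μ : ℕ+ → ℝ) (ψ : HilbertBasis ℕ+ ℂ H) (m : ℕ+) : formDomain μ ψ :=
  ⟨ψ m, basis_mem_formDomain μ ψ m⟩

/-- The partial sum `∑_{k ≤ n} ⟨f, ψ k⟩ ψ k`, as an element of `Dom(a)`. -/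
def trunc (μ : ℕ+ → ℝ) (ψ : HilbertBasis ℕ+ ℂ H) (n : ℕ+) (f : H) : formDomain μ ψ :=
  ∑ k ∈ Finset.Icc 1 n, ψ.repr f k • basisVec μ ψ k

/-! ### Sesquilinear forms (linear in the first argument) and the operator `T` -/

/-- The form `a(f, g) = ⟨A^{1/2} f, A^{1/2} g⟩`. -/
def formA (μ : ℕ+ → ℝ) (ψ : HilbertBasis ℕ+ ℂ H) :
    formDomain μ ψ →ₗ[ℂ] formDomain μ ψ →ₗ⋆[ℂ] ℂ :=
  LinearMap.mk₂'ₛₗ (RingHom.id ℂ) (starRingEnd ℂ)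
    (fun f g => inner ℂ (sqrtA μ ψ g) (sqrtA μ ψ f))
    (fun f f' g => by simp)
    (fun c f g => by simp)
    (fun f g g' => by simp)
    (fun c f g => by simp [mul_comm])

/-- The pairs `(f, w)` with `f ∈ D` and `t(f, g) = ⟨w, g⟩` for all `g ∈ D`. -/
def formGraph (D : Submodule ℂ H) (t : D →ₗ[ℂ] D →ₗ⋆[ℂ] ℂ) : Submodule ℂ (H × H) where
  carrier := {p | ∃ hf : p.1 ∈ D, ∀ g : D, t ⟨p.1, hf⟩ g = inner ℂ (g : H) p.2}
  add_mem' := by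
    rintro ⟨f, w⟩ ⟨f', w'⟩ ⟨hf, h⟩ ⟨hf', h'⟩
    refine ⟨D.add_mem hf hf', fun g => ?_⟩
    have e : (⟨(((f, w) : H × H) + (f', w')).1, D.add_mem hf hf'⟩ : D)
        = ⟨f, hf⟩ + ⟨f', hf'⟩ := rfl
    rw [e, map_add, LinearMap.add_apply, h g, h' g]
    simp
  zero_mem' := by
    refine ⟨D.zero_mem, fun g => ?_⟩
    have e : (⟨(0 : H × H).1, D.zero_mem⟩ : D) = 0 := rfl
    rw [e]
    simp
  smul_mem' := by
    rintro c ⟨f, w⟩ ⟨hf, h⟩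
    refine ⟨D.smul_mem c hf, fun g => ?_⟩
    have e : (⟨(c • ((f, w) : H × H)).1, D.smul_mem c hf⟩ : D) = c • ⟨f, hf⟩ := rfl
    rw [e, map_smul, LinearMap.smul_apply, h g]
    simp

/-- The operator associated with a form `t` on a dense domain `D` (first representation theorem):
`T f = w` if and only if `f ∈ D` and `t(f, g) = ⟨w, g⟩` for all `g ∈ D`. -/
def formOperator (D : Submodule ℂ H) (t : D →ₗ[ℂ] D →ₗ⋆[ℂ] ℂ) : H →ₗ.[ℂ] H :=
  (formGraph D t).toLinearPMap

/-- The perturbed operator, associated with the form sum `a + b`. -/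
def opT (μ : ℕ+ → ℝ) (ψ : HilbertBasis ℕ+ ℂ H)
    (b : formDomain μ ψ →ₗ[ℂ] formDomain μ ψ →ₗ⋆[ℂ] ℂ) : H →ₗ.[ℂ] H :=
  formOperator (formDomain μ ψ) (formA μ ψ + b)

/-- `⟨B f, g⟩ = b(K(z) f, K(z)* g)` for all `f, g ∈ H`. -/
def IsB (μ : ℕ+ → ℝ) (ψ : HilbertBasis ℕ+ ℂ H)
    (b : formDomain μ ψ →ₗ[ℂ] formDomain μ ψ →ₗ⋆[ℂ] ℂ) (z : ℂ) (B : H →L[ℂ] H) : Prop :=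
  ∀ f g : H, ∃ (hf : opK μ ψ z f ∈ formDomain μ ψ)
    (hg : ContinuousLinearMap.adjoint (opK μ ψ z) g ∈ formDomain μ ψ),
    inner ℂ g (B f) = b ⟨opK μ ψ z f, hf⟩ ⟨ContinuousLinearMap.adjoint (opK μ ψ z) g, hg⟩

open Classical in
/-- The operator `B(z)` determined by the bounded form `b(K(z) ·, K(z)* ·)`. -/
def opB (μ : ℕ+ → ℝ) (ψ : HilbertBasis ℕ+ ℂ H)
    (b : formDomain μ ψ →ₗ[ℂ] formDomain μ ψ →ₗ⋆[ℂ] ℂ) (z : ℂ) : H →L[ℂ] H :=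
  if h : ∃ B : H →L[ℂ] H, IsB μ ψ b z B then h.choose else 0

/-- `K(z) B(z)^k K(z)`. -/
def opKBK (μ : ℕ+ → ℝ) (ψ : HilbertBasis ℕ+ ℂ H)
    (b : formDomain μ ψ →ₗ[ℂ] formDomain μ ψ →ₗ⋆[ℂ] ℂ) (k : ℕ) (z : ℂ) : H →L[ℂ] H :=
  opK μ ψ z * opB μ ψ b z ^ k * opK μ ψ z

/-! ### Boxes and contour integrals -/

/-- The box `Π_0(N, h)`. -/
def boxZero (μ : ℕ+ → ℝ) (γ κ : ℝ) (N : ℕ+) (h : ℝ) : Set ℂ :=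
  {z | -h < z.re ∧ z.re < μ N + κ / 2 * (N : ℝ) ^ (γ - 1) ∧ |z.im| < h}

/-- The box `Π_k`. -/
def box (μ : ℕ+ → ℝ) (γ κ : ℝ) (k : ℕ+) : Set ℂ :=
  {z | μ k - κ / 2 * ((k : ℝ) - 1) ^ (γ - 1) < z.re ∧ z.re < μ k + κ / 2 * (k : ℝ) ^ (γ - 1) ∧
    |z.im| < κ / 2 * (k : ℝ) ^ (γ - 1)}

/-- `∮ F(z) dz` over the positively oriented boundary of `(x₀, x₁) × (y₀, y₁)`. -/
def rectIntegral {E : Type*} [NormedAddCommGroup E] [NormedSpace ℂ E]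
    (F : ℂ → E) (x₀ x₁ y₀ y₁ : ℝ) : E :=
  (∫ x : ℝ in x₀..x₁, F (x + y₀ * I)) - (∫ x : ℝ in x₀..x₁, F (x + y₁ * I)) +
    I • (∫ y : ℝ in y₀..y₁, F (x₁ + y * I)) - I • (∫ y : ℝ in y₀..y₁, F (x₀ + y * I))

/-- `(2πi)⁻¹ ∮ F(z) dz` over `Γ_n = ∂Π_n`. -/
def contour {E : Type*} [NormedAddCommGroup E] [NormedSpace ℂ E]
    (μ : ℕ+ → ℝ) (γ κ : ℝ) (n : ℕ+) (F : ℂ → E) : E :=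
  (2 * Real.pi * I : ℂ)⁻¹ • rectIntegral F
    (μ n - κ / 2 * ((n : ℝ) - 1) ^ (γ - 1)) (μ n + κ / 2 * (n : ℝ) ^ (γ - 1))
    (-(κ / 2 * (n : ℝ) ^ (γ - 1))) (κ / 2 * (n : ℝ) ^ (γ - 1))

/-! ### The terms of the expansions -/

/-- `σ_{ω,γ}(n)`. -/
def sigma (ω γ : ℝ) (n : ℕ+) : ℝ :=
  if ω ≤ 1 then (n : ℝ) ^ (-ω - γ + 1) * Real.log (Real.exp 1 * n) else (n : ℝ) ^ (-γ)

/-- `(2πi)⁻¹ ∮_{Γ_n} (z - μ_n) K(z) B(z)^k K(z) dz`. -/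
def evOp (μ : ℕ+ → ℝ) (ψ : HilbertBasis ℕ+ ℂ H)
    (b : formDomain μ ψ →ₗ[ℂ] formDomain μ ψ →ₗ⋆[ℂ] ℂ) (γ κ : ℝ) (k : ℕ) (n : ℕ+) :
    H →L[ℂ] H :=
  contour μ γ κ n (fun z => (z - (μ n : ℂ)) • opKBK μ ψ b k z)

/-- The eigenvalue correction `λ_n^{(k)}`. -/
def evCorr (μ : ℕ+ → ℝ) (ψ : HilbertBasis ℕ+ ℂ H)
    (b : formDomain μ ψ →ₗ[ℂ] formDomain μ ψ →ₗ⋆[ℂ] ℂ) (γ κ : ℝ) (k : ℕ) (n : ℕ+) : ℂ :=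
  trace ψ (evOp μ ψ b γ κ k n)

/-- The eigenvector correction `φ_n^{(k)}`. -/
def vecCorr (μ : ℕ+ → ℝ) (ψ : HilbertBasis ℕ+ ℂ H)
    (b : formDomain μ ψ →ₗ[ℂ] formDomain μ ψ →ₗ⋆[ℂ] ℂ) (γ κ : ℝ) (k : ℕ) (n : ℕ+) : H :=
  contour μ γ κ n (fun z => opKBK μ ψ b k z (ψ n))

/-- `φ_n = (2πi)⁻¹ ∮_{Γ_n} (z - T)⁻¹ ψ_n dz`. -/
def phi (μ : ℕ+ → ℝ) (ψ : HilbertBasis ℕ+ ℂ H)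
    (b : formDomain μ ψ →ₗ[ℂ] formDomain μ ψ →ₗ⋆[ℂ] ℂ) (γ κ : ℝ) (n : ℕ+) : H :=
  contour μ γ κ n (fun z => resolv (opT μ ψ b) z (ψ n))

/-- The Riesz projection `P_n = (2πi)⁻¹ ∮_{Γ_n} (z - T)⁻¹ dz`. -/
def riesz (μ : ℕ+ → ℝ) (ψ : HilbertBasis ℕ+ ℂ H)
    (b : formDomain μ ψ →ₗ[ℂ] formDomain μ ψ →ₗ⋆[ℂ] ℂ) (γ κ : ℝ) (n : ℕ+) : H →L[ℂ] H :=
  contour μ γ κ n (fun z => resolv (opT μ ψ b) z)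

end

end LocalSub

/-!
# Local form-subordinate perturbations of a diagonal operator

Write `D = A^{-1/2}` and let `B₀` be the operator with `⟨B₀ f, g⟩ = b(D f, D g)`. It is bounded:
by the subordination hypothesis the matrix of `b` is dominated by `M w_m w_n` with `w_m = m^{-α}`,
and `∑ w_m² / μ_m` converges because the gaps force `μ_m ≥ c m^γ` and `2α + γ > 1`. Consequently
`T = A^{1/2} (1 + B₀) A^{1/2}`, and `z - T` is governed by the bounded pencil
`Λ(z) = diag((z - μ_k)/μ_k) - B₀`: where `Λ(z)` is invertible, `(z - T)⁻¹ = D Λ(z)⁻¹ D`. Conjugating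
`Λ(z)` with a square root of its diagonal part gives `1 - B(z)`, where the matrix of `B(z)` is
dominated by a rank one matrix, so that `‖B(z)‖ ≤ M ∑ w_m² / |z - μ_m|`
(`IsSubordinate.norm_sandwich_le`). All estimates come from this sum.

*Localization.* For `z` near `μ_n`, and for `z` outside all boxes whose real part is closest to
`μ_n`, the gap hypothesis gives `|z - μ_m| ≥ c (|n - m| + 1) max(n, m)^{γ-1}` for the relevant `m`,
and the sum is `O(σ(n))` (`tsum_gapModel_le`). Hence there is no spectrum to the right of a vertical
line and outside the boxes, while left of the line dominated convergence bounds the spectrum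
(`IsSubordinate.exists_bound_spec`).

*One box.* Replacing the `n`-th diagonal entry of the pencil by a constant of the size of the gap
gives a pencil which is invertible on the whole closed box, and from which `Λ(z)` differs by a
multiple of a rank one projection. By the Sherman–Morrison formula the resolvent of `T` is
`X(z) + E(z)⁻¹ Y(z)` with `X`, `Y` holomorphic and `Y` of rank one. The scalar function `E` is a small
perturbation of a linear function vanishing at `μ_n`; it has exactly one zero, a simple one, in the
closed box (`IsolatedBox.exists_zero_charFun`). That zero is `λ_n`, and all statements about the
spectrum in the box, the Riesz projection and `φ_n` follow by taking residues
(`IsolatedBox.exists_eigenvalue`).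

*The expansions.* On `Γ_n` the resolvent is `∑_{k ≤ j} K B^k K + K B^{j+1} (1 - B)⁻¹ K`, with
`‖B‖ = O(σ(n))`, `‖K‖² = O(n^{1-γ})` and a contour of length `O(n^{γ-1})`, which gives the expansion
of `φ_n`. For `λ_n` one takes the trace of `(2πi)⁻¹ ∮ (z - μ_n) (z - T)⁻¹ dz = (λ_n - μ_n) P_n`. The
diagonal entries of `B^k` and of `B^{j+1} (1 - B)⁻¹` are bounded by multiples of
`M w_i² / |z - μ_i|`, with the factors `θ^{k-1}` and `2 θ^j`, `θ = O(σ(n))`, so the traces converge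
absolutely and obey the same estimates. The operators under the traces have finite rank, since
`K B^k K` is meromorphic in the box with a pole only at `μ_n`, all of whose Laurent coefficients in
the polar part have finite rank (`HasFiniteRankResidues`).
-/

open Filter Topology Asymptotics Complex

set_option linter.unusedSectionVars false

namespace LocalSub

noncomputable section

variable {H : Type*} [NormedAddCommGroup H] [InnerProductSpace ℂ H] [CompleteSpace H]

/-! ### Diagonal operators -/

/-- A bounded sequence of multipliers, with a nonnegative bound as `diagOp` asks for it. -/
def IsBddSeq (c : ℕ+ → ℂ) : Prop := ∃ M : ℝ, 0 ≤ M ∧ ∀ k, ‖c k‖ ≤ M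

lemma vec_ext_inner (ψ : HilbertBasis ℕ+ ℂ H) {f g : H}
    (h : ∀ k, inner ℂ (ψ k) f = inner ℂ (ψ k) g) : f = g := by
  apply ψ.repr.injective
  ext k
  exact ((ψ.repr_apply_apply f k).trans (h k)).trans (ψ.repr_apply_apply g k).symm

lemma op_ext_inner (ψ : HilbertBasis ℕ+ ℂ H) {S R : H →L[ℂ] H}
    (h : ∀ f k, inner ℂ (ψ k) (S f) = inner ℂ (ψ k) (R f)) : S = R :=
  ContinuousLinearMap.ext fun f => vec_ext_inner ψ (h f)

lemma inner_diagOp {ψ : HilbertBasis ℕ+ ℂ H} {c : ℕ+ → ℂ} (hc : IsBddSeq c) (f : H) (k : ℕ+) :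
    inner ℂ (ψ k) (diagOp ψ c f) = c k * inner ℂ (ψ k) f := by
  have hc' : ∃ M : ℝ, 0 ≤ M ∧ ∀ k, ‖c k‖ ≤ M := hc
  rw [← ψ.repr_apply_apply, ← ψ.repr_apply_apply]
  unfold diagOp
  simp only [hc', ↓reduceDIte]
  simp [lp.mapCLM]

lemma inner_basis (ψ : HilbertBasis ℕ+ ℂ H) (k m : ℕ+) :
    inner ℂ (ψ k) (ψ m) = if k = m then (1 : ℂ) else 0 :=
  orthonormal_iff_ite.1 ψ.orthonormal k m

lemma diagOp_basis {ψ : HilbertBasis ℕ+ ℂ H} {c : ℕ+ → ℂ} (hc : IsBddSeq c) (k : ℕ+) :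
    diagOp ψ c (ψ k) = c k • ψ k := by
  apply vec_ext_inner ψ
  intro m
  rw [inner_diagOp hc, inner_smul_right, inner_basis]
  split_ifs with h
  · rw [h]
  · simp

lemma IsBddSeq.mul {c e : ℕ+ → ℂ} (hc : IsBddSeq c) (he : IsBddSeq e) :
    IsBddSeq (fun k => c k * e k) := by
  obtain ⟨M, hM, h⟩ := hc
  obtain ⟨M', hM', h'⟩ := he
  refine ⟨M * M', by positivity, fun k => ?_⟩
  rw [norm_mul]
  exact mul_le_mul (h k) (h' k) (norm_nonneg _) hM

lemma IsBddSeq.add {c e : ℕ+ → ℂ} (hc : IsBddSeq c) (he : IsBddSeq e) :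
    IsBddSeq (fun k => c k + e k) := by
  obtain ⟨M, hM, h⟩ := hc
  obtain ⟨M', hM', h'⟩ := he
  exact ⟨M + M', by positivity, fun k => (norm_add_le _ _).trans (add_le_add (h k) (h' k))⟩

lemma isBddSeq_const (a : ℂ) : IsBddSeq (fun _ => a) := ⟨‖a‖, norm_nonneg _, fun _ => le_rfl⟩

lemma isBddSeq_ite (n : ℕ+) (a : ℂ) {c : ℕ+ → ℂ} (hc : IsBddSeq c) :
    IsBddSeq (fun k => if k = n then a else c k) := by
  obtain ⟨M, hM, h⟩ := hc
  refine ⟨‖a‖ + M, by positivity, fun k => ?_⟩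
  have := norm_nonneg a
  dsimp only
  split_ifs
  · linarith
  · linarith [h k]

lemma IsBddSeq.conj {c : ℕ+ → ℂ} (hc : IsBddSeq c) :
    IsBddSeq (fun k => starRingEnd ℂ (c k)) := by
  obtain ⟨M, hM, h⟩ := hc
  exact ⟨M, hM, fun k => by simpa using h k⟩

lemma diagOp_mul {ψ : HilbertBasis ℕ+ ℂ H} {c e : ℕ+ → ℂ} (hc : IsBddSeq c) (he : IsBddSeq e) :
    diagOp ψ c * diagOp ψ e = diagOp ψ (fun k => c k * e k) := by
  apply op_ext_inner ψ
  intro f k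
  rw [inner_diagOp (hc.mul he), mul_assoc, ← inner_diagOp he, ← inner_diagOp hc]
  rfl

lemma diagOp_add {ψ : HilbertBasis ℕ+ ℂ H} {c e : ℕ+ → ℂ} (hc : IsBddSeq c) (he : IsBddSeq e) :
    diagOp ψ c + diagOp ψ e = diagOp ψ (fun k => c k + e k) := by
  apply op_ext_inner ψ
  intro f k
  rw [add_apply, inner_add_right, inner_diagOp hc, inner_diagOp he,
    inner_diagOp (hc.add he), add_mul]

lemma diagOp_smul {ψ : HilbertBasis ℕ+ ℂ H} {c : ℕ+ → ℂ} (a : ℂ) (hc : IsBddSeq c) :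
    a • diagOp ψ c = diagOp ψ (fun k => a * c k) := by
  apply op_ext_inner ψ
  intro f k
  rw [smul_apply, inner_smul_right, inner_diagOp hc,
    inner_diagOp ((isBddSeq_const a).mul hc), mul_assoc]

lemma diagOp_const (ψ : HilbertBasis ℕ+ ℂ H) (a : ℂ) :
    diagOp ψ (fun _ => a) = a • (1 : H →L[ℂ] H) := by
  apply op_ext_inner ψ
  intro f k
  rw [inner_diagOp (isBddSeq_const a), smul_apply, inner_smul_right]
  rfl

lemma diagOp_one (ψ : HilbertBasis ℕ+ ℂ H) : diagOp ψ (fun _ => 1) = 1 := by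
  rw [diagOp_const, one_smul]

lemma norm_diagOp_le {ψ : HilbertBasis ℕ+ ℂ H} {c : ℕ+ → ℂ} {C : ℝ} (hC : 0 ≤ C)
    (h : ∀ k, ‖c k‖ ≤ C) : ‖diagOp ψ c‖ ≤ C := by
  have hc : IsBddSeq c := ⟨C, hC, h⟩
  refine ContinuousLinearMap.opNorm_le_bound _ hC fun f => ?_
  have e : ψ.repr (diagOp ψ c f) =
      lp.mapCLM 2 (E := fun _ : ℕ+ => ℂ) (F := fun _ : ℕ+ => ℂ)
        (fun k => c k • ContinuousLinearMap.id ℂ ℂ) hC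
        (fun k => by rw [norm_smul, ContinuousLinearMap.norm_id, mul_one]; exact h k)
        (ψ.repr f) := by
    ext k
    refine ((ψ.repr_apply_apply _ k).trans (inner_diagOp hc f k)).trans ?_
    rw [← ψ.repr_apply_apply]
    simp [lp.mapCLM]
  rw [← ψ.repr.norm_map, e, ← ψ.repr.norm_map f]
  exact ContinuousLinearMap.le_of_opNorm_le _ (lp.norm_mapCLM_le _ _ _ _) _

lemma hasSum_conj_inner_mul_inner (ψ : HilbertBasis ℕ+ ℂ H) (f g : H) :
    HasSum (fun k => starRingEnd ℂ (inner ℂ (ψ k) f) * inner ℂ (ψ k) g) (inner ℂ f g) := by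
  simpa only [inner_conj_symm] using ψ.hasSum_inner_mul_inner f g

lemma adjoint_diagOp {ψ : HilbertBasis ℕ+ ℂ H} {c : ℕ+ → ℂ} (hc : IsBddSeq c) :
    ContinuousLinearMap.adjoint (diagOp ψ c) = diagOp ψ (fun k => starRingEnd ℂ (c k)) := by
  symm
  rw [ContinuousLinearMap.eq_adjoint_iff]
  intro f g
  refine (hasSum_conj_inner_mul_inner ψ _ _).unique ?_
  have h := hasSum_conj_inner_mul_inner ψ f (diagOp ψ c g)
  convert h using 2 with k
  rw [inner_diagOp hc, inner_diagOp hc.conj, map_mul, Complex.conj_conj]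
  ring

/-- Parseval's identity in coordinates. -/
lemma hasSum_sq_norm_inner (ψ : HilbertBasis ℕ+ ℂ H) (f : H) :
    HasSum (fun k => ‖inner ℂ (ψ k) f‖ ^ 2) (‖f‖ ^ 2) := by
  have h := (hasSum_conj_inner_mul_inner ψ f f).mapL Complex.reCLM
  have e : Complex.reCLM (inner ℂ f f) = ‖f‖ ^ 2 := by
    rw [inner_self_eq_norm_sq_to_K]
    norm_cast
  rw [e] at h
  convert h using 2 with k
  rw [← Complex.normSq_eq_norm_sq, ← Complex.normSq_eq_conj_mul_self]
  simp

/-- Cauchy–Schwarz for the coordinates of `f` against a square summable weight. -/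
lemma summable_mul_norm_inner (ψ : HilbertBasis ℕ+ ℂ H) {v : ℕ+ → ℝ} (hv : ∀ k, 0 ≤ v k)
    (hs : Summable fun k => v k ^ 2) (f : H) :
    (Summable fun k => v k * ‖inner ℂ (ψ k) f‖) ∧
      ∑' k, v k * ‖inner ℂ (ψ k) f‖ ≤ √(∑' k, v k ^ 2) * ‖f‖ := by
  have hf := hasSum_sq_norm_inner ψ f
  have hpq : (2 : ℝ).HolderConjugate 2 := by constructor <;> norm_num
  have hf2 : Summable fun k => ‖(inner ℂ (ψ k) f : ℂ)‖ ^ (2 : ℝ) := by simpa using hf.summable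
  have hv2 : Summable fun k => v k ^ (2 : ℝ) := by simpa using hs
  refine ⟨Real.summable_mul_of_Lp_Lq_of_nonneg hpq hv (fun k => norm_nonneg _) hv2 hf2,
    (Real.inner_le_Lp_mul_Lq_tsum_of_nonneg hpq hv (fun k => norm_nonneg _) hv2 hf2).trans
      (le_of_eq ?_)⟩
  simp only [Real.rpow_two, hf.tsum_eq, ← Real.sqrt_eq_rpow]
  rw [Real.sqrt_sq (norm_nonneg _)]

/-! ### The form domain and the operator of the form -/

/-- The multipliers `μ_k^{-1/2}` of `A^{-1/2}`. -/
def invSqrt (μ : ℕ+ → ℝ) (k : ℕ+) : ℂ := ((√(μ k))⁻¹ : ℝ)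

lemma isBddSeq_invSqrt {μ : ℕ+ → ℝ} {c : ℝ} (hc : 0 < c) (h : ∀ k, c ≤ μ k) :
    IsBddSeq (invSqrt μ) := by
  refine ⟨(√c)⁻¹, by positivity, fun k => ?_⟩
  rw [invSqrt, Complex.norm_real, Real.norm_of_nonneg (by positivity)]
  exact inv_anti₀ (Real.sqrt_pos.2 hc) (Real.sqrt_le_sqrt (h k))

lemma sqrt_mul_invSqrt {μ : ℕ+ → ℝ} {k : ℕ+} (h : 0 < μ k) :
    ((√(μ k) : ℝ) : ℂ) * invSqrt μ k = 1 := by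
  rw [invSqrt, ← Complex.ofReal_mul, mul_inv_cancel₀ (Real.sqrt_pos.2 h).ne', Complex.ofReal_one]

lemma conj_invSqrt (μ : ℕ+ → ℝ) (k : ℕ+) : starRingEnd ℂ (invSqrt μ k) = invSqrt μ k :=
  Complex.conj_ofReal _

lemma norm_invSqrt (μ : ℕ+ → ℝ) (k : ℕ+) : ‖invSqrt μ k‖ = (√(μ k))⁻¹ := by
  rw [invSqrt, Complex.norm_real, Real.norm_of_nonneg (by positivity)]

lemma inner_sqrtA {μ : ℕ+ → ℝ} {ψ : HilbertBasis ℕ+ ℂ H} (f : formDomain μ ψ) (k : ℕ+) :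
    inner ℂ (ψ k) (sqrtA μ ψ f) = ((√(μ k) : ℝ) : ℂ) * inner ℂ (ψ k) (f : H) := by
  rw [← ψ.repr_apply_apply, ← ψ.repr_apply_apply]
  simp [sqrtA]

/-- The operator `A^{-1/2}`. -/
abbrev invSqrtA (μ : ℕ+ → ℝ) (ψ : HilbertBasis ℕ+ ℂ H) : H →L[ℂ] H := diagOp ψ (invSqrt μ)

/-- The data of the perturbed operator with abstract weights: `μ` is bounded below by a positive
constant, and the matrix of `b`, which determines `b`, is dominated by `M w_m w_n` with
`∑ w_k² / μ_k < ∞`. -/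
structure IsSubordinate (μ : ℕ+ → ℝ) (ψ : HilbertBasis ℕ+ ℂ H)
    (b : formDomain μ ψ →ₗ[ℂ] formDomain μ ψ →ₗ⋆[ℂ] ℂ) (w : ℕ+ → ℝ) (M : ℝ) : Prop where
  lower : ∃ c > 0, ∀ k, c ≤ μ k
  weight_nonneg : ∀ k, 0 ≤ w k
  const_pos : 0 < M
  bound : ∀ m n, ‖b (basisVec μ ψ m) (basisVec μ ψ n)‖ ≤ M * (w m * w n)
  lim : ∀ f g : formDomain μ ψ,
      Tendsto (fun n => b (trunc μ ψ n f) (trunc μ ψ n g)) atTop (𝓝 (b f g))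
  summable : Summable fun k => w k ^ 2 / μ k

namespace IsSubordinate

variable {μ : ℕ+ → ℝ} {ψ : HilbertBasis ℕ+ ℂ H}
    {b : formDomain μ ψ →ₗ[ℂ] formDomain μ ψ →ₗ⋆[ℂ] ℂ} {w : ℕ+ → ℝ} {M : ℝ}

lemma pos (hS : IsSubordinate μ ψ b w M) (k : ℕ+) : 0 < μ k := by
  obtain ⟨c, hc, h⟩ := hS.lower
  exact hc.trans_le (h k)

lemma bdd_invSqrt (hS : IsSubordinate μ ψ b w M) : IsBddSeq (invSqrt μ) := by
  obtain ⟨c, hc, h⟩ := hS.lower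
  exact isBddSeq_invSqrt hc h

lemma invSqrtA_mem (hS : IsSubordinate μ ψ b w M) (f : H) :
    invSqrtA μ ψ f ∈ formDomain μ ψ := by
  have h : (fun k => ((√(μ k) : ℝ) : ℂ) * ψ.repr (invSqrtA μ ψ f) k) = fun k => ψ.repr f k := by
    funext k
    rw [ψ.repr_apply_apply, ψ.repr_apply_apply, inner_diagOp hS.bdd_invSqrt, ← mul_assoc,
      sqrt_mul_invSqrt (hS.pos k), one_mul]
  change Memℓp _ 2
  rw [h]
  exact lp.memℓp (ψ.repr f)

lemma sqrtA_invSqrtA (hS : IsSubordinate μ ψ b w M) (f : H) (h : invSqrtA μ ψ f ∈ formDomain μ ψ) :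
    sqrtA μ ψ ⟨invSqrtA μ ψ f, h⟩ = f := by
  apply vec_ext_inner ψ
  intro k
  rw [inner_sqrtA, inner_diagOp hS.bdd_invSqrt, ← mul_assoc, sqrt_mul_invSqrt (hS.pos k), one_mul]

lemma invSqrtA_sqrtA (hS : IsSubordinate μ ψ b w M) (f : formDomain μ ψ) :
    invSqrtA μ ψ (sqrtA μ ψ f) = f := by
  apply vec_ext_inner ψ
  intro k
  rw [inner_diagOp hS.bdd_invSqrt, inner_sqrtA, ← mul_assoc, mul_comm (invSqrt μ k),
    sqrt_mul_invSqrt (hS.pos k), one_mul]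

lemma invSqrtA_injective (hS : IsSubordinate μ ψ b w M) :
    Function.Injective (invSqrtA μ ψ) := by
  intro f g h
  rw [← hS.sqrtA_invSqrtA f (hS.invSqrtA_mem f), ← hS.sqrtA_invSqrtA g (hS.invSqrtA_mem g)]
  congr 1
  exact Subtype.ext h

lemma inner_invSqrtA_left (hS : IsSubordinate μ ψ b w M) (f g : H) :
    inner ℂ (invSqrtA μ ψ f) g = inner ℂ f (invSqrtA μ ψ g) := by
  refine (hasSum_conj_inner_mul_inner ψ _ _).unique ?_
  have h := hasSum_conj_inner_mul_inner ψ f (invSqrtA μ ψ g)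
  convert h using 2 with k
  rw [inner_diagOp hS.bdd_invSqrt, inner_diagOp hS.bdd_invSqrt, map_mul, conj_invSqrt]
  ring

/-- The bound on the matrix of `b` passes to the form through the truncations that determine it. -/
lemma norm_form_le (hS : IsSubordinate μ ψ b w M) (f g : formDomain μ ψ)
    (hf : Summable fun k => w k * ‖inner ℂ (ψ k) (f : H)‖)
    (hg : Summable fun k => w k * ‖inner ℂ (ψ k) (g : H)‖) :
    ‖b f g‖ ≤ M * ((∑' k, w k * ‖inner ℂ (ψ k) (f : H)‖) *
      ∑' k, w k * ‖inner ℂ (ψ k) (g : H)‖) := by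
  have hw := hS.weight_nonneg
  refine le_of_tendsto (hS.lim f g).norm (Eventually.of_forall fun n => ?_)
  have e : b (trunc μ ψ n f) (trunc μ ψ n g) =
      ∑ k ∈ Finset.Icc 1 n, ∑ l ∈ Finset.Icc 1 n, inner ℂ (ψ k) (f : H) *
        (starRingEnd ℂ (inner ℂ (ψ l) (g : H)) * b (basisVec μ ψ k) (basisVec μ ψ l)) := by
    simp only [trunc, map_sum, LinearMap.sum_apply, map_smul, LinearMap.smul_apply, smul_eq_mul,
      LinearMap.map_smulₛₗ, HilbertBasis.repr_apply_apply, Finset.mul_sum]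
    rw [Finset.sum_comm]
    exact Finset.sum_congr rfl fun k _ => Finset.sum_congr rfl fun l _ => by ring
  have hM := hS.const_pos
  calc ‖b (trunc μ ψ n f) (trunc μ ψ n g)‖
      ≤ ∑ k ∈ Finset.Icc 1 n, ∑ l ∈ Finset.Icc 1 n, M * ((w k * ‖inner ℂ (ψ k) (f : H)‖) *
          (w l * ‖inner ℂ (ψ l) (g : H)‖)) := by
        rw [e]
        refine (norm_sum_le _ _).trans (Finset.sum_le_sum fun k _ => ?_)
        refine (norm_sum_le _ _).trans (Finset.sum_le_sum fun l _ => ?_)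
        rw [norm_mul, norm_mul, RCLike.norm_conj]
        have h := mul_le_mul_of_nonneg_left (hS.bound k l) (mul_nonneg
          (norm_nonneg (inner ℂ (ψ k) (f : H))) (norm_nonneg (inner ℂ (ψ l) (g : H))))
        linarith
    _ = M * ((∑ k ∈ Finset.Icc 1 n, w k * ‖inner ℂ (ψ k) (f : H)‖) *
          ∑ l ∈ Finset.Icc 1 n, w l * ‖inner ℂ (ψ l) (g : H)‖) := by
        rw [Finset.sum_mul_sum, Finset.mul_sum]
        simp only [Finset.mul_sum]
    _ ≤ _ := by
        refine mul_le_mul_of_nonneg_left ?_ hM.le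
        have h0 : ∀ (f : H) k, 0 ≤ w k * ‖inner ℂ (ψ k) f‖ :=
          fun f k => mul_nonneg (hw k) (norm_nonneg _)
        exact mul_le_mul (hf.sum_le_tsum _ fun k _ => h0 _ k)
          (hg.sum_le_tsum _ fun k _ => h0 _ k) (Finset.sum_nonneg fun k _ => h0 _ k)
          (tsum_nonneg fun k => h0 _ k)

/-- The weights `v_k = w_k μ_k^{-1/2}`. They are square summable for the `μ` of a subordinate form,
and also for `|ζ_k|` in place of `μ_k` when `ζ` is comparable with `μ`. -/
def _root_.LocalSub.relWeight (μ w : ℕ+ → ℝ) (k : ℕ+) : ℝ := w k * (√(μ k))⁻¹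

lemma relWeight_nonneg (hS : IsSubordinate μ ψ b w M) (k : ℕ+) : 0 ≤ relWeight μ w k :=
  mul_nonneg (hS.weight_nonneg k) (by positivity)

lemma relWeight_sq (hS : IsSubordinate μ ψ b w M) (k : ℕ+) :
    relWeight μ w k ^ 2 = w k ^ 2 / μ k := by
  rw [relWeight, mul_pow, inv_pow, Real.sq_sqrt (hS.pos k).le, div_eq_mul_inv]

lemma summable_relWeight_sq (hS : IsSubordinate μ ψ b w M) :
    Summable fun k => relWeight μ w k ^ 2 := by
  simpa only [hS.relWeight_sq] using hS.summable

/-- `A^{-1/2}` as a linear map onto the form domain. -/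
def toFormDomain (hS : IsSubordinate μ ψ b w M) : H →ₗ[ℂ] formDomain μ ψ :=
  LinearMap.codRestrict (formDomain μ ψ) (invSqrtA μ ψ : H →ₗ[ℂ] H) hS.invSqrtA_mem

lemma norm_form_toFormDomain_le (hS : IsSubordinate μ ψ b w M) (f g : H) :
    ‖b (hS.toFormDomain f) (hS.toFormDomain g)‖ ≤
      M * ((∑' k, relWeight μ w k * ‖inner ℂ (ψ k) f‖) *
        ∑' k, relWeight μ w k * ‖inner ℂ (ψ k) g‖) := by
  have e : ∀ f : H, (fun k => w k * ‖inner ℂ (ψ k) ((hS.toFormDomain f : formDomain μ ψ) : H)‖) =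
      fun k => relWeight μ w k * ‖inner ℂ (ψ k) f‖ := by
    intro f
    funext k
    have : inner ℂ (ψ k) ((hS.toFormDomain f : formDomain μ ψ) : H) =
      invSqrt μ k * inner ℂ (ψ k) f := inner_diagOp hS.bdd_invSqrt f k
    rw [this, norm_mul, norm_invSqrt, relWeight, mul_assoc]
  have hs : ∀ f : H, Summable fun k => relWeight μ w k * ‖inner ℂ (ψ k) f‖ :=
    fun f => (summable_mul_norm_inner ψ hS.relWeight_nonneg hS.summable_relWeight_sq f).1
  have h := hS.norm_form_le (hS.toFormDomain f) (hS.toFormDomain g)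
    (by rw [e]; exact hs f) (by rw [e]; exact hs g)
  rwa [e, e] at h

/-- The form `b(A^{-1/2} ·, A^{-1/2} ·)` is bounded by Cauchy–Schwarz with the weights `v`. -/
lemma exists_formOp (hS : IsSubordinate μ ψ b w M) :
    ∃ B : H →L[ℂ] H, ∀ f g : H, inner ℂ g (B f) = b (hS.toFormDomain f) (hS.toFormDomain g) := by
  set S := √(∑' k, relWeight μ w k ^ 2)
  have hv := summable_mul_norm_inner ψ hS.relWeight_nonneg hS.summable_relWeight_sq
  let B₀ : H →ₗ⋆[ℂ] H →ₗ[ℂ] ℂ := LinearMap.mk₂'ₛₗ (starRingEnd ℂ) (RingHom.id ℂ)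
    (fun g f => b (hS.toFormDomain f) (hS.toFormDomain g))
    (fun g g' f => by simp) (fun c g f => by simp) (fun g f f' => by simp)
    (fun c g f => by simp)
  let B₁ : H →L⋆[ℂ] H →L[ℂ] ℂ := B₀.mkContinuous₂ (M * (S * S)) (by
    intro g f
    have h := hS.norm_form_toFormDomain_le f g
    calc ‖B₀ g f‖ ≤ _ := h
      _ ≤ M * ((S * ‖f‖) * (S * ‖g‖)) := by
        refine mul_le_mul_of_nonneg_left ?_ hS.const_pos.le
        exact mul_le_mul (hv f).2 (hv g).2
          (tsum_nonneg fun k => mul_nonneg (hS.relWeight_nonneg k) (norm_nonneg _)) (by positivity)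
      _ = M * (S * S) * ‖g‖ * ‖f‖ := by ring)
  refine ⟨ContinuousLinearMap.adjoint (InnerProductSpace.continuousLinearMapOfBilin B₁),
    fun f g => ?_⟩
  rw [ContinuousLinearMap.adjoint_inner_right, InnerProductSpace.continuousLinearMapOfBilin_apply]
  rfl

/-- The bounded operator `B₀` of the form `b(A^{-1/2} ·, A^{-1/2} ·)`. -/
def formOp (hS : IsSubordinate μ ψ b w M) : H →L[ℂ] H := hS.exists_formOp.choose

lemma inner_formOp (hS : IsSubordinate μ ψ b w M) (f g : H) :
    inner ℂ g (hS.formOp f) = b (hS.toFormDomain f) (hS.toFormDomain g) :=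
  hS.exists_formOp.choose_spec f g

lemma norm_inner_formOp_le (hS : IsSubordinate μ ψ b w M) (f g : H) :
    ‖inner ℂ g (hS.formOp f)‖ ≤
      M * ((∑' k, relWeight μ w k * ‖inner ℂ (ψ k) f‖) *
        ∑' k, relWeight μ w k * ‖inner ℂ (ψ k) g‖) := by
  rw [hS.inner_formOp]
  exact hS.norm_form_toFormDomain_le f g

/-- The form operator `T` in terms of bounded operators: `T f = y` if and only if
`f = A^{-1/2} x` and `A^{-1/2} y = (1 + B₀) x` for some `x`. -/
lemma mem_graph_opT (hS : IsSubordinate μ ψ b w M) (f y : H) :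
    (f, y) ∈ (opT μ ψ b).graph ↔
      ∃ hf : f ∈ formDomain μ ψ, sqrtA μ ψ ⟨f, hf⟩ + hS.formOp (sqrtA μ ψ ⟨f, hf⟩) =
        invSqrtA μ ψ y := by
  have key : ∀ (f y : H), (f, y) ∈ formGraph (formDomain μ ψ) (formA μ ψ + b) ↔
      ∃ hf : f ∈ formDomain μ ψ, sqrtA μ ψ ⟨f, hf⟩ + hS.formOp (sqrtA μ ψ ⟨f, hf⟩) =
        invSqrtA μ ψ y := by
    intro f y
    refine exists_congr fun hf => ?_
    have e : ∀ g : H, (formA μ ψ + b) ⟨f, hf⟩ (hS.toFormDomain g) =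
        inner ℂ g (sqrtA μ ψ ⟨f, hf⟩ + hS.formOp (sqrtA μ ψ ⟨f, hf⟩)) := by
      intro g
      have h1 : sqrtA μ ψ (hS.toFormDomain g) = g := hS.sqrtA_invSqrtA g _
      have h2 : hS.toFormDomain (sqrtA μ ψ ⟨f, hf⟩) = ⟨f, hf⟩ :=
        Subtype.ext (hS.invSqrtA_sqrtA ⟨f, hf⟩)
      rw [inner_add_right, hS.inner_formOp, h2, LinearMap.add_apply, LinearMap.add_apply]
      simp only [formA, LinearMap.mk₂'ₛₗ_apply, h1]
    constructor
    · intro h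
      refine ext_inner_left ℂ fun g => ?_
      rw [← e, h, ← hS.inner_invSqrtA_left]
      rfl
    · intro h g
      have h2 : hS.toFormDomain (sqrtA μ ψ g) = g := Subtype.ext (hS.invSqrtA_sqrtA g)
      conv_lhs => rw [← h2]
      rw [e, h, ← hS.inner_invSqrtA_left, hS.invSqrtA_sqrtA]
  rw [opT, formOperator, Submodule.toLinearPMap_graph_eq]
  · exact key f y
  · rintro ⟨f, y⟩ hx rfl
    obtain ⟨hf, h⟩ := (key _ _).1 hx
    have h0 : sqrtA μ ψ ⟨0, hf⟩ = 0 := map_zero _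
    apply hS.invSqrtA_injective
    rw [map_zero, ← h, h0, map_zero, add_zero]

end IsSubordinate

/-! ### The resolvent set of the self-adjoint operator -/

lemma IsResolventAt.unique {T : H →ₗ.[ℂ] H} {z : ℂ} {R R' : H →L[ℂ] H}
    (h : IsResolventAt T z R) (h' : IsResolventAt T z R') : R = R' := by
  ext f
  obtain ⟨hf, e⟩ := h.1 f
  have e' := h'.2 ⟨R f, hf⟩
  rw [e] at e'
  exact e'.symm

lemma resolv_eq {T : H →ₗ.[ℂ] H} {z : ℂ} {R : H →L[ℂ] H} (h : IsResolventAt T z R) :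
    resolv T z = R := by
  have hex : ∃ R : H →L[ℂ] H, IsResolventAt T z R := ⟨R, h⟩
  unfold resolv
  rw [dif_pos hex]
  exact hex.choose_spec.unique h

lemma IsEigenvector.resolvent_apply {T : H →ₗ.[ℂ] H} {z c : ℂ} {f : H} {R : H →L[ℂ] H}
    (hf : IsEigenvector T c f) (h : IsResolventAt T z R) : (z - c) • R f = f := by
  obtain ⟨hd, e⟩ := hf.2
  have h2 := h.2 ⟨f, hd⟩
  rw [e] at h2
  change R (z • f - c • f) = f at h2
  rw [← sub_smul, map_smul] at h2
  exact h2

/-- The resolvent maps `ψ_k` to `(z - μ_k)⁻¹ ψ_k`, so its norm controls the distance of `z` from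
the eigenvalues. -/
lemma exists_le_norm_sub_of_mem_resSet {A : H →ₗ.[ℂ] H} {μ : ℕ+ → ℝ} {ψ : HilbertBasis ℕ+ ℂ H}
    (hψ : ∀ k, IsEigenvector A (μ k) (ψ k)) {z : ℂ} (hz : z ∈ resSet A) :
    ∃ c > 0, ∀ k, c ≤ ‖z - μ k‖ := by
  obtain ⟨R, hR⟩ := hz
  refine ⟨(‖R‖ + 1)⁻¹, by positivity, fun k => ?_⟩
  have h := congrArg norm ((hψ k).resolvent_apply hR)
  rw [norm_smul, ψ.orthonormal.1 k] at h
  have h1 : ‖R (ψ k)‖ ≤ ‖R‖ := by simpa [ψ.orthonormal.1 k] using R.le_opNorm (ψ k)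
  rw [inv_le_iff_one_le_mul₀ (by positivity)]
  nlinarith [norm_nonneg (z - μ k), norm_nonneg R]

/-- A point at positive distance from the eigenvalues of `A` is in the resolvent set, because
`A` is its own adjoint and hence has no proper extension by a diagonal operator. -/
lemma mem_resSet_of_le_norm_sub {A : H →ₗ.[ℂ] H} (hA : IsSelfAdjoint A) {μ : ℕ+ → ℝ}
    {ψ : HilbertBasis ℕ+ ℂ H} (hψ : ∀ k, IsEigenvector A (μ k) (ψ k)) {z : ℂ} {c : ℝ}
    (hc : 0 < c) (h : ∀ k, c ≤ ‖z - μ k‖) : z ∈ resSet A := by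
  have hd := hA.dense_domain
  have hadj := LinearPMap.isSelfAdjoint_def.1 hA
  have hbdd : IsBddSeq (fun k => (z - μ k)⁻¹) :=
    ⟨c⁻¹, by positivity, fun k => by rw [norm_inv]; exact inv_anti₀ hc (h k)⟩
  have hne : ∀ k, z - μ k ≠ 0 := fun k => norm_pos_iff.1 (hc.trans_le (h k))
  have hsym : ∀ x y : A.domain, inner ℂ (A x) (y : H) = inner ℂ (x : H) (A y) := by
    have := LinearPMap.adjoint_isFormalAdjoint hd
    rw [hadj] at this
    exact this
  have hcoef : ∀ (k) (g : A.domain), inner ℂ (ψ k) (A g) = μ k * inner ℂ (ψ k) (g : H) := by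
    intro k g
    obtain ⟨hk, e⟩ := (hψ k).2
    have := hsym ⟨ψ k, hk⟩ g
    rw [← this, e, inner_smul_left, Complex.conj_ofReal]
  refine ⟨diagOp ψ (fun k => (z - μ k)⁻¹), fun f => ?_, fun g => ?_⟩
  · set R := diagOp ψ (fun k => (z - μ k)⁻¹)
    have key : ∀ g : A.domain, inner ℂ (z • R f - f) (g : H) = inner ℂ (R f) (A g) := by
      intro g
      refine (hasSum_conj_inner_mul_inner ψ _ _).unique ?_
      have h' := hasSum_conj_inner_mul_inner ψ (R f) (A g)
      convert h' using 2 with k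
      rw [hcoef, inner_sub_right, inner_smul_right, inner_diagOp hbdd]
      have e : z * ((z - μ k)⁻¹ * inner ℂ (ψ k) f) - inner ℂ (ψ k) f =
          μ k * ((z - μ k)⁻¹ * inner ℂ (ψ k) f) := by
        have := hne k
        field_simp
        ring
      rw [e, map_mul (starRingEnd ℂ) (μ k : ℂ), Complex.conj_ofReal]
      ring
    have hmem : R f ∈ A.adjoint.domain :=
      LinearPMap.mem_adjoint_domain_of_exists _ ⟨_, key⟩
    have hval : A.adjoint ⟨R f, hmem⟩ = z • R f - f := LinearPMap.adjoint_apply_eq hd _ key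
    have hmem' : R f ∈ A.domain := hadj ▸ hmem
    refine ⟨hmem', ?_⟩
    have hle : A.adjoint ≤ A := le_of_eq hadj
    rw [← hle.2 (x := ⟨R f, hmem⟩) (y := ⟨R f, hmem'⟩) rfl, hval]
    abel
  · apply vec_ext_inner ψ
    intro k
    rw [inner_diagOp hbdd, inner_sub_right, inner_smul_right, hcoef, ← sub_mul, ← mul_assoc,
      inv_mul_cancel₀ (hne k), one_mul]

/-! ### Diagonal multipliers and the sandwiched operators -/

/-- Multipliers comparable with `μ`, such as `z - μ_k` for `z` in the resolvent set of `A`. -/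
def IsComparable (μ : ℕ+ → ℝ) (ζ : ℕ+ → ℂ) : Prop :=
  ∃ c > 0, ∃ C : ℝ, ∀ k, c * μ k ≤ ‖ζ k‖ ∧ ‖ζ k‖ ≤ C * μ k

/-- `(ζ_k / μ_k)^{-1/2}`, computed with the branch of `opK`. -/
def rootMul (μ : ℕ+ → ℝ) (ζ : ℕ+ → ℂ) (k : ℕ+) : ℂ := ζ k ^ (-(1 / 2) : ℂ) * ((√(μ k) : ℝ) : ℂ)

lemma cpow_neg_half_mul_self {x : ℂ} (hx : x ≠ 0) :
    x ^ (-(1 / 2) : ℂ) * x ^ (-(1 / 2) : ℂ) = x⁻¹ := by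
  rw [← Complex.cpow_add _ _ hx, ← Complex.cpow_neg_one]
  norm_num

lemma norm_cpow_neg_half {x : ℂ} (hx : x ≠ 0) : ‖x ^ (-(1 / 2) : ℂ)‖ = (√‖x‖)⁻¹ := by
  rw [← Real.sqrt_inv, ← norm_inv, ← cpow_neg_half_mul_self hx, norm_mul,
    Real.sqrt_mul_self (norm_nonneg _)]

namespace IsSubordinate

variable {μ : ℕ+ → ℝ} {ψ : HilbertBasis ℕ+ ℂ H}
    {b : formDomain μ ψ →ₗ[ℂ] formDomain μ ψ →ₗ⋆[ℂ] ℂ} {w : ℕ+ → ℝ} {M : ℝ} {ζ : ℕ+ → ℂ}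

lemma ne_zero (hS : IsSubordinate μ ψ b w M) (hζ : IsComparable μ ζ) (k : ℕ+) : ζ k ≠ 0 := by
  obtain ⟨c, hc, C, h⟩ := hζ
  exact norm_pos_iff.1 ((mul_pos hc (hS.pos k)).trans_le (h k).1)

/-- A bounded perturbation of `-μ` that stays away from zero is comparable with `μ`. -/
lemma comparable_of_le (hS : IsSubordinate μ ψ b w M) {c R : ℝ} (hc : 0 < c)
    (h : ∀ k, c ≤ ‖ζ k‖) (hR : ∀ k, ‖ζ k + μ k‖ ≤ R) : IsComparable μ ζ := by
  obtain ⟨m, hm, hμ⟩ := hS.lower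
  have hR0 : 0 ≤ R := (norm_nonneg _).trans (hR 1)
  refine ⟨min (1 / 2) (c / (2 * R + 1)), by positivity, 1 + R / m, fun k => ⟨?_, ?_⟩⟩
  · have hk := hS.pos k
    rcases le_total (2 * R) (μ k) with h1 | h1
    · have : μ k - ‖ζ k + μ k‖ ≤ ‖ζ k‖ := by
        have := norm_sub_norm_le (μ k : ℂ) (ζ k + μ k)
        rwa [Complex.norm_real, Real.norm_of_nonneg hk.le, sub_add_cancel_right, norm_neg] at this
      have h2 : min (1 / 2) (c / (2 * R + 1)) * μ k ≤ 1 / 2 * μ k :=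
        mul_le_mul_of_nonneg_right (min_le_left _ _) hk.le
      linarith [hR k]
    · have h2 : min (1 / 2) (c / (2 * R + 1)) * μ k ≤ c / (2 * R + 1) * μ k :=
        mul_le_mul_of_nonneg_right (min_le_right _ _) hk.le
      have h3 : c / (2 * R + 1) * μ k ≤ c := by
        rw [div_mul_eq_mul_div, div_le_iff₀ (by positivity)]
        nlinarith
      linarith [h k]
  · have hk := hS.pos k
    have h1 : R ≤ R / m * μ k := by
      rw [div_mul_eq_mul_div, le_div_iff₀ hm]
      exact mul_le_mul_of_nonneg_left (hμ k) hR0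
    have h2 := norm_sub_le (ζ k + μ k) (μ k)
    rw [add_sub_cancel_right, Complex.norm_real, Real.norm_of_nonneg hk.le] at h2
    linarith [hR k]

lemma comparable_sub (hS : IsSubordinate μ ψ b w M) {z : ℂ} (hz : ∃ c > 0, ∀ k, c ≤ ‖z - μ k‖) :
    IsComparable μ (fun k => z - μ k) := by
  obtain ⟨c, hc, h⟩ := hz
  exact hS.comparable_of_le hc h (R := ‖z‖) fun k => by simp

lemma norm_rootMul (hS : IsSubordinate μ ψ b w M) (hζ : IsComparable μ ζ) (k : ℕ+) :
    ‖rootMul μ ζ k‖ = √(μ k) * (√‖ζ k‖)⁻¹ := by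
  rw [rootMul, norm_mul, norm_cpow_neg_half (hS.ne_zero hζ k), Complex.norm_real,
    Real.norm_of_nonneg (Real.sqrt_nonneg _), mul_comm]

lemma rootMul_mul_self (hS : IsSubordinate μ ψ b w M) (hζ : IsComparable μ ζ) (k : ℕ+) :
    rootMul μ ζ k * rootMul μ ζ k = μ k / ζ k := by
  rw [rootMul, mul_mul_mul_comm, cpow_neg_half_mul_self (hS.ne_zero hζ k), ← Complex.ofReal_mul,
    Real.mul_self_sqrt (hS.pos k).le]
  ring

lemma rootMul_ne_zero (hS : IsSubordinate μ ψ b w M) (hζ : IsComparable μ ζ) (k : ℕ+) :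
    rootMul μ ζ k ≠ 0 := by
  have := hS.rootMul_mul_self hζ k
  intro h
  rw [h, mul_zero] at this
  have h2 : (μ k : ℂ) ≠ 0 := by exact_mod_cast (hS.pos k).ne'
  exact div_ne_zero h2 (hS.ne_zero hζ k) this.symm

lemma bdd_rootMul (hS : IsSubordinate μ ψ b w M) (hζ : IsComparable μ ζ) :
    IsBddSeq (rootMul μ ζ) := by
  have hn := hS.norm_rootMul hζ
  have h0 := hS.ne_zero hζ
  obtain ⟨c, hc, C, h⟩ := hζ
  refine ⟨(√c)⁻¹, by positivity, fun k => ?_⟩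
  have hk := hS.pos k
  rw [hn, ← div_eq_mul_inv, ← Real.sqrt_div hk.le, ← Real.sqrt_inv]
  refine Real.sqrt_le_sqrt ?_
  rw [div_le_iff₀ (norm_pos_iff.2 (h0 k)), inv_mul_eq_div, le_div_iff₀ hc]
  linarith [(h k).1]

lemma bdd_rootMul_inv (hS : IsSubordinate μ ψ b w M) (hζ : IsComparable μ ζ) :
    IsBddSeq (fun k => (rootMul μ ζ k)⁻¹) := by
  have hn := hS.norm_rootMul hζ
  obtain ⟨c, hc, C, h⟩ := hζ
  refine ⟨√C, by positivity, fun k => ?_⟩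
  have hk := hS.pos k
  rw [norm_inv, hn, mul_inv, inv_inv, mul_comm, ← div_eq_mul_inv, ← Real.sqrt_div (norm_nonneg _)]
  refine Real.sqrt_le_sqrt ?_
  rw [div_le_iff₀ hk]
  exact (h k).2

lemma bdd_div (hS : IsSubordinate μ ψ b w M) (hζ : IsComparable μ ζ) :
    IsBddSeq (fun k => ζ k / μ k) := by
  obtain ⟨c, hc, C, h⟩ := hζ
  refine ⟨|C|, by positivity, fun k => ?_⟩
  have hk := hS.pos k
  rw [norm_div, Complex.norm_real, Real.norm_of_nonneg hk.le, div_le_iff₀ hk]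
  exact (h k).2.trans (mul_le_mul_of_nonneg_right (le_abs_self C) hk.le)

/-- `diag(u) B₀ diag(u)` with `u_k = (ζ_k / μ_k)^{-1/2}`; for `ζ_k = z - μ_k` this is `B(z)`. -/
def sandwich (hS : IsSubordinate μ ψ b w M) (ζ : ℕ+ → ℂ) : H →L[ℂ] H :=
  diagOp ψ (rootMul μ ζ) * hS.formOp * diagOp ψ (rootMul μ ζ)

/-- The pencil `diag(ζ_k / μ_k) - B₀`; for `ζ_k = z - μ_k` it is `A^{-1/2} (z - T) A^{-1/2}`
up to domains. -/
def pencil (hS : IsSubordinate μ ψ b w M) (ζ : ℕ+ → ℂ) : H →L[ℂ] H :=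
  diagOp ψ (fun k => ζ k / μ k) - hS.formOp

lemma inner_sandwich (hS : IsSubordinate μ ψ b w M) (hζ : IsComparable μ ζ) (f g : H) :
    inner ℂ g (hS.sandwich ζ f) =
      inner ℂ (diagOp ψ (fun k => starRingEnd ℂ (rootMul μ ζ k)) g)
        (hS.formOp (diagOp ψ (rootMul μ ζ) f)) := by
  rw [← adjoint_diagOp (hS.bdd_rootMul hζ), ContinuousLinearMap.adjoint_inner_left]
  rfl

lemma norm_inner_sandwich_le (hS : IsSubordinate μ ψ b w M) (hζ : IsComparable μ ζ) (f g : H) :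
    ‖inner ℂ g (hS.sandwich ζ f)‖ ≤
      M * ((∑' k, relWeight (fun k => ‖ζ k‖) w k * ‖inner ℂ (ψ k) f‖) *
        ∑' k, relWeight (fun k => ‖ζ k‖) w k * ‖inner ℂ (ψ k) g‖) := by
  rw [hS.inner_sandwich hζ]
  refine (hS.norm_inner_formOp_le _ _).trans (le_of_eq ?_)
  have e : ∀ k, relWeight μ w k * ‖rootMul μ ζ k‖ = relWeight (fun k => ‖ζ k‖) w k := by
    intro k
    have := (Real.sqrt_pos.2 (hS.pos k)).ne'
    rw [hS.norm_rootMul hζ, relWeight, relWeight]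
    field_simp
  simp only [inner_diagOp (hS.bdd_rootMul hζ), inner_diagOp (hS.bdd_rootMul hζ).conj, norm_mul,
    RCLike.norm_conj, ← mul_assoc, e]

lemma summable_weight_div (hS : IsSubordinate μ ψ b w M) (hζ : IsComparable μ ζ) :
    Summable fun k => w k ^ 2 / ‖ζ k‖ := by
  have h0 := hS.ne_zero hζ
  obtain ⟨c, hc, C, h⟩ := hζ
  refine Summable.of_nonneg_of_le (fun k => by positivity) (fun k => ?_)
    (hS.summable.mul_left c⁻¹)
  have hk := hS.pos k
  rw [inv_mul_eq_div, div_div, mul_comm (μ k)]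
  exact div_le_div_of_nonneg_left (by positivity) (by positivity) (h k).1

lemma relWeight_norm_sq (w : ℕ+ → ℝ) (ζ : ℕ+ → ℂ) (k : ℕ+) :
    relWeight (fun k => ‖ζ k‖) w k ^ 2 = w k ^ 2 / ‖ζ k‖ := by
  rw [relWeight, mul_pow, inv_pow, Real.sq_sqrt (norm_nonneg _), div_eq_mul_inv]

/-- Cauchy–Schwarz for the weights of the sandwiched operator. -/
lemma tsum_relWeight_norm_le (hS : IsSubordinate μ ψ b w M) (hζ : IsComparable μ ζ) (f : H) :
    ∑' k, relWeight (fun k => ‖ζ k‖) w k * ‖inner ℂ (ψ k) f‖ ≤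
      √(∑' k, w k ^ 2 / ‖ζ k‖) * ‖f‖ := by
  have h := (summable_mul_norm_inner ψ (v := relWeight (fun k => ‖ζ k‖) w)
    (fun k => mul_nonneg (hS.weight_nonneg k) (by positivity))
    (by simpa only [relWeight_norm_sq] using hS.summable_weight_div hζ) f).2
  simpa only [relWeight_norm_sq] using h

/-- The estimate on which everything rests: the norm of `B(z)` is at most
`M ∑ w_k² / |z - μ_k|`. -/
lemma norm_sandwich_le (hS : IsSubordinate μ ψ b w M) (hζ : IsComparable μ ζ) :
    ‖hS.sandwich ζ‖ ≤ M * ∑' k, w k ^ 2 / ‖ζ k‖ := by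
  have hM := hS.const_pos
  have hs : 0 ≤ ∑' k, w k ^ 2 / ‖ζ k‖ := tsum_nonneg fun k => by positivity
  have h := hS.norm_inner_sandwich_le hζ
  set S := ∑' k, w k ^ 2 / ‖ζ k‖
  refine ContinuousLinearMap.opNorm_le_of_re_inner_le (by positivity) fun f g hf hg => ?_
  have hnn : ∀ f : H, 0 ≤ ∑' k, relWeight (fun k => ‖ζ k‖) w k * ‖inner ℂ (ψ k) f‖ :=
    fun f => tsum_nonneg fun k => mul_nonneg
      (mul_nonneg (hS.weight_nonneg k) (by positivity)) (norm_nonneg _)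
  have hf' := hS.tsum_relWeight_norm_le hζ f
  have hg' := hS.tsum_relWeight_norm_le hζ g
  rw [hf, mul_one] at hf'
  rw [hg, mul_one] at hg'
  have h2 : ‖inner ℂ g (hS.sandwich ζ f)‖ ≤ M * S := by
    calc _ ≤ _ := h f g
      _ ≤ M * (√S * √S) := by
        have := hnn g
        have := hnn f
        gcongr
      _ = M * S := by rw [Real.mul_self_sqrt hs]
  rw [← inner_conj_symm] at h2
  rw [RCLike.norm_conj] at h2
  exact (RCLike.re_le_norm _).trans h2

lemma tsum_relWeight_basis (ζ : ℕ+ → ℂ) (w : ℕ+ → ℝ) (ψ : HilbertBasis ℕ+ ℂ H) (i : ℕ+) :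
    ∑' k, relWeight (fun k => ‖ζ k‖) w k * ‖inner ℂ (ψ k) (ψ i)‖ =
      relWeight (fun k => ‖ζ k‖) w i := by
  rw [tsum_eq_single i]
  · simp [ψ.orthonormal.1 i]
  · intro k hk
    simp [inner_basis, hk]

lemma norm_inner_sandwich_basis_le (hS : IsSubordinate μ ψ b w M) (hζ : IsComparable μ ζ)
    (i : ℕ+) : ‖inner ℂ (ψ i) (hS.sandwich ζ (ψ i))‖ ≤ M * (w i ^ 2 / ‖ζ i‖) := by
  have h := hS.norm_inner_sandwich_le hζ (ψ i) (ψ i)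
  rwa [tsum_relWeight_basis, ← sq, relWeight_norm_sq] at h

/-- Since the matrix of `B` is dominated by `M p_i p_j` with `p_i² = w_i² / |ζ_i|`, the diagonal
entries of `B X B` are summable for every bounded `X`. -/
lemma norm_inner_sandwich_mul_mul_le (hS : IsSubordinate μ ψ b w M) (hζ : IsComparable μ ζ)
    (X : H →L[ℂ] H) (i : ℕ+) :
    ‖inner ℂ (ψ i) ((hS.sandwich ζ * X * hS.sandwich ζ) (ψ i))‖ ≤
      M ^ 2 * ‖X‖ * (∑' k, w k ^ 2 / ‖ζ k‖) * (w i ^ 2 / ‖ζ i‖) := by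
  set S := ∑' k, w k ^ 2 / ‖ζ k‖
  set p := relWeight (fun k => ‖ζ k‖) w i
  have hp : 0 ≤ p := mul_nonneg (hS.weight_nonneg i) (by positivity)
  have hM := hS.const_pos
  have hS0 : 0 ≤ S := tsum_nonneg fun k => by positivity
  have hnn : ∀ f : H, 0 ≤ ∑' k, relWeight (fun k => ‖ζ k‖) w k * ‖inner ℂ (ψ k) f‖ :=
    fun f => tsum_nonneg fun k => mul_nonneg
      (mul_nonneg (hS.weight_nonneg k) (by positivity)) (norm_nonneg _)
  have h1 : ‖hS.sandwich ζ (ψ i)‖ ≤ M * (p * √S) := by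
    have h := hS.norm_inner_sandwich_le hζ (ψ i) (hS.sandwich ζ (ψ i))
    rw [tsum_relWeight_basis, inner_self_eq_norm_sq_to_K] at h
    have h2 := hS.tsum_relWeight_norm_le hζ (hS.sandwich ζ (ψ i))
    have h3 : ‖hS.sandwich ζ (ψ i)‖ ^ 2 ≤ M * (p * √S) * ‖hS.sandwich ζ (ψ i)‖ := by
      calc ‖hS.sandwich ζ (ψ i)‖ ^ 2 ≤ _ := by simpa using h
        _ ≤ M * (p * (√S * ‖hS.sandwich ζ (ψ i)‖)) := by gcongr
        _ = _ := by ring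
    rcases (norm_nonneg (hS.sandwich ζ (ψ i))).eq_or_lt with h0 | h0
    · rw [← h0]; positivity
    · exact le_of_mul_le_mul_right (by rwa [sq] at h3) h0
  have h2 := hS.norm_inner_sandwich_le hζ (X (hS.sandwich ζ (ψ i))) (ψ i)
  rw [tsum_relWeight_basis] at h2
  have h3 := hS.tsum_relWeight_norm_le hζ (X (hS.sandwich ζ (ψ i)))
  calc ‖inner ℂ (ψ i) ((hS.sandwich ζ * X * hS.sandwich ζ) (ψ i))‖ ≤ _ := h2
    _ ≤ M * (√S * (‖X‖ * (M * (p * √S))) * p) := by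
      gcongr
      refine h3.trans ?_
      gcongr
      exact (X.le_opNorm _).trans (by gcongr)
    _ = M ^ 2 * ‖X‖ * (√S * √S) * p ^ 2 := by ring
    _ = _ := by rw [Real.mul_self_sqrt hS0, relWeight_norm_sq]

lemma isUnit_one_sub_sandwich (hS : IsSubordinate μ ψ b w M) (h : ‖hS.sandwich ζ‖ < 1) :
    IsUnit (1 - hS.sandwich ζ) := isUnit_one_sub_of_norm_lt_one h

/-- The pencil is `diag(u)⁻¹ (1 - B) diag(u)⁻¹`, so it is invertible together with `1 - B`. -/
lemma pencil_mul_eq_one (hS : IsSubordinate μ ψ b w M) (hζ : IsComparable μ ζ)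
    (h : ‖hS.sandwich ζ‖ < 1) :
    hS.pencil ζ * (diagOp ψ (rootMul μ ζ) * Ring.inverse (1 - hS.sandwich ζ) *
        diagOp ψ (rootMul μ ζ)) = 1 ∧
      (diagOp ψ (rootMul μ ζ) * Ring.inverse (1 - hS.sandwich ζ) *
        diagOp ψ (rootMul μ ζ)) * hS.pencil ζ = 1 := by
  set U := diagOp ψ (rootMul μ ζ) with hU
  set V := diagOp ψ (fun k => (rootMul μ ζ k)⁻¹) with hV
  set G := Ring.inverse (1 - hS.sandwich ζ)
  have hu := hS.bdd_rootMul hζ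
  have hv := hS.bdd_rootMul_inv hζ
  have hne := hS.rootMul_ne_zero hζ
  have hUV : U * V = 1 := by
    rw [hU, hV, diagOp_mul hu hv, ← diagOp_one ψ]
    congr 1; funext k; exact mul_inv_cancel₀ (hne k)
  have hVU : V * U = 1 := by
    rw [hU, hV, diagOp_mul hv hu, ← diagOp_one ψ]
    congr 1; funext k; exact inv_mul_cancel₀ (hne k)
  have hVV : V * V = diagOp ψ (fun k => ζ k / μ k) := by
    rw [hV, diagOp_mul hv hv]
    congr 1; funext k
    rw [← mul_inv, hS.rootMul_mul_self hζ, inv_div]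
  have e : hS.pencil ζ = V * (1 - hS.sandwich ζ) * V := by
    rw [pencil, ← hVV, mul_sub, sub_mul, mul_one, sandwich, ← hU]
    congr 1
    calc hS.formOp = (V * U) * hS.formOp * (U * V) := by rw [hVU, hUV, one_mul, mul_one]
      _ = V * (U * hS.formOp * U) * V := by noncomm_ring
  have hG1 : (1 - hS.sandwich ζ) * G = 1 := Ring.mul_inverse_cancel _ (hS.isUnit_one_sub_sandwich h)
  have hG2 : G * (1 - hS.sandwich ζ) = 1 := Ring.inverse_mul_cancel _ (hS.isUnit_one_sub_sandwich h)
  constructor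
  · calc hS.pencil ζ * (U * G * U) = V * (1 - hS.sandwich ζ) * (V * U) * G * U := by
          rw [e]; noncomm_ring
      _ = V * ((1 - hS.sandwich ζ) * G) * U := by rw [hVU]; noncomm_ring
      _ = 1 := by rw [hG1, mul_one, hVU]
  · calc (U * G * U) * hS.pencil ζ = U * G * (U * V) * (1 - hS.sandwich ζ) * V := by
          rw [e]; noncomm_ring
      _ = U * (G * (1 - hS.sandwich ζ)) * V := by rw [hUV]; noncomm_ring
      _ = 1 := by rw [hG2, mul_one, hUV]

lemma isUnit_pencil (hS : IsSubordinate μ ψ b w M) (hζ : IsComparable μ ζ)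
    (h : ‖hS.sandwich ζ‖ < 1) : IsUnit (hS.pencil ζ) :=
  ⟨⟨_, _, (hS.pencil_mul_eq_one hζ h).1, (hS.pencil_mul_eq_one hζ h).2⟩, rfl⟩

lemma inverse_pencil (hS : IsSubordinate μ ψ b w M) (hζ : IsComparable μ ζ)
    (h : ‖hS.sandwich ζ‖ < 1) :
    Ring.inverse (hS.pencil ζ) = diagOp ψ (rootMul μ ζ) * Ring.inverse (1 - hS.sandwich ζ) *
      diagOp ψ (rootMul μ ζ) :=
  Ring.inverse_unit ⟨_, _, (hS.pencil_mul_eq_one hζ h).1, (hS.pencil_mul_eq_one hζ h).2⟩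

/-! ### The resolvent of `T` and the operators `K(z)`, `B(z)` -/

lemma invSqrtA_mul_self (hS : IsSubordinate μ ψ b w M) :
    invSqrtA μ ψ * invSqrtA μ ψ = diagOp ψ (fun k => (μ k : ℂ)⁻¹) := by
  rw [diagOp_mul hS.bdd_invSqrt hS.bdd_invSqrt]
  congr 1
  funext k
  rw [invSqrt, ← Complex.ofReal_mul, ← mul_inv, Real.mul_self_sqrt (hS.pos k).le, Complex.ofReal_inv]

lemma bdd_inv (hS : IsSubordinate μ ψ b w M) : IsBddSeq (fun k => (μ k : ℂ)⁻¹) := by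
  obtain ⟨c, hc, h⟩ := hS.lower
  refine ⟨c⁻¹, by positivity, fun k => ?_⟩
  rw [norm_inv, Complex.norm_real, Real.norm_of_nonneg (hS.pos k).le]
  exact inv_anti₀ hc (h k)

lemma pencil_sub_eq (hS : IsSubordinate μ ψ b w M) (z : ℂ) :
    hS.pencil (fun k => z - μ k) = z • (invSqrtA μ ψ * invSqrtA μ ψ) - 1 - hS.formOp := by
  have h1 : diagOp ψ (fun k => (z - μ k) / μ k) =
      z • diagOp ψ (fun k => (μ k : ℂ)⁻¹) + diagOp ψ (fun _ => (-1 : ℂ)) := by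
    rw [diagOp_smul z hS.bdd_inv, diagOp_add ((isBddSeq_const z).mul hS.bdd_inv) (isBddSeq_const _)]
    congr 1
    funext k
    have : (μ k : ℂ) ≠ 0 := by exact_mod_cast (hS.pos k).ne'
    field_simp
    ring
  rw [pencil, h1, diagOp_const, hS.invSqrtA_mul_self, neg_one_smul]
  abel

lemma isResolventAt_opT (hS : IsSubordinate μ ψ b w M) {z : ℂ}
    (h : IsUnit (hS.pencil (fun k => z - μ k))) :
    IsResolventAt (opT μ ψ b) z
      (invSqrtA μ ψ * Ring.inverse (hS.pencil (fun k => z - μ k)) * invSqrtA μ ψ) := by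
  set Λ := hS.pencil (fun k => z - μ k) with hΛ
  set D := invSqrtA μ ψ with hD
  have hΛx : ∀ x, Λ x = z • D (D x) - x - hS.formOp x := by
    intro x
    rw [hΛ, hS.pencil_sub_eq z]
    rfl
  constructor
  · intro f
    set x := Ring.inverse Λ (D f) with hx
    have h1 : Λ x = D f := by
      have := congrArg (fun S : H →L[ℂ] H => S (D f)) (Ring.mul_inverse_cancel _ h)
      exact this
    have hmem : D x ∈ formDomain μ ψ := hS.invSqrtA_mem x
    have hg : (D x, z • D x - f) ∈ (opT μ ψ b).graph := by
      rw [hS.mem_graph_opT]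
      refine ⟨hmem, ?_⟩
      rw [hS.sqrtA_invSqrtA x hmem, map_sub, map_smul, ← hD, ← h1, hΛx]
      abel
    obtain ⟨y, hy1, hy2⟩ := (LinearPMap.mem_graph_iff _).1 hg
    have hy : (D x) ∈ (opT μ ψ b).domain := by
      simp only at hy1
      rw [← hy1]; exact y.2
    refine ⟨hy, ?_⟩
    have e : y = ⟨D x, hy⟩ := Subtype.ext hy1
    have e2 : opT μ ψ b ⟨D x, hy⟩ = z • D x - f := by rw [← e]; exact hy2
    change z • D x - opT μ ψ b ⟨D x, hy⟩ = f
    rw [e2]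
    abel
  · intro f
    obtain ⟨hf, e⟩ := (hS.mem_graph_opT _ _).1 ((opT μ ψ b).mem_graph f)
    set x := sqrtA μ ψ ⟨f, hf⟩
    have hDx : D x = f := hS.invSqrtA_sqrtA ⟨f, hf⟩
    have h1 : D (z • (f : H) - opT μ ψ b f) = Λ x := by
      rw [map_sub, map_smul, hΛx, hDx, hD, ← e]
      abel
    change D (Ring.inverse Λ (D (z • (f : H) - opT μ ψ b f))) = f
    rw [h1, ← hDx]
    congr 1
    exact congrArg (fun S : H →L[ℂ] H => S x) (Ring.inverse_mul_cancel _ h)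

lemma isEigenvector_opT (hS : IsSubordinate μ ψ b w M) {z : ℂ} {x : H} (hx : x ≠ 0)
    (h : hS.pencil (fun k => z - μ k) x = 0) :
    IsEigenvector (opT μ ψ b) z (invSqrtA μ ψ x) := by
  refine ⟨fun h0 => hx (hS.invSqrtA_injective (by rw [h0, map_zero])), ?_⟩
  have hg : (invSqrtA μ ψ x, z • invSqrtA μ ψ x) ∈ (opT μ ψ b).graph := by
    rw [hS.mem_graph_opT]
    refine ⟨hS.invSqrtA_mem x, ?_⟩
    rw [hS.sqrtA_invSqrtA, map_smul]
    rw [hS.pencil_sub_eq z] at h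
    have h' : z • invSqrtA μ ψ (invSqrtA μ ψ x) - x - hS.formOp x = 0 := h
    rw [sub_sub, sub_eq_zero] at h'
    exact h'.symm
  obtain ⟨y, hy1, hy2⟩ := (LinearPMap.mem_graph_iff _).1 hg
  simp only at hy1 hy2
  have hy : invSqrtA μ ψ x ∈ (opT μ ψ b).domain := by rw [← hy1]; exact y.2
  refine ⟨hy, ?_⟩
  have e : y = ⟨_, hy⟩ := Subtype.ext hy1
  rw [← e]; exact hy2

lemma opK_eq (hS : IsSubordinate μ ψ b w M) {z : ℂ} (hz : IsComparable μ (fun k => z - μ k)) :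
    opK μ ψ z = invSqrtA μ ψ * diagOp ψ (rootMul μ (fun k => z - μ k)) := by
  rw [opK, diagOp_mul hS.bdd_invSqrt (hS.bdd_rootMul hz)]
  congr 1
  funext k
  rw [rootMul, mul_comm (invSqrt μ k), mul_assoc, sqrt_mul_invSqrt (hS.pos k), mul_one]

lemma adjoint_opK (hS : IsSubordinate μ ψ b w M) {z : ℂ} (hz : IsComparable μ (fun k => z - μ k)) :
    ContinuousLinearMap.adjoint (opK μ ψ z) =
      invSqrtA μ ψ * diagOp ψ (fun k => starRingEnd ℂ (rootMul μ (fun k => z - μ k) k)) := by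
  have hu := hS.bdd_rootMul hz
  rw [hS.opK_eq hz, diagOp_mul hS.bdd_invSqrt hu, adjoint_diagOp (hS.bdd_invSqrt.mul hu),
    diagOp_mul hS.bdd_invSqrt hu.conj]
  congr 1
  funext k
  rw [map_mul, conj_invSqrt]

lemma isB_sandwich (hS : IsSubordinate μ ψ b w M) {z : ℂ}
    (hz : IsComparable μ (fun k => z - μ k)) :
    IsB μ ψ b z (hS.sandwich (fun k => z - μ k)) := by
  intro f g
  have hf : opK μ ψ z f = hS.toFormDomain (diagOp ψ (rootMul μ (fun k => z - μ k)) f) := by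
    rw [hS.opK_eq hz]; rfl
  have hg : ContinuousLinearMap.adjoint (opK μ ψ z) g =
      hS.toFormDomain (diagOp ψ (fun k => starRingEnd ℂ (rootMul μ (fun k => z - μ k) k)) g) := by
    rw [hS.adjoint_opK hz]; rfl
  have hf' : opK μ ψ z f ∈ formDomain μ ψ := by rw [hf]; exact Subtype.mem _
  have hg' : ContinuousLinearMap.adjoint (opK μ ψ z) g ∈ formDomain μ ψ := by
    rw [hg]; exact Subtype.mem _
  refine ⟨hf', hg', ?_⟩
  rw [hS.inner_sandwich hz, hS.inner_formOp]
  have e1 : hS.toFormDomain (diagOp ψ (rootMul μ (fun k => z - μ k)) f) =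
    ⟨opK μ ψ z f, hf'⟩ := Subtype.ext hf.symm
  rw [e1]
  congr 1
  exact Subtype.ext hg.symm

lemma isB_opB (hS : IsSubordinate μ ψ b w M) {z : ℂ} (hz : IsComparable μ (fun k => z - μ k)) :
    IsB μ ψ b z (opB μ ψ b z) := by
  have hex : ∃ B : H →L[ℂ] H, IsB μ ψ b z B := ⟨_, hS.isB_sandwich hz⟩
  unfold opB
  rw [dif_pos hex]
  exact hex.choose_spec

lemma opB_eq (hS : IsSubordinate μ ψ b w M) {z : ℂ} (hz : IsComparable μ (fun k => z - μ k)) :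
    opB μ ψ b z = hS.sandwich (fun k => z - μ k) := by
  ext f
  refine ext_inner_left ℂ fun g => ?_
  obtain ⟨_, _, h1⟩ := hS.isB_opB hz f g
  obtain ⟨_, _, h2⟩ := hS.isB_sandwich hz f g
  rw [h1, h2]

/-- At `z = 0` all multipliers are `-i`, which gives `B(0) = -B₀`. -/
lemma opB_zero (hS : IsSubordinate μ ψ b w M) : opB μ ψ b 0 = -hS.formOp := by
  have hz : IsComparable μ (fun k => (0 : ℂ) - μ k) := by
    refine ⟨1, one_pos, 1, fun k => ?_⟩
    simp [abs_of_pos (hS.pos k)]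
  rw [hS.opB_eq hz, sandwich]
  have e : rootMul μ (fun k => (0 : ℂ) - μ k) = fun _ => -I := by
    funext k
    have hk := hS.pos k
    have h1 : ((0 : ℂ) - μ k) = ((-μ k : ℝ) : ℂ) := by push_cast; ring
    have h2 : cexp (Real.pi * I * (-(1 / 2))) = -I := by
      rw [show (Real.pi * I * (-(1 / 2)) : ℂ) = -(Real.pi / 2 * I) by ring, Complex.exp_neg,
        Complex.exp_pi_div_two_mul_I, Complex.inv_I]
    have h3 : ((μ k : ℝ) : ℂ) ^ (-(1 / 2) : ℂ) = (((√(μ k))⁻¹ : ℝ) : ℂ) := by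
      rw [Real.sqrt_eq_rpow, ← Real.rpow_neg hk.le, Complex.ofReal_cpow hk.le]
      norm_num
    have h4 : ((√(μ k) : ℝ) : ℂ) ≠ 0 := by exact_mod_cast (Real.sqrt_pos.2 hk).ne'
    rw [rootMul, h1, Complex.ofReal_cpow_of_nonpos (by linarith), h2]
    rw [Complex.ofReal_neg, neg_neg, h3, Complex.ofReal_inv]
    field_simp
  rw [e, diagOp_const]
  simp [smul_smul]

end IsSubordinate

/-! ### Integrals over the boundary of a rectangle -/

section Rectangle

variable {E E' : Type*} [NormedAddCommGroup E] [NormedSpace ℂ E]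
  [NormedAddCommGroup E'] [NormedSpace ℂ E'] {x₀ x₁ y₀ y₁ : ℝ}

/-- The closed rectangle `[x₀, x₁] × [y₀, y₁]`. -/
def closedRect (x₀ x₁ y₀ y₁ : ℝ) : Set ℂ := {z | (x₀ ≤ z.re ∧ z.re ≤ x₁) ∧ y₀ ≤ z.im ∧ z.im ≤ y₁}

/-- The open rectangle `(x₀, x₁) × (y₀, y₁)`. -/
def openRect (x₀ x₁ y₀ y₁ : ℝ) : Set ℂ := {z | (x₀ < z.re ∧ z.re < x₁) ∧ y₀ < z.im ∧ z.im < y₁}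

/-- The boundary of the rectangle. -/
def bdryRect (x₀ x₁ y₀ y₁ : ℝ) : Set ℂ := closedRect x₀ x₁ y₀ y₁ \ openRect x₀ x₁ y₀ y₁

lemma horiz_mem (hx : x₀ < x₁) (hy : y₀ < y₁) {y : ℝ} (h : y = y₀ ∨ y = y₁) {x : ℝ}
    (hxm : x ∈ Set.uIcc x₀ x₁) : (x + y * I : ℂ) ∈ bdryRect x₀ x₁ y₀ y₁ := by
  rw [Set.uIcc_of_le hx.le] at hxm
  simp only [bdryRect, closedRect, openRect, Set.mem_sdiff, Set.mem_ofPred_eq]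
  simp
  rcases h with rfl | rfl
  · exact ⟨⟨hxm, le_rfl, hy.le⟩, fun _ _ h => absurd h (lt_irrefl _)⟩
  · exact ⟨⟨hxm, hy.le, le_rfl⟩, fun _ _ _ => le_rfl⟩

lemma vert_mem (hx : x₀ < x₁) (hy : y₀ < y₁) {x : ℝ} (h : x = x₀ ∨ x = x₁) {y : ℝ}
    (hym : y ∈ Set.uIcc y₀ y₁) : (x + y * I : ℂ) ∈ bdryRect x₀ x₁ y₀ y₁ := by
  rw [Set.uIcc_of_le hy.le] at hym
  simp only [bdryRect, closedRect, openRect, Set.mem_sdiff, Set.mem_ofPred_eq]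
  simp
  rcases h with rfl | rfl
  · exact ⟨⟨⟨le_rfl, hx.le⟩, hym⟩, fun h => absurd h (lt_irrefl _)⟩
  · exact ⟨⟨⟨hx.le, le_rfl⟩, hym⟩, fun _ h => absurd h (lt_irrefl _)⟩

lemma rectIntegral_congr (hx : x₀ < x₁) (hy : y₀ < y₁) {F G : ℂ → E}
    (h : ∀ z ∈ bdryRect x₀ x₁ y₀ y₁, F z = G z) :
    rectIntegral F x₀ x₁ y₀ y₁ = rectIntegral G x₀ x₁ y₀ y₁ := by
  unfold rectIntegral
  congr 1
  · congr 1
    · congr 1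
      · exact intervalIntegral.integral_congr fun x hm => h _ (horiz_mem hx hy (.inl rfl) hm)
      · exact intervalIntegral.integral_congr fun x hm => h _ (horiz_mem hx hy (.inr rfl) hm)
    · congr 1
      exact intervalIntegral.integral_congr fun x hm => h _ (vert_mem hx hy (.inr rfl) hm)
  · congr 1
    exact intervalIntegral.integral_congr fun x hm => h _ (vert_mem hx hy (.inl rfl) hm)

lemma intervalIntegrable_edges (hx : x₀ < x₁) (hy : y₀ < y₁) {F : ℂ → E}
    (hF : ContinuousOn F (bdryRect x₀ x₁ y₀ y₁)) :
    (∀ y, y = y₀ ∨ y = y₁ →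
      IntervalIntegrable (fun x : ℝ => F (x + y * I)) MeasureTheory.volume x₀ x₁) ∧
    (∀ x, x = x₀ ∨ x = x₁ →
      IntervalIntegrable (fun y : ℝ => F (x + y * I)) MeasureTheory.volume y₀ y₁) := by
  constructor
  · intro y h
    refine ContinuousOn.intervalIntegrable (hF.comp (by fun_prop) fun x hm => ?_)
    exact horiz_mem hx hy h hm
  · intro x h
    refine ContinuousOn.intervalIntegrable (hF.comp (by fun_prop) fun y hm => ?_)
    exact vert_mem hx hy h hm

lemma rectIntegral_add (hx : x₀ < x₁) (hy : y₀ < y₁) {F G : ℂ → E}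
    (hF : ContinuousOn F (bdryRect x₀ x₁ y₀ y₁)) (hG : ContinuousOn G (bdryRect x₀ x₁ y₀ y₁)) :
    rectIntegral (fun z => F z + G z) x₀ x₁ y₀ y₁ =
      rectIntegral F x₀ x₁ y₀ y₁ + rectIntegral G x₀ x₁ y₀ y₁ := by
  obtain ⟨h1, h2⟩ := intervalIntegrable_edges hx hy hF
  obtain ⟨h3, h4⟩ := intervalIntegrable_edges hx hy hG
  unfold rectIntegral
  rw [intervalIntegral.integral_add (h1 _ (.inl rfl)) (h3 _ (.inl rfl)),
    intervalIntegral.integral_add (h1 _ (.inr rfl)) (h3 _ (.inr rfl)),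
    intervalIntegral.integral_add (h2 _ (.inl rfl)) (h4 _ (.inl rfl)),
    intervalIntegral.integral_add (h2 _ (.inr rfl)) (h4 _ (.inr rfl)), smul_add, smul_add]
  abel

lemma rectIntegral_clm [CompleteSpace E] [CompleteSpace E'] (hx : x₀ < x₁) (hy : y₀ < y₁)
    {F : ℂ → E} (hF : ContinuousOn F (bdryRect x₀ x₁ y₀ y₁)) (L : E →L[ℂ] E') :
    rectIntegral (fun z => L (F z)) x₀ x₁ y₀ y₁ = L (rectIntegral F x₀ x₁ y₀ y₁) := by
  obtain ⟨h1, h2⟩ := intervalIntegrable_edges hx hy hF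
  unfold rectIntegral
  rw [L.intervalIntegral_comp_comm (h1 _ (.inl rfl)), L.intervalIntegral_comp_comm (h1 _ (.inr rfl)),
    L.intervalIntegral_comp_comm (h2 _ (.inl rfl)), L.intervalIntegral_comp_comm (h2 _ (.inr rfl))]
  simp only [map_sub, map_add, map_smul]

lemma norm_rectIntegral_le (hx : x₀ < x₁) (hy : y₀ < y₁) {F : ℂ → E} {C : ℝ}
    (hF : ∀ z ∈ bdryRect x₀ x₁ y₀ y₁, ‖F z‖ ≤ C) :
    ‖rectIntegral F x₀ x₁ y₀ y₁‖ ≤ 2 * C * ((x₁ - x₀) + (y₁ - y₀)) := by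
  have h1 : ∀ y, y = y₀ ∨ y = y₁ → ‖∫ x : ℝ in x₀..x₁, F (x + y * I)‖ ≤ C * (x₁ - x₀) := by
    intro y h
    have := intervalIntegral.norm_integral_le_of_norm_le_const (a := x₀) (b := x₁)
      (f := fun x : ℝ => F (x + y * I)) (C := C)
      fun x hm => hF _ (horiz_mem hx hy h (Set.uIoc_subset_uIcc hm))
    rwa [abs_of_pos (by linarith)] at this
  have h2 : ∀ x, x = x₀ ∨ x = x₁ → ‖∫ y : ℝ in y₀..y₁, F (x + y * I)‖ ≤ C * (y₁ - y₀) := by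
    intro x h
    have := intervalIntegral.norm_integral_le_of_norm_le_const (a := y₀) (b := y₁)
      (f := fun y : ℝ => F (x + y * I)) (C := C)
      fun y hm => hF _ (vert_mem hx hy h (Set.uIoc_subset_uIcc hm))
    rwa [abs_of_pos (by linarith)] at this
  unfold rectIntegral
  refine (norm_sub_le _ _).trans ?_
  have h3 := (norm_add_le ((∫ x : ℝ in x₀..x₁, F (x + y₀ * I)) - (∫ x : ℝ in x₀..x₁, F (x + y₁ * I)))
    (I • (∫ y : ℝ in y₀..y₁, F (x₁ + y * I))))
  have h4 := norm_sub_le (∫ x : ℝ in x₀..x₁, F (x + y₀ * I)) (∫ x : ℝ in x₀..x₁, F (x + y₁ * I))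
  have h5 := h1 y₀ (.inl rfl)
  have h6 := h1 y₁ (.inr rfl)
  have h7 := h2 x₀ (.inl rfl)
  have h8 := h2 x₁ (.inr rfl)
  simp only [norm_smul, Complex.norm_I, one_mul] at h3 ⊢
  linarith

lemma rectIntegral_eq_zero (hx : x₀ < x₁) (hy : y₀ < y₁) {F : ℂ → E}
    (hF : DifferentiableOn ℂ F (closedRect x₀ x₁ y₀ y₁)) : rectIntegral F x₀ x₁ y₀ y₁ = 0 := by
  have h := Complex.integral_boundary_rect_eq_zero_of_differentiableOn F ⟨x₀, y₀⟩ ⟨x₁, y₁⟩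
    (hF.mono ?_)
  · exact h
  · intro z hz
    rw [Complex.mem_reProdIm] at hz
    simp only [Set.uIcc_of_le hx.le, Set.uIcc_of_le hy.le] at hz
    exact hz

/-- The winding number of the boundary about an interior point, computed from primitives of
`1 / (z - c)`: the principal logarithm of `z - c` on three sides, that of `c - z` on the left. -/
lemma rectIntegral_inv_sub {c : ℂ} (hc : c ∈ openRect x₀ x₁ y₀ y₁) :
    rectIntegral (fun z => (z - c)⁻¹) x₀ x₁ y₀ y₁ = 2 * Real.pi * I := by
  obtain ⟨⟨hx0, hx1⟩, hy0, hy1⟩ := hc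
  have horiz : ∀ y : ℝ, y ≠ c.im → ∫ x : ℝ in x₀..x₁, ((x + y * I : ℂ) - c)⁻¹ =
      Complex.log (x₁ + y * I - c) - Complex.log (x₀ + y * I - c) := by
    intro y hyc
    have hsl : ∀ x : ℝ, (x + y * I - c : ℂ) ∈ Complex.slitPlane := by
      intro x
      refine Complex.mem_slitPlane_iff.2 (.inr ?_)
      simpa [sub_eq_zero] using hyc
    refine intervalIntegral.integral_eq_sub_of_hasDerivAt
      (f := fun x : ℝ => Complex.log (x + y * I - c)) (fun x _ => ?_) ?_
    · have h1 : HasDerivAt (fun x : ℝ => (x + y * I - c : ℂ)) 1 x := by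
        simpa using ((Complex.ofRealCLM.hasDerivAt (x := x)).add_const (y * I : ℂ)).sub_const c
      simpa using h1.clog_real (hsl x)
    · refine ContinuousOn.intervalIntegrable (ContinuousOn.inv₀ (by fun_prop) fun x _ => ?_)
      exact Complex.slitPlane_ne_zero (hsl x)
  have hv : ∀ x y : ℝ, HasDerivAt (fun y : ℝ => (x + y * I - c : ℂ)) I y := by
    intro x y
    simpa using (((Complex.ofRealCLM.hasDerivAt (x := y)).mul_const I).const_add (x : ℂ)).sub_const c
  have right : I • ∫ y : ℝ in y₀..y₁, ((x₁ + y * I : ℂ) - c)⁻¹ =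
      Complex.log (x₁ + y₁ * I - c) - Complex.log (x₁ + y₀ * I - c) := by
    have hsl : ∀ y : ℝ, (x₁ + y * I - c : ℂ) ∈ Complex.slitPlane := fun y =>
      Complex.mem_slitPlane_iff.2 (.inl (by simpa using hx1))
    rw [← intervalIntegral.integral_smul]
    refine intervalIntegral.integral_eq_sub_of_hasDerivAt
      (f := fun y : ℝ => Complex.log (x₁ + y * I - c)) (fun y _ => ?_) ?_
    · simpa [div_eq_mul_inv] using (hv x₁ y).clog_real (hsl y)
    · have hcont : ContinuousOn (fun y : ℝ => ((x₁ + y * I : ℂ) - c)⁻¹) (Set.uIcc y₀ y₁) :=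
        ContinuousOn.inv₀ (by fun_prop) fun y _ => Complex.slitPlane_ne_zero (hsl y)
      exact (hcont.const_smul I).intervalIntegrable
  have left : I • ∫ y : ℝ in y₀..y₁, ((x₀ + y * I : ℂ) - c)⁻¹ =
      Complex.log (-(x₀ + y₁ * I - c)) - Complex.log (-(x₀ + y₀ * I - c)) := by
    have hsl : ∀ y : ℝ, -(x₀ + y * I - c : ℂ) ∈ Complex.slitPlane := fun y =>
      Complex.mem_slitPlane_iff.2 (.inl (by simpa using hx0))
    rw [← intervalIntegral.integral_smul]
    refine intervalIntegral.integral_eq_sub_of_hasDerivAt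
      (f := fun y : ℝ => Complex.log (-(x₀ + y * I - c))) (fun y _ => ?_) ?_
    · have h1 : HasDerivAt (fun y : ℝ => -(x₀ + y * I - c : ℂ)) (-I) y := (hv x₀ y).neg
      have h := h1.clog_real (hsl y)
      rwa [neg_div_neg_eq, div_eq_mul_inv] at h
    · have hcont : ContinuousOn (fun y : ℝ => ((x₀ + y * I : ℂ) - c)⁻¹) (Set.uIcc y₀ y₁) :=
        ContinuousOn.inv₀ (by fun_prop) fun y _ =>
          neg_ne_zero.1 (Complex.slitPlane_ne_zero (hsl y))
      exact (hcont.const_smul I).intervalIntegrable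
  have hup : Complex.log (-(x₀ + y₁ * I - c)) = Complex.log (x₀ + y₁ * I - c) - Real.pi * I := by
    have him : 0 < (x₀ + y₁ * I - c : ℂ).im := by simpa using hy1
    simp only [Complex.log, norm_neg, Complex.arg_neg_eq_arg_sub_pi_of_im_pos him]
    push_cast; ring
  have hdown : Complex.log (-(x₀ + y₀ * I - c)) = Complex.log (x₀ + y₀ * I - c) + Real.pi * I := by
    have him : (x₀ + y₀ * I - c : ℂ).im < 0 := by simpa using hy0
    simp only [Complex.log, norm_neg, Complex.arg_neg_eq_arg_add_pi_of_im_neg him]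
    push_cast; ring
  unfold rectIntegral
  rw [horiz y₀ hy0.ne, horiz y₁ hy1.ne', right, left, hup, hdown]
  ring

end Rectangle

/-! ### The contours `Γ_n` -/

section Contour

variable {E E' : Type*} [NormedAddCommGroup E] [NormedSpace ℂ E] [CompleteSpace E]
  [NormedAddCommGroup E'] [NormedSpace ℂ E'] [CompleteSpace E'] {μ : ℕ+ → ℝ} {γ κ : ℝ} {n : ℕ+}

/-- The closure of the box `Π_n`. -/
def closedBox (μ : ℕ+ → ℝ) (γ κ : ℝ) (n : ℕ+) : Set ℂ :=
  closedRect (μ n - κ / 2 * ((n : ℝ) - 1) ^ (γ - 1)) (μ n + κ / 2 * (n : ℝ) ^ (γ - 1))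
    (-(κ / 2 * (n : ℝ) ^ (γ - 1))) (κ / 2 * (n : ℝ) ^ (γ - 1))

/-- The boundary `Γ_n` of the box `Π_n`, as the difference of the closed and the open box. -/
def bdryBox (μ : ℕ+ → ℝ) (γ κ : ℝ) (n : ℕ+) : Set ℂ := closedBox μ γ κ n \ box μ γ κ n

lemma box_eq (μ : ℕ+ → ℝ) (γ κ : ℝ) (n : ℕ+) : box μ γ κ n =
  openRect (μ n - κ / 2 * ((n : ℝ) - 1) ^ (γ - 1)) (μ n + κ / 2 * (n : ℝ) ^ (γ - 1))
    (-(κ / 2 * (n : ℝ) ^ (γ - 1))) (κ / 2 * (n : ℝ) ^ (γ - 1)) := by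
  ext z
  simp only [box, openRect, Set.mem_ofPred_eq, abs_lt, and_assoc]

lemma bdryBox_eq (μ : ℕ+ → ℝ) (γ κ : ℝ) (n : ℕ+) : bdryBox μ γ κ n =
  bdryRect (μ n - κ / 2 * ((n : ℝ) - 1) ^ (γ - 1)) (μ n + κ / 2 * (n : ℝ) ^ (γ - 1))
    (-(κ / 2 * (n : ℝ) ^ (γ - 1))) (κ / 2 * (n : ℝ) ^ (γ - 1)) := by
  rw [bdryBox, box_eq]; rfl

lemma isOpen_box (μ : ℕ+ → ℝ) (γ κ : ℝ) (n : ℕ+) : IsOpen (box μ γ κ n) := by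
  refine (isOpen_lt continuous_const Complex.continuous_re).inter
    ((isOpen_lt Complex.continuous_re continuous_const).inter
      (isOpen_lt (continuous_abs.comp Complex.continuous_im) continuous_const))

lemma isClosed_closedBox (μ : ℕ+ → ℝ) (γ κ : ℝ) (n : ℕ+) : IsClosed (closedBox μ γ κ n) :=
  ((isClosed_le continuous_const Complex.continuous_re).inter
    (isClosed_le Complex.continuous_re continuous_const)).inter
    ((isClosed_le continuous_const Complex.continuous_im).inter
      (isClosed_le Complex.continuous_im continuous_const))

lemma box_subset_closedBox (μ : ℕ+ → ℝ) (γ κ : ℝ) (n : ℕ+) : box μ γ κ n ⊆ closedBox μ γ κ n := by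
  rw [box_eq]
  exact fun z hz => ⟨⟨hz.1.1.le, hz.1.2.le⟩, hz.2.1.le, hz.2.2.le⟩

lemma frontier_box_subset (μ : ℕ+ → ℝ) (γ κ : ℝ) (n : ℕ+) :
    frontier (box μ γ κ n) ⊆ bdryBox μ γ κ n := by
  rw [(isOpen_box μ γ κ n).frontier_eq]
  exact Set.sdiff_subset_sdiff_left
    ((isClosed_closedBox μ γ κ n).closure_subset_iff.2 (box_subset_closedBox μ γ κ n))

lemma pred_rpow_nonneg (n : ℕ+) (s : ℝ) : 0 ≤ ((n : ℝ) - 1) ^ s := by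
  refine Real.rpow_nonneg ?_ _
  have : (1 : ℝ) ≤ n := by exact_mod_cast (one_le : 1 ≤ n)
  linarith

lemma rpow_pnat_pos (n : ℕ+) (s : ℝ) : 0 < (n : ℝ) ^ s :=
  Real.rpow_pos_of_pos (by exact_mod_cast n.pos) _

lemma box_width (hκ : 0 < κ) (n : ℕ+) :
    μ n - κ / 2 * ((n : ℝ) - 1) ^ (γ - 1) < μ n + κ / 2 * (n : ℝ) ^ (γ - 1) := by
  have h1 := mul_nonneg (half_pos hκ).le (pred_rpow_nonneg n (γ - 1))
  have h2 := mul_pos (half_pos hκ) (rpow_pnat_pos n (γ - 1))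
  linarith

lemma box_height (hκ : 0 < κ) (n : ℕ+) :
    -(κ / 2 * (n : ℝ) ^ (γ - 1)) < κ / 2 * (n : ℝ) ^ (γ - 1) := by
  have h2 := mul_pos (half_pos hκ) (rpow_pnat_pos n (γ - 1))
  linarith

lemma contour_congr (hκ : 0 < κ) {F G : ℂ → E} (h : ∀ z ∈ bdryBox μ γ κ n, F z = G z) :
    contour μ γ κ n F = contour μ γ κ n G := by
  rw [bdryBox_eq] at h
  rw [contour, contour, rectIntegral_congr (box_width hκ n) (box_height hκ n) h]

lemma contour_add (hκ : 0 < κ) {F G : ℂ → E} (hF : ContinuousOn F (bdryBox μ γ κ n))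
    (hG : ContinuousOn G (bdryBox μ γ κ n)) :
    contour μ γ κ n (fun z => F z + G z) = contour μ γ κ n F + contour μ γ κ n G := by
  rw [bdryBox_eq] at hF hG
  rw [contour, rectIntegral_add (box_width hκ n) (box_height hκ n) hF hG, smul_add]
  rfl

lemma contour_clm (hκ : 0 < κ) {F : ℂ → E} (hF : ContinuousOn F (bdryBox μ γ κ n))
    (L : E →L[ℂ] E') : contour μ γ κ n (fun z => L (F z)) = L (contour μ γ κ n F) := by
  rw [bdryBox_eq] at hF
  rw [contour, rectIntegral_clm (box_width hκ n) (box_height hκ n) hF, contour, map_smul]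

lemma contour_sum (hκ : 0 < κ) {ι : Type*} (s : Finset ι) {F : ι → ℂ → E}
    (hF : ∀ i ∈ s, ContinuousOn (F i) (bdryBox μ γ κ n)) :
    contour μ γ κ n (fun z => ∑ i ∈ s, F i z) = ∑ i ∈ s, contour μ γ κ n (F i) := by
  classical
  induction s using Finset.induction_on with
  | empty => simp [contour, rectIntegral]
  | insert a s ha ih =>
    simp only [Finset.sum_insert ha]
    rw [contour_add hκ (hF a (Finset.mem_insert_self a s))
      (continuousOn_finsetSum _ fun i hi => hF i (Finset.mem_insert_of_mem hi)),
      ih fun i hi => hF i (Finset.mem_insert_of_mem hi)]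

lemma norm_contour_le (hκ : 0 < κ) {F : ℂ → E} {C : ℝ} (hF : ∀ z ∈ bdryBox μ γ κ n, ‖F z‖ ≤ C) :
    ‖contour μ γ κ n F‖ ≤
      C * (κ / 2 * ((n : ℝ) - 1) ^ (γ - 1) + 3 * (κ / 2 * (n : ℝ) ^ (γ - 1))) := by
  rw [bdryBox_eq] at hF
  have h := norm_rectIntegral_le (box_width hκ n) (box_height hκ n) hF
  have h1 := mul_nonneg (half_pos hκ).le (pred_rpow_nonneg n (γ - 1))
  have h2 := mul_pos (half_pos hκ) (rpow_pnat_pos n (γ - 1))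
  rw [contour, norm_smul]
  have hpi : ‖(2 * Real.pi * I : ℂ)⁻¹‖ ≤ 1 / 2 := by
    rw [norm_inv, norm_mul, norm_mul, Complex.norm_I, Complex.norm_real,
      Real.norm_of_nonneg Real.pi_pos.le, mul_one, Complex.norm_ofNat, one_div]
    refine inv_anti₀ two_pos ?_
    linarith [Real.pi_gt_three]
  calc _ ≤ 1 / 2 * _ := mul_le_mul hpi h (norm_nonneg _) (by norm_num)
    _ = _ := by ring

lemma contour_eq_zero (hκ : 0 < κ) {F : ℂ → E} (hF : DifferentiableOn ℂ F (closedBox μ γ κ n)) :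
    contour μ γ κ n F = 0 := by
  rw [contour, rectIntegral_eq_zero (box_width hκ n) (box_height hκ n) hF, smul_zero]

lemma closedBox_mem_nhds {c : ℂ} (hc : c ∈ box μ γ κ n) : closedBox μ γ κ n ∈ 𝓝 c :=
  mem_of_superset ((isOpen_box μ γ κ n).mem_nhds hc) (box_subset_closedBox μ γ κ n)

lemma sub_ne_zero_of_mem_bdryBox {c z : ℂ} (hc : c ∈ box μ γ κ n) (hz : z ∈ bdryBox μ γ κ n) :
    z - c ≠ 0 := by
  intro h
  rw [sub_eq_zero] at h
  exact hz.2 (h ▸ hc)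

lemma continuousOn_inv_sub {c : ℂ} (hc : c ∈ box μ γ κ n) :
    ContinuousOn (fun z => (z - c)⁻¹) (bdryBox μ γ κ n) :=
  ContinuousOn.inv₀ (by fun_prop) fun _ hz => sub_ne_zero_of_mem_bdryBox hc hz

/-- Cauchy's integral formula on the box. -/
lemma contour_inv_sub_smul (hκ : 0 < κ) {F : ℂ → E}
    (hF : DifferentiableOn ℂ F (closedBox μ γ κ n)) {c : ℂ} (hc : c ∈ box μ γ κ n) :
    contour μ γ κ n (fun z => (z - c)⁻¹ • F z) = F c := by
  have hd : DifferentiableOn ℂ (dslope F c) (closedBox μ γ κ n) :=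
    (Complex.differentiableOn_dslope (closedBox_mem_nhds hc)).2 hF
  have hcont := continuousOn_inv_sub hc
  have e : ∀ z ∈ bdryBox μ γ κ n, (z - c)⁻¹ • F z = dslope F c z + (z - c)⁻¹ • F c := by
    intro z hz
    have hne := sub_ne_zero_of_mem_bdryBox hc hz
    rw [dslope_of_ne _ (sub_ne_zero.1 hne), slope, vsub_eq_sub, smul_sub]
    abel
  have hcont' : ContinuousOn (fun z => (z - c)⁻¹ • F c) (bdryBox μ γ κ n) :=
    hcont.smul continuousOn_const
  rw [contour_congr hκ e, contour_add hκ (hd.continuousOn.mono Set.sdiff_subset) hcont',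
    contour_eq_zero hκ hd, zero_add]
  have h := contour_clm hκ hcont ((1 : ℂ →L[ℂ] ℂ).smulRight (F c))
  have h1 : contour μ γ κ n (fun z => (z - c)⁻¹) = 1 := by
    rw [box_eq] at hc
    rw [contour, rectIntegral_inv_sub hc, smul_eq_mul, inv_mul_cancel₀]
    simp [Real.pi_ne_zero]
  rw [h1] at h
  simpa using h

/-- For a simple pole at an interior point the contour integral is the residue. -/
lemma contour_simple_pole (hκ : 0 < κ) {F X Y : ℂ → E}
    (hX : DifferentiableOn ℂ X (closedBox μ γ κ n))
    (hY : DifferentiableOn ℂ Y (closedBox μ γ κ n)) {c : ℂ} (hc : c ∈ box μ γ κ n)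
    (hF : ∀ z ∈ bdryBox μ γ κ n, F z = X z + (z - c)⁻¹ • Y z) :
    contour μ γ κ n F = Y c := by
  have hcont : ContinuousOn (fun z => (z - c)⁻¹ • Y z) (bdryBox μ γ κ n) :=
    (continuousOn_inv_sub hc).smul (hY.continuousOn.mono Set.sdiff_subset)
  rw [contour_congr hκ hF, contour_add hκ (hX.continuousOn.mono Set.sdiff_subset) hcont,
    contour_eq_zero hκ hX, zero_add, contour_inv_sub_smul hκ hY hc]

lemma mem_box_self (hκ : 0 < κ) (hn : 1 < n) : (μ n : ℂ) ∈ box μ γ κ n := by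
  have hn' : (0 : ℝ) < (n : ℝ) - 1 := by
    have : (1 : ℝ) < n := by exact_mod_cast hn
    linarith
  have h1 := mul_pos (half_pos hκ) (Real.rpow_pos_of_pos hn' (γ - 1))
  have h2 := mul_pos (half_pos hκ) (rpow_pnat_pos n (γ - 1))
  refine ⟨?_, ?_, ?_⟩
  · simpa using h1
  · simpa using h2
  · simpa using h2

end Contour

/-! ### Gaps and growth of the eigenvalues -/

lemma rpow_comparable {x y : ℝ} (s : ℝ) (hy : 0 < y) (h1 : y / 2 ≤ x) (h2 : x ≤ 2 * y) :
    2 ^ (-|s|) * y ^ s ≤ x ^ s ∧ x ^ s ≤ 2 ^ |s| * y ^ s := by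
  have hx : 0 < x := by linarith
  have e : x ^ s = (x / y) ^ s * y ^ s := by
    rw [← Real.mul_rpow (by positivity) hy.le, div_mul_cancel₀ _ hy.ne']
  have hr1 : 2⁻¹ ≤ x / y := by rw [le_div_iff₀ hy]; linarith
  have hr2 : x / y ≤ 2 := by rw [div_le_iff₀ hy]; linarith
  have hr : 0 < x / y := by positivity
  have key : 2 ^ (-|s|) ≤ (x / y) ^ s ∧ (x / y) ^ s ≤ (2 : ℝ) ^ |s| := by
    rcases le_total 0 s with hs | hs
    · rw [abs_of_nonneg hs]
      refine ⟨?_, Real.rpow_le_rpow hr.le hr2 hs⟩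
      rw [Real.rpow_neg two_pos.le, ← Real.inv_rpow two_pos.le]
      exact Real.rpow_le_rpow (by norm_num) hr1 hs
    · rw [abs_of_nonpos hs, neg_neg]
      refine ⟨Real.rpow_le_rpow_of_nonpos hr hr2 hs, ?_⟩
      rw [Real.rpow_neg two_pos.le, ← Real.inv_rpow two_pos.le]
      exact Real.rpow_le_rpow_of_nonpos (by norm_num) hr1 hs
  have hys := Real.rpow_pos_of_pos hy s
  rw [e]
  exact ⟨mul_le_mul_of_nonneg_right key.1 hys.le, mul_le_mul_of_nonneg_right key.2 hys.le⟩

lemma pnat_cast_pos (n : ℕ+) : (0 : ℝ) < n := by exact_mod_cast n.pos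

lemma pnat_one_le_cast (n : ℕ+) : (1 : ℝ) ≤ n := by exact_mod_cast (one_le : 1 ≤ n)

lemma tendsto_pnat_cast : Tendsto (fun n : ℕ+ => (n : ℝ)) atTop atTop := by
  refine tendsto_atTop.2 fun x => ?_
  obtain ⟨k, hk⟩ := exists_nat_ge x
  filter_upwards [eventually_ge_atTop k.succPNat] with n hn
  have h : ((k.succPNat : ℕ) : ℝ) ≤ n := by exact_mod_cast hn
  rw [Nat.succPNat_coe] at h
  push_cast at h
  linarith

lemma mul_le_sub_of_le_succ_sub {μ : ℕ+ → ℝ} {t : ℝ} {l k : ℕ+} (hlk : l ≤ k)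
    (h : ∀ i, l ≤ i → i < k → t ≤ μ (i + 1) - μ i) : ((k : ℝ) - l) * t ≤ μ k - μ l := by
  induction k using PNat.recOn with
  | one =>
    have : l = 1 := le_antisymm hlk one_le
    subst this
    simp
  | succ k ih =>
    rcases hlk.eq_or_lt with rfl | hlt
    · simp
    · have hlk' : l ≤ k := PNat.lt_add_one_iff.1 hlt
      have h1 := ih hlk' fun i hi hik => h i hi (hik.trans (PNat.lt_add_right k 1))
      have h2 := h k hlk' (PNat.lt_add_right k 1)
      push_cast
      linarith

/-- The gap condition adds up: only the indices in the upper half of `[j, k]` are used. -/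
lemma gap_of_le {μ : ℕ+ → ℝ} {γ κ : ℝ} (hκ : 0 < κ) {N₀ : ℕ+}
    (hgap : ∀ k, N₀ ≤ k → κ * (k : ℝ) ^ (γ - 1) ≤ μ (k + 1) - μ k) {j k : ℕ+} (hj : N₀ ≤ j)
    (hjk : j < k) : κ * 2 ^ (-|γ - 1|) / 2 * ((k : ℝ) - j) * (k : ℝ) ^ (γ - 1) ≤ μ k - μ j := by
  have hjk' : (j : ℕ) < k := hjk
  have hj1 : 1 ≤ (j : ℕ) := j.pos
  let l : ℕ+ := ⟨((j : ℕ) + k) / 2, by omega⟩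
  have hl : (l : ℕ) = ((j : ℕ) + k) / 2 := rfl
  have hjl : j ≤ l := by rw [← PNat.coe_le_coe, hl]; omega
  have hlk : l ≤ k := by rw [← PNat.coe_le_coe, hl]; omega
  have h2l : (k : ℝ) ≤ 2 * l := by
    have : (k : ℕ) ≤ 2 * l := by rw [hl]; omega
    exact_mod_cast this
  have h2l' : 2 * (l : ℝ) ≤ j + k := by
    have : 2 * (l : ℕ) ≤ j + k := by rw [hl]; omega
    exact_mod_cast this
  have hk0 := pnat_cast_pos k
  have hstep : ∀ i : ℕ+, l ≤ i → i < k →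
      κ * (2 ^ (-|γ - 1|) * (k : ℝ) ^ (γ - 1)) ≤ μ (i + 1) - μ i := by
    intro i hi hik
    refine le_trans ?_ (hgap i (hj.trans (hjl.trans hi)))
    have h1 : (l : ℝ) ≤ i := by exact_mod_cast hi
    have h2 : (i : ℝ) ≤ k := by exact_mod_cast hik.le
    exact mul_le_mul_of_nonneg_left
      (rpow_comparable (γ - 1) hk0 (by linarith) (by linarith)).1 hκ.le
  have h1 := mul_le_sub_of_le_succ_sub hlk hstep
  have hpos : 0 < κ * (2 ^ (-|γ - 1|) * (k : ℝ) ^ (γ - 1)) := by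
    have := rpow_pnat_pos k (γ - 1)
    positivity
  have h3 : 0 ≤ μ l - μ j := by
    have := mul_le_sub_of_le_succ_sub (t := 0) hjl fun i hi hik =>
      (mul_nonneg hκ.le (rpow_pnat_pos i _).le).trans (hgap i (hj.trans hi))
    linarith
  nlinarith

/-- For large `n` the gap estimate extends to all `m < n`: the finitely many eigenvalues below the
index `N₀` are at bounded distance from `μ_{N₀}`, while `μ_n - μ_{N₀}` grows like `n^γ`. -/
lemma exists_gap {μ : ℕ+ → ℝ} {γ κ : ℝ} (hγ : 0 < γ) (hκ : 0 < κ) {N₀ : ℕ+}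
    (hgap : ∀ k, N₀ ≤ k → κ * (k : ℝ) ^ (γ - 1) ≤ μ (k + 1) - μ k) :
    ∃ c > 0, ∃ N₁, N₀ ≤ N₁ ∧ ∀ n, N₁ ≤ n → ∀ m, m < n →
      c * (((n : ℝ) - m + 1) * (n : ℝ) ^ (γ - 1)) ≤ μ n - μ m := by
  set c := κ * 2 ^ (-|γ - 1|) / 2 with hc
  have hc0 : 0 < c := by positivity
  set D := ∑ m ∈ Finset.Icc 1 N₀, |μ m - μ N₀|
  have hD : ∀ m ≤ N₀, μ m - μ N₀ ≤ D := fun m hm =>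
    (le_abs_self _).trans (Finset.single_le_sum (f := fun m => |μ m - μ N₀|)
      (fun _ _ => abs_nonneg _) (Finset.mem_Icc.2 ⟨one_le, hm⟩))
  have hlim : ∀ᶠ n : ℕ+ in atTop, D ≤ c / 4 * (n : ℝ) ^ γ :=
    (((tendsto_rpow_atTop hγ).comp tendsto_pnat_cast).const_mul_atTop
      (by positivity : 0 < c / 4)).eventually_ge_atTop D
  obtain ⟨N₂, hN₂⟩ := eventually_atTop.1 hlim
  refine ⟨c / 4, by positivity, max (2 * N₀) N₂, ?_, fun n hn m hm => ?_⟩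
  · refine le_trans ?_ (le_max_left _ _)
    rw [← PNat.coe_le_coe, PNat.mul_coe]
    have := N₀.pos
    change _ ≤ 2 * (N₀ : ℕ)
    omega
  have hn1 : 2 * (N₀ : ℝ) ≤ n := by
    have : 2 * N₀ ≤ n := (le_max_left _ _).trans hn
    exact_mod_cast this
  have hN0 := pnat_cast_pos N₀
  have hn0 := pnat_cast_pos n
  have hp := rpow_pnat_pos n (γ - 1)
  have hmn : (m : ℝ) + 1 ≤ n := by exact_mod_cast hm
  have hm1 := pnat_one_le_cast m
  rcases le_total N₀ m with h | h
  · have h1 := gap_of_le hκ hgap h hm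
    rw [← hc] at h1
    refine le_trans ?_ h1
    rw [mul_assoc c]
    have : c / 4 * (((n : ℝ) - m + 1) * (n : ℝ) ^ (γ - 1)) ≤ c * (((n : ℝ) - m) * (n : ℝ) ^ (γ - 1)) := by
      have : ((n : ℝ) - m + 1) * (n : ℝ) ^ (γ - 1) ≤ (4 * ((n : ℝ) - m)) * (n : ℝ) ^ (γ - 1) :=
        mul_le_mul_of_nonneg_right (by linarith) hp.le
      nlinarith
    exact this
  · have hlt : N₀ < n := by
      rw [← PNat.coe_lt_coe]
      have : (N₀ : ℝ) < n := by linarith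
      exact_mod_cast this
    have h1 := gap_of_le hκ hgap le_rfl hlt
    rw [← hc] at h1
    have h2 := hD m h
    have h3 := hN₂ n ((le_max_right _ _).trans hn)
    have e : (n : ℝ) ^ γ = n * (n : ℝ) ^ (γ - 1) := by
      rw [Real.rpow_sub_one hn0.ne']; field_simp
    rw [e] at h3
    have h4 : ((n : ℝ) - m + 1) * (n : ℝ) ^ (γ - 1) ≤ n * (n : ℝ) ^ (γ - 1) :=
      mul_le_mul_of_nonneg_right (by linarith) hp.le
    have h5 : (n / 2 : ℝ) * (n : ℝ) ^ (γ - 1) ≤ (n - N₀ : ℝ) * (n : ℝ) ^ (γ - 1) :=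
      mul_le_mul_of_nonneg_right (by linarith) hp.le
    nlinarith

/-- The gaps force growth of order `k^γ`; positivity takes care of the small indices. -/
lemma exists_growth {μ : ℕ+ → ℝ} (hμ : ∀ k, 0 < μ k) {γ c : ℝ} (hc : 0 < c) {N₁ : ℕ+}
    (h : ∀ n, N₁ ≤ n → ∀ m, m < n →
      c * (((n : ℝ) - m + 1) * (n : ℝ) ^ (γ - 1)) ≤ μ n - μ m) :
    ∃ c' > 0, ∀ k : ℕ+, c' * (k : ℝ) ^ γ ≤ μ k := by
  obtain ⟨k₀, -, hk₀⟩ := Finset.exists_min_image (Finset.Icc 1 (2 * N₁))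
    (fun k : ℕ+ => μ k / (k : ℝ) ^ γ) ⟨1, Finset.mem_Icc.2 ⟨le_rfl, one_le⟩⟩
  have hq : 0 < μ k₀ / (k₀ : ℝ) ^ γ := div_pos (hμ _) (rpow_pnat_pos _ _)
  refine ⟨min (c / 2) (μ k₀ / (k₀ : ℝ) ^ γ), lt_min (by positivity) hq, fun k => ?_⟩
  have hk := rpow_pnat_pos k γ
  rcases le_or_gt k (2 * N₁) with hle | hgt
  · have h1 := hk₀ k (Finset.mem_Icc.2 ⟨one_le, hle⟩)
    rw [le_div_iff₀ hk] at h1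
    exact (mul_le_mul_of_nonneg_right (min_le_right _ _) hk.le).trans h1
  · refine (mul_le_mul_of_nonneg_right (min_le_left _ _) hk.le).trans ?_
    have hk0 := pnat_cast_pos k
    have e : (k : ℝ) ^ γ = k * (k : ℝ) ^ (γ - 1) := by
      rw [Real.rpow_sub_one hk0.ne']; field_simp
    have h2 : 2 * (N₁ : ℝ) ≤ k := by exact_mod_cast hgt.le
    have hN := pnat_cast_pos N₁
    have hlt : N₁ < k := by
      rw [← PNat.coe_lt_coe]
      have : (N₁ : ℝ) < k := by linarith
      exact_mod_cast this
    have h1 := h k hlt.le N₁ hlt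
    have hp := rpow_pnat_pos k (γ - 1)
    have h4 : (k / 2 : ℝ) * (k : ℝ) ^ (γ - 1) ≤ (k - N₁ + 1 : ℝ) * (k : ℝ) ^ (γ - 1) :=
      mul_le_mul_of_nonneg_right (by linarith) hp.le
    have := hμ N₁
    rw [e]
    nlinarith

/-! ### The weighted sums -/

lemma sum_le_sum_nat {f : ℕ → ℝ} (hf : ∀ i, 0 ≤ f i) (F : Finset ℕ+) (G : Finset ℕ) (e : ℕ+ → ℕ)
    (he : Set.InjOn e F) (h : ∀ m ∈ F, e m ∈ G) : ∑ m ∈ F, f (e m) ≤ ∑ i ∈ G, f i := by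
  rw [← Finset.sum_image he]
  refine Finset.sum_le_sum_of_subset_of_nonneg ?_ fun i _ _ => hf i
  intro i hi
  obtain ⟨m, hm, rfl⟩ := Finset.mem_image.1 hi
  exact h m hm

lemma log_exp_mul (n : ℕ+) : Real.log (Real.exp 1 * n) = 1 + Real.log n := by
  rw [Real.log_mul (Real.exp_pos _).ne' (pnat_cast_pos n).ne', Real.log_exp]

lemma sum_inv_le_log (n : ℕ+) :
    ∑ i ∈ Finset.Icc 1 (n : ℕ), ((i : ℝ))⁻¹ ≤ Real.log (Real.exp 1 * n) := by
  have h := harmonic_le_one_add_log n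
  rw [harmonic_eq_sum_Icc] at h
  push_cast at h
  rw [log_exp_mul]
  exact h

lemma one_le_log_exp_mul (n : ℕ+) : 1 ≤ Real.log (Real.exp 1 * n) := by
  rw [log_exp_mul]
  linarith [Real.log_nonneg (pnat_one_le_cast n)]

lemma sigma_pos (s γ : ℝ) (n : ℕ+) : 0 < sigma s γ n := by
  unfold sigma
  split_ifs
  · exact mul_pos (rpow_pnat_pos _ _) (one_pos.trans_le (one_le_log_exp_mul n))
  · exact rpow_pnat_pos _ _

lemma tendsto_sigma {s γ : ℝ} (hγ : 0 < γ) (hs : 1 < s + γ) :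
    Tendsto (sigma s γ) atTop (𝓝 0) := by
  unfold sigma
  split_ifs with h
  · have hq : 0 < s + γ - 1 := by linarith
    have h1 : Tendsto (fun x : ℝ => x ^ (-(s + γ - 1)) + Real.log x / x ^ (s + γ - 1)) atTop
        (𝓝 (0 + 0)) :=
      (tendsto_rpow_neg_atTop hq).add (isLittleO_log_rpow_atTop hq).tendsto_div_nhds_zero
    rw [add_zero] at h1
    refine (h1.comp tendsto_pnat_cast).congr fun n => ?_
    have hn := pnat_cast_pos n
    simp only [Function.comp]
    rw [log_exp_mul, show -s - γ + 1 = -(s + γ - 1) by ring, mul_add, mul_one, Real.rpow_neg hn.le,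
      div_eq_inv_mul]
  · exact (tendsto_rpow_neg_atTop hγ).comp tendsto_pnat_cast

/-- Partial sums of `∑ m^{-s}`. -/
lemma sum_rpow_neg_le (s : ℝ) : ∃ C > 0, ∀ (n : ℕ+) (F : Finset ℕ+), (∀ m ∈ F, m ≤ n) →
    ∑ m ∈ F, (m : ℝ) ^ (-s) ≤
      C * if s ≤ 1 then (n : ℝ) ^ (1 - s) * Real.log (Real.exp 1 * n) else 1 := by
  rcases le_or_gt s 1 with hs | hs
  · refine ⟨1, one_pos, fun n F hF => ?_⟩
    rw [if_pos hs, one_mul]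
    calc ∑ m ∈ F, (m : ℝ) ^ (-s) ≤ ∑ m ∈ F, (n : ℝ) ^ (1 - s) * (((m : ℕ) : ℝ))⁻¹ := by
          refine Finset.sum_le_sum fun m hm => ?_
          have hm0 := pnat_cast_pos m
          have hmn : (m : ℝ) ≤ n := by exact_mod_cast hF m hm
          rw [show -s = (1 - s) - 1 by ring, Real.rpow_sub_one hm0.ne', div_eq_mul_inv]
          exact mul_le_mul_of_nonneg_right (Real.rpow_le_rpow hm0.le hmn (by linarith))
            (by positivity)
      _ = (n : ℝ) ^ (1 - s) * ∑ m ∈ F, (((m : ℕ) : ℝ))⁻¹ := by rw [Finset.mul_sum]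
      _ ≤ (n : ℝ) ^ (1 - s) * Real.log (Real.exp 1 * n) := by
          refine mul_le_mul_of_nonneg_left ?_ (rpow_pnat_pos _ _).le
          refine (sum_le_sum_nat (f := fun i => ((i : ℝ))⁻¹) (fun i => by positivity) F
            (Finset.Icc 1 (n : ℕ)) (fun m => (m : ℕ)) PNat.coe_injective.injOn
            fun m hm => Finset.mem_Icc.2 ⟨m.pos, hF m hm⟩).trans (sum_inv_le_log n)
  · have hsum : Summable fun i : ℕ => (i : ℝ) ^ (-s) := Real.summable_nat_rpow.2 (by linarith)
    have hnn : ∀ i : ℕ, (0 : ℝ) ≤ (i : ℝ) ^ (-s) := fun i => by positivity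
    refine ⟨∑' i : ℕ, (i : ℝ) ^ (-s), ?_, fun n F hF => ?_⟩
    · exact hsum.tsum_pos hnn 1 (by simp)
    · rw [if_neg (by linarith), mul_one]
      refine (sum_le_sum_nat (f := fun i => (i : ℝ) ^ (-s)) hnn F (Finset.Icc 1 (n : ℕ))
        (fun m => (m : ℕ)) PNat.coe_injective.injOn
        fun m hm => Finset.mem_Icc.2 ⟨m.pos, hF m hm⟩).trans ?_
      exact hsum.sum_le_tsum _ fun i _ => hnn i

lemma sum_inv_dist_le (n : ℕ+) (F : Finset ℕ+) (hF : ∀ m ∈ F, m ≤ 2 * n) :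
    ∑ m ∈ F, (|(n : ℝ) - m| + 1)⁻¹ ≤ 2 * Real.log (Real.exp 1 * n) := by
  rw [← Finset.sum_filter_add_sum_filter_not F (fun m => m ≤ n), two_mul]
  refine add_le_add ?_ ?_
  · have h := sum_le_sum_nat (f := fun i => ((i : ℝ))⁻¹) (fun i => by positivity)
      (F.filter fun m => m ≤ n) (Finset.Icc 1 (n : ℕ)) (fun m => (n : ℕ) - m + 1) ?_ ?_
    · refine le_trans (le_of_eq (Finset.sum_congr rfl fun m hm => ?_)) (h.trans (sum_inv_le_log n))
      have hmn : (m : ℕ) ≤ n := (Finset.mem_filter.1 hm).2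
      have hmn' : (m : ℝ) ≤ n := by exact_mod_cast hmn
      rw [abs_of_nonneg (by linarith)]
      push_cast [Nat.cast_sub hmn]
      rfl
    · intro m hm m' hm' hmm
      have h1 : (m : ℕ) ≤ n := (Finset.mem_filter.1 hm).2
      have h2 : (m' : ℕ) ≤ n := (Finset.mem_filter.1 hm').2
      apply PNat.coe_injective
      simp only at hmm
      omega
    · intro m hm
      have h1 : (m : ℕ) ≤ n := (Finset.mem_filter.1 hm).2
      have := m.pos
      rw [Finset.mem_Icc]
      omega
  · have h := sum_le_sum_nat (f := fun i => ((i : ℝ))⁻¹) (fun i => by positivity)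
      (F.filter fun m => ¬ m ≤ n) (Finset.Icc 1 (n : ℕ)) (fun m => (m : ℕ) - n) ?_ ?_
    · refine le_trans (Finset.sum_le_sum fun m hm => ?_) (h.trans (sum_inv_le_log n))
      have hmn : (n : ℕ) < m := not_le.1 (Finset.mem_filter.1 hm).2
      have hmn' : (n : ℝ) < m := by exact_mod_cast hmn
      rw [abs_of_neg (by linarith)]
      push_cast [Nat.cast_sub hmn.le]
      exact inv_anti₀ (by linarith) (by linarith)
    · intro m hm m' hm' hmm
      have h1 : (n : ℕ) < m := not_le.1 (Finset.mem_filter.1 hm).2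
      have h2 : (n : ℕ) < m' := not_le.1 (Finset.mem_filter.1 hm').2
      apply PNat.coe_injective
      simp only at hmm
      omega
    · intro m hm
      have h1 : (n : ℕ) < m := not_le.1 (Finset.mem_filter.1 hm).2
      have h2 : (m : ℕ) ≤ 2 * n := by exact_mod_cast hF m (Finset.mem_filter.1 hm).1
      rw [Finset.mem_Icc]
      omega

/-- The discrete form of `x^{-q-1} = -q⁻¹ (x^{-q})'`, which makes the tail of the series telescope. -/
lemma rpow_neg_succ_le {q : ℝ} (hq : 0 < q) {m : ℕ} (hm : 1 ≤ m) :
    ((m + 1 : ℕ) : ℝ) ^ (-q - 1) ≤ q⁻¹ * ((m : ℝ) ^ (-q) - ((m + 1 : ℕ) : ℝ) ^ (-q)) := by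
  have hm0 : (0 : ℝ) < m := by exact_mod_cast hm
  have hm1 : (0 : ℝ) < ((m + 1 : ℕ) : ℝ) := by positivity
  set x : ℝ := ((m + 1 : ℕ) : ℝ) with hx
  have hxm : (m : ℝ) = x - 1 := by rw [hx]; push_cast; ring
  have h1 : 1 + q / x ≤ ((m : ℝ) / x) ^ (-q) := by
    rw [Real.rpow_def_of_pos (by positivity)]
    have h2 : Real.log (m / x) ≤ -(1 / x) := by
      have := Real.log_le_sub_one_of_pos (show 0 < (m : ℝ) / x by positivity)
      have e : (m : ℝ) / x - 1 = -(1 / x) := by rw [hxm]; field_simp; ring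
      linarith
    have h3 := Real.add_one_le_exp (Real.log (m / x) * -q)
    have h4 : q / x ≤ Real.log (m / x) * -q := by
      rw [div_eq_mul_one_div]
      nlinarith
    linarith
  have h5 : (m : ℝ) ^ (-q) = ((m : ℝ) / x) ^ (-q) * x ^ (-q) := by
    rw [← Real.mul_rpow (by positivity) hm1.le, div_mul_cancel₀ _ hm1.ne']
  have h6 : 0 < x ^ (-q) := Real.rpow_pos_of_pos hm1 _
  rw [le_inv_mul_iff₀ hq, h5, Real.rpow_sub_one hm1.ne']
  have := mul_le_mul_of_nonneg_right h1 h6.le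
  calc q * (x ^ (-q) / x) = (1 + q / x) * x ^ (-q) - x ^ (-q) := by ring
    _ ≤ _ := by linarith

lemma sum_tail_le {q : ℝ} (hq : 0 < q) (n : ℕ+) (F : Finset ℕ+) (hF : ∀ m ∈ F, n < m) :
    ∑ m ∈ F, (m : ℝ) ^ (-q - 1) ≤ q⁻¹ * (n : ℝ) ^ (-q) := by
  have key : ∀ K : ℕ, (n : ℕ) ≤ K → ∑ i ∈ Finset.Ioc (n : ℕ) K, (i : ℝ) ^ (-q - 1) ≤
      q⁻¹ * ((n : ℝ) ^ (-q) - (K : ℝ) ^ (-q)) := by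
    intro K hK
    induction K, hK using Nat.le_induction with
    | base => simp
    | succ K hK ih =>
      rw [Finset.sum_Ioc_succ_top hK]
      have := rpow_neg_succ_le hq (n.pos.trans_le hK : 1 ≤ K)
      push_cast at this ⊢
      linarith
  set K := (n : ℕ) + ∑ m ∈ F, (m : ℕ)
  have h := sum_le_sum_nat (f := fun i => (i : ℝ) ^ (-q - 1)) (fun i => by positivity) F
    (Finset.Ioc (n : ℕ) K) (fun m => (m : ℕ)) PNat.coe_injective.injOn fun m hm => by
      rw [Finset.mem_Ioc]
      have := Finset.single_le_sum (f := fun m : ℕ+ => (m : ℕ)) (fun _ _ => Nat.zero_le _) hm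
      refine ⟨hF m hm, ?_⟩
      omega
  refine h.trans ((key K (Nat.le_add_right _ _)).trans ?_)
  refine mul_le_mul_of_nonneg_left ?_ (by positivity)
  have : (0 : ℝ) ≤ (K : ℝ) ^ (-q) := by positivity
  linarith

/-- The model lower bound for `|μ_m - μ_n|`. -/
def gapModel (γ : ℝ) (n m : ℕ+) : ℝ := (|(n : ℝ) - m| + 1) * (max (n : ℝ) m) ^ (γ - 1)

lemma gapModel_pos (γ : ℝ) (n m : ℕ+) : 0 < gapModel γ n m :=
  mul_pos (by positivity) (Real.rpow_pos_of_pos (lt_max_of_lt_left (pnat_cast_pos n)) _)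

/-- The sum over all eigenvalues that measures the size of `B(z)` for `z` near `μ_n`: the three
parts `m ≤ n / 2`, `n / 2 < m ≤ 2 n` and `m > 2 n` are estimated separately. -/
lemma sum_gapModel_le {s γ : ℝ} (hs : 1 < s + γ) :
    ∃ C > 0, ∀ (n : ℕ+) (F : Finset ℕ+),
      ∑ m ∈ F, (m : ℝ) ^ (-s) / gapModel γ n m ≤ C * sigma s γ n := by
  obtain ⟨C₁, hC₁, h₁⟩ := sum_rpow_neg_le s
  set q := s + γ - 1 with hq
  have hq0 : 0 < q := by linarith
  set C₂ : ℝ := 2 ^ |s| * 2 ^ |γ - 1| * 2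
  set C₃ : ℝ := if s ≤ 1 then 1 else 1 + 1 / (s - 1) with hC₃
  have hC₃1 : 1 ≤ C₃ := by
    rw [hC₃]; split_ifs with h
    · exact le_rfl
    · have : 0 < 1 / (s - 1) := one_div_pos.2 (by linarith)
      linarith
  have hC₂ : 0 < C₂ := by positivity
  refine ⟨2 * C₁ + C₂ * C₃ + 2 * q⁻¹, by positivity, fun n F => ?_⟩
  have hn0 := pnat_cast_pos n
  have hn1 := pnat_one_le_cast n
  have hσ := sigma_pos s γ n
  -- `n^{1-s-γ} log(en)` is within a constant of `σ(n)`
  have hσ2 : (n : ℝ) ^ (-q) * Real.log (Real.exp 1 * n) ≤ C₃ * sigma s γ n := by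
    rw [hC₃, sigma]
    split_ifs with h
    · rw [one_mul, show -q = -s - γ + 1 by ring]
    · have hs1 : 0 < s - 1 := by linarith
      have h2 := Real.log_le_rpow_div hn0.le hs1
      have h3 : (n : ℝ) ^ (-q) = (n : ℝ) ^ (-(s - 1)) * (n : ℝ) ^ (-γ) := by
        rw [← Real.rpow_add hn0]; congr 1; ring
      have h4 : (n : ℝ) ^ (-(s - 1)) * Real.log (Real.exp 1 * n) ≤ 1 + 1 / (s - 1) := by
        rw [log_exp_mul, mul_add, mul_one]
        refine add_le_add (Real.rpow_le_one_of_one_le_of_nonpos hn1 (by linarith)) ?_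
        calc _ ≤ (n : ℝ) ^ (-(s - 1)) * ((n : ℝ) ^ (s - 1) / (s - 1)) :=
              mul_le_mul_of_nonneg_left h2 (rpow_pnat_pos _ _).le
          _ = 1 / (s - 1) := by
              rw [mul_div_assoc', ← Real.rpow_add hn0, neg_add_cancel, Real.rpow_zero]
      rw [h3, mul_right_comm]
      exact mul_le_mul_of_nonneg_right h4 (rpow_pnat_pos _ _).le
  have hσ3 : (n : ℝ) ^ (-q) ≤ sigma s γ n := by
    rw [sigma]
    split_ifs with h
    · rw [show -s - γ + 1 = -q by ring]
      exact le_mul_of_one_le_right (rpow_pnat_pos _ _).le (one_le_log_exp_mul n)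
    · exact Real.rpow_le_rpow_of_exponent_le hn1 (by linarith)
  have hσ1 : (n : ℝ) ^ (-γ) *
      (if s ≤ 1 then (n : ℝ) ^ (1 - s) * Real.log (Real.exp 1 * n) else 1) = sigma s γ n := by
    rw [sigma]
    split_ifs with h
    · rw [← mul_assoc, ← Real.rpow_add hn0]; congr 2; ring
    · rw [mul_one]
  -- for `m ≤ n / 2` the denominator is comparable with `n^γ`
  have a1 : ∀ m ∈ F.filter (fun m : ℕ+ => 2 * (m : ℝ) ≤ n),
      (m : ℝ) ^ (-s) / gapModel γ n m ≤ 2 * (n : ℝ) ^ (-γ) * (m : ℝ) ^ (-s) := by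
    intro m hm
    have hm2 := (Finset.mem_filter.1 hm).2
    have hm0 := pnat_cast_pos m
    have hp := rpow_pnat_pos n (γ - 1)
    have hmp := rpow_pnat_pos m (-s)
    rw [gapModel, max_eq_left (by linarith), abs_of_nonneg (by linarith), div_le_iff₀
      (mul_pos (by linarith) hp)]
    have e : (n : ℝ) ^ (-γ) * (n : ℝ) ^ (γ - 1) = (n : ℝ)⁻¹ := by
      rw [← Real.rpow_add hn0, ← Real.rpow_neg_one]; congr 1; ring
    have h : 1 ≤ 2 * (n : ℝ)⁻¹ * (n - m + 1) := by
      rw [mul_right_comm, ← div_eq_mul_inv, le_div_iff₀ hn0]; linarith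
    calc (m : ℝ) ^ (-s) ≤ (2 * (n : ℝ)⁻¹ * (n - m + 1)) * (m : ℝ) ^ (-s) :=
          le_mul_of_one_le_left hmp.le h
      _ = _ := by rw [← e]; ring
  -- for `m` comparable with `n` only the factor `|n - m| + 1` varies
  have a2 : ∀ m ∈ (F.filter (fun m : ℕ+ => ¬ 2 * (m : ℝ) ≤ n)).filter (fun m : ℕ+ => m ≤ 2 * n),
      (m : ℝ) ^ (-s) / gapModel γ n m ≤
        2 ^ |s| * 2 ^ |γ - 1| * (n : ℝ) ^ (-q) * (|(n : ℝ) - m| + 1)⁻¹ := by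
    intro m hm
    have hm1 := not_le.1 (Finset.mem_filter.1 (Finset.mem_filter.1 hm).1).2
    have hm2 : (m : ℝ) ≤ 2 * n := by exact_mod_cast (Finset.mem_filter.1 hm).2
    have h1 := (rpow_comparable (-s) hn0 (by linarith) hm2).2
    rw [abs_neg] at h1
    have h2 := (rpow_comparable (-(γ - 1)) hn0 (x := max (n : ℝ) m)
      ((by linarith : (n : ℝ) / 2 ≤ n).trans (le_max_left _ _)) (max_le (by linarith) hm2)).2
    rw [abs_neg] at h2
    have hmax : 0 < max (n : ℝ) m := lt_max_of_lt_left hn0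
    have e : (n : ℝ) ^ (-q) = (n : ℝ) ^ (-s) * (n : ℝ) ^ (-(γ - 1)) := by
      rw [← Real.rpow_add hn0]; congr 1; ring
    rw [gapModel, div_eq_mul_inv, mul_inv, ← Real.rpow_neg hmax.le, e]
    have hi : 0 ≤ (|(n : ℝ) - m| + 1)⁻¹ := by positivity
    have h3 := mul_le_mul h1 h2 (by positivity) (by positivity)
    calc _ = ((m : ℝ) ^ (-s) * max (n : ℝ) m ^ (-(γ - 1))) * (|(n : ℝ) - m| + 1)⁻¹ := by ring
      _ ≤ _ := mul_le_mul_of_nonneg_right h3 hi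
      _ = _ := by ring
  -- for `m > 2 n` the denominator is comparable with `m^γ`
  have a3 : ∀ m ∈ (F.filter (fun m : ℕ+ => ¬ 2 * (m : ℝ) ≤ n)).filter (fun m : ℕ+ => ¬ m ≤ 2 * n),
      (m : ℝ) ^ (-s) / gapModel γ n m ≤ 2 * (m : ℝ) ^ (-q - 1) := by
    intro m hm
    have hm2 : 2 * (n : ℝ) < m := by exact_mod_cast not_le.1 (Finset.mem_filter.1 hm).2
    have hm0 := pnat_cast_pos m
    have hp := rpow_pnat_pos m (γ - 1)
    have hmp := rpow_pnat_pos m (-s)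
    rw [gapModel, max_eq_right (by linarith), abs_of_neg (by linarith), div_le_iff₀
      (mul_pos (by linarith) hp)]
    have e : (m : ℝ) ^ (-q - 1) * (m : ℝ) ^ (γ - 1) = (m : ℝ)⁻¹ * (m : ℝ) ^ (-s) := by
      rw [← Real.rpow_neg_one, ← Real.rpow_add hm0, ← Real.rpow_add hm0]; congr 1; ring
    have h : 1 ≤ 2 * (m : ℝ)⁻¹ * (-((n : ℝ) - m) + 1) := by
      rw [mul_right_comm, ← div_eq_mul_inv, le_div_iff₀ hm0]; linarith
    calc (m : ℝ) ^ (-s) ≤ (2 * (m : ℝ)⁻¹ * (-((n : ℝ) - m) + 1)) * (m : ℝ) ^ (-s) :=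
          le_mul_of_one_le_left hmp.le h
      _ = 2 * ((m : ℝ)⁻¹ * (m : ℝ) ^ (-s)) * (-((n : ℝ) - m) + 1) := by ring
      _ = _ := by rw [← e]; ring
  rw [← Finset.sum_filter_add_sum_filter_not F (fun m : ℕ+ => 2 * (m : ℝ) ≤ n),
    ← Finset.sum_filter_add_sum_filter_not (F.filter (fun m : ℕ+ => ¬ 2 * (m : ℝ) ≤ n))
      (fun m : ℕ+ => m ≤ 2 * n)]
  have b1 := Finset.sum_le_sum a1
  have b2 := Finset.sum_le_sum a2
  have b3 := Finset.sum_le_sum a3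
  rw [← Finset.mul_sum] at b1 b2 b3
  have c1 := h₁ n (F.filter (fun m : ℕ+ => 2 * (m : ℝ) ≤ n)) fun m hm => by
    have := (Finset.mem_filter.1 hm).2
    have hm0 := pnat_cast_pos m
    have : (m : ℝ) ≤ n := by linarith
    exact_mod_cast this
  have c2 := sum_inv_dist_le n
    ((F.filter (fun m : ℕ+ => ¬ 2 * (m : ℝ) ≤ n)).filter (fun m : ℕ+ => m ≤ 2 * n))
    fun m hm => (Finset.mem_filter.1 hm).2
  have c3 := sum_tail_le hq0 n
    ((F.filter (fun m : ℕ+ => ¬ 2 * (m : ℝ) ≤ n)).filter (fun m : ℕ+ => ¬ m ≤ 2 * n)) fun m hm => by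
      have h : 2 * n < m := not_le.1 (Finset.mem_filter.1 hm).2
      have h' : 2 * (n : ℝ) < m := by exact_mod_cast h
      have : (n : ℝ) < m := by linarith
      exact_mod_cast this
  have d1 := b1.trans (mul_le_mul_of_nonneg_left c1
    (by have := rpow_pnat_pos n (-γ); positivity))
  have d2 := b2.trans (mul_le_mul_of_nonneg_left c2
    (by have := rpow_pnat_pos n (-q); positivity))
  have d3 := b3.trans (mul_le_mul_of_nonneg_left c3 (by norm_num))
  have e1 : 2 * (n : ℝ) ^ (-γ) * (C₁ *
      if s ≤ 1 then (n : ℝ) ^ (1 - s) * Real.log (Real.exp 1 * n) else 1) =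
      2 * C₁ * sigma s γ n := by rw [← hσ1]; ring
  have e2 : 2 ^ |s| * 2 ^ |γ - 1| * (n : ℝ) ^ (-q) * (2 * Real.log (Real.exp 1 * n)) ≤
      C₂ * C₃ * sigma s γ n := by
    calc _ = C₂ * ((n : ℝ) ^ (-q) * Real.log (Real.exp 1 * n)) := by ring
      _ ≤ C₂ * (C₃ * sigma s γ n) := mul_le_mul_of_nonneg_left hσ2 hC₂.le
      _ = _ := by ring
  have e3 : 2 * (q⁻¹ * (n : ℝ) ^ (-q)) ≤ 2 * q⁻¹ * sigma s γ n := by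
    rw [← mul_assoc]
    exact mul_le_mul_of_nonneg_left hσ3 (by positivity)
  rw [e1] at d1
  linarith

lemma tsum_gapModel_le {s γ : ℝ} (hs : 1 < s + γ) :
    ∃ C > 0, ∀ n : ℕ+, Summable (fun m : ℕ+ => (m : ℝ) ^ (-s) / gapModel γ n m) ∧
      ∑' m : ℕ+, (m : ℝ) ^ (-s) / gapModel γ n m ≤ C * sigma s γ n := by
  obtain ⟨C, hC, h⟩ := sum_gapModel_le hs
  refine ⟨C, hC, fun n => ?_⟩
  have hsum : Summable (fun m : ℕ+ => (m : ℝ) ^ (-s) / gapModel γ n m) :=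
    summable_of_sum_le (fun m => div_nonneg (rpow_pnat_pos m _).le (gapModel_pos γ n m).le) (h n)
  exact ⟨hsum, hsum.tsum_le_of_sum_le (h n)⟩

/-! ### A quantitative simple zero -/

/-- If `p` is small on a disc about `c`, then `z - c + p(z)` has exactly one zero near `c`, and it
is simple: by Cauchy's estimate `z ↦ c - p(z)` is a contraction of the half disc. -/
lemma exists_simple_zero {p : ℂ → ℂ} {c : ℂ} {δ : ℝ} (hδ : 0 < δ)
    (hd : ∀ z ∈ Metric.closedBall c δ, DifferentiableAt ℂ p z)
    (hp : ∀ z ∈ Metric.closedBall c δ, ‖p z‖ ≤ δ / 16) :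
    ∃ z₀ ∈ Metric.closedBall c (δ / 2), z₀ - c + p z₀ = 0 ∧ 1 + deriv p z₀ ≠ 0 ∧
      ∀ z ∈ Metric.closedBall c (δ / 2), z - c + p z = 0 → z = z₀ := by
  set s := Metric.closedBall c (δ / 2) with hs
  have hsub : s ⊆ Metric.closedBall c δ := Metric.closedBall_subset_closedBall (by linarith)
  have hder : ∀ z ∈ s, ‖deriv p z‖ ≤ 1 / 8 := by
    intro z hz
    have hb : Metric.closedBall z (δ / 2) ⊆ Metric.closedBall c δ := by
      intro x hx
      rw [Metric.mem_closedBall] at *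
      linarith [dist_triangle x z c, Metric.mem_closedBall.1 hz]
    have h := Complex.norm_deriv_le_of_forall_mem_sphere_norm_le (c := z) (R := δ / 2)
      (C := δ / 16) (f := p) (by linarith)
      (DifferentiableOn.diffContOnCl fun x hx =>
        (hd x (hb (closure_minimal Metric.ball_subset_closedBall Metric.isClosed_closedBall hx))).differentiableWithinAt)
      fun x hx => hp x (hb (Metric.sphere_subset_closedBall hx))
    refine h.trans (le_of_eq ?_)
    field_simp
    norm_num
  have hlip : ∀ x ∈ s, ∀ y ∈ s, ‖p y - p x‖ ≤ 1 / 8 * ‖y - x‖ := fun x hx y hy =>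
    (convex_closedBall c (δ / 2)).norm_image_sub_le_of_norm_deriv_le
      (fun z hz => hd z (hsub hz)) hder hx hy
  let g : ℂ → ℂ := fun z => c - p z
  have hmaps : Set.MapsTo g s s := by
    intro z hz
    rw [hs, Metric.mem_closedBall, dist_eq_norm]
    have := hp z (hsub hz)
    simp only [g, sub_sub_cancel_left, norm_neg]
    linarith
  have hcontr : ContractingWith (1 / 8) (Set.MapsTo.restrict g s s hmaps) := by
    refine ⟨by rw [div_lt_one (by norm_num)]; norm_num, LipschitzWith.of_dist_le_mul ?_⟩
    rintro ⟨x, hx⟩ ⟨y, hy⟩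
    have h := hlip x hx y hy
    rw [Subtype.dist_eq, Subtype.dist_eq, dist_eq_norm, dist_eq_norm]
    simp only [Set.MapsTo.val_restrict_apply, g, sub_sub_sub_cancel_left]
    rw [norm_sub_rev x y]
    simpa using h
  have hc : c ∈ s := Metric.mem_closedBall_self (by linarith)
  obtain ⟨z₀, hz₀, hfix, -, -⟩ := hcontr.exists_fixedPoint' (x := c)
    (Metric.isClosed_closedBall.isComplete) hmaps hc (edist_ne_top _ _)
  have hz₀' : c - p z₀ = z₀ := hfix
  refine ⟨z₀, hz₀, by linear_combination -hz₀', ?_, fun z hz h0 => ?_⟩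
  · intro h
    have h1 := hder z₀ hz₀
    rw [← eq_neg_iff_add_eq_zero] at h
    have h2 : deriv p z₀ = -1 := by rw [h, neg_neg]
    rw [h2, norm_neg, norm_one] at h1
    norm_num at h1
  · have h1 := hlip z₀ hz₀ z hz
    have h2 : p z - p z₀ = -(z - z₀) := by linear_combination h0 + hz₀'
    rw [h2, norm_neg] at h1
    have h3 : ‖z - z₀‖ ≤ 0 := by linarith
    rwa [norm_le_zero_iff, sub_eq_zero] at h3

lemma norm_inverse_one_sub_le {t : H →L[ℂ] H} (ht : ‖t‖ ≤ 1 / 2) :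
    ‖Ring.inverse (1 - t)‖ ≤ 2 := by
  have hu : IsUnit (1 - t) := isUnit_one_sub_of_norm_lt_one (by linarith)
  set G := Ring.inverse (1 - t)
  have h1 : G = 1 + t * G := by
    have : (1 - t) * G = 1 := Ring.mul_inverse_cancel _ hu
    rw [sub_mul, one_mul, sub_eq_iff_eq_add] at this
    exact this
  have h2 : ‖G‖ ≤ 1 + 1 / 2 * ‖G‖ := by
    calc ‖G‖ = ‖1 + t * G‖ := by rw [← h1]
      _ ≤ ‖(1 : H →L[ℂ] H)‖ + ‖t * G‖ := norm_add_le _ _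
      _ ≤ 1 + 1 / 2 * ‖G‖ := add_le_add ContinuousLinearMap.norm_id_le
        ((norm_mul_le _ _).trans (mul_le_mul_of_nonneg_right ht (norm_nonneg _)))
  linarith

/-! ### The pencil on one box -/

/-- The box `Π_n` isolates `μ_n`: `l_m` is a lower bound for `|z - μ_m|` on the closed box for
`m ≠ n` and on its boundary for `m = n`, and `∑ w_m² / l_m` is small. -/
structure IsolatedBox (μ w : ℕ+ → ℝ) (M γ κ : ℝ) (n : ℕ+) (l : ℕ+ → ℝ) (θ : ℝ) : Prop where
  one_lt : 1 < n
  kappa_pos : 0 < κ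
  pos : 0 < l n
  le : ∀ m, l n ≤ l m
  dist_le : ∀ z ∈ closedBox μ γ κ n, ∀ m, m ≠ n → l m ≤ ‖z - μ m‖
  dist_self_le : ∀ z ∈ bdryBox μ γ κ n, l n ≤ ‖z - μ n‖
  ball : Metric.closedBall (μ n : ℂ) (l n) ⊆ closedBox μ γ κ n
  summable : Summable fun m => w m ^ 2 / l m
  small : M * ∑' m, w m ^ 2 / l m ≤ θ
  theta_le : θ ≤ 1 / 64

/-- The sequence `z - μ_m` with its `n`-th entry replaced by the constant `a`. -/
def shifted (μ : ℕ+ → ℝ) (n : ℕ+) (a : ℝ) (z : ℂ) (m : ℕ+) : ℂ := if m = n then a else z - μ m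

/-- The orthogonal projection onto `ψ_n`. -/
abbrev proj (ψ : HilbertBasis ℕ+ ℂ H) (n : ℕ+) : H →L[ℂ] H :=
  (innerSL ℂ (ψ n)).smulRight (ψ n)

lemma proj_apply (ψ : HilbertBasis ℕ+ ℂ H) (n : ℕ+) (f : H) :
    proj ψ n f = inner ℂ (ψ n) f • ψ n := rfl

lemma diagOp_add_smul_proj {ψ : HilbertBasis ℕ+ ℂ H} {c : ℕ+ → ℂ} (hc : IsBddSeq c) (n : ℕ+)
    (a : ℂ) : diagOp ψ (fun k => if k = n then a else c k) =
      diagOp ψ c + (a - c n) • proj ψ n := by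
  apply op_ext_inner ψ
  intro f k
  rw [inner_diagOp (isBddSeq_ite n a hc), add_apply, smul_apply, proj_apply, inner_add_right,
    inner_diagOp hc, inner_smul_right, inner_smul_right, inner_basis]
  split_ifs with h
  · subst h; ring
  · ring

namespace IsolatedBox

variable {μ : ℕ+ → ℝ} {ψ : HilbertBasis ℕ+ ℂ H}
    {b : formDomain μ ψ →ₗ[ℂ] formDomain μ ψ →ₗ⋆[ℂ] ℂ} {w : ℕ+ → ℝ} {M γ κ θ : ℝ} {n : ℕ+}
    {l : ℕ+ → ℝ}

section Scalar

lemma theta_nonneg (hb : IsolatedBox μ w M γ κ n l θ) (hM : 0 ≤ M) : 0 ≤ θ :=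
  le_trans (mul_nonneg hM (tsum_nonneg fun m =>
    div_nonneg (sq_nonneg _) (hb.pos.le.trans (hb.le m)))) hb.small

lemma le_norm_shifted (hb : IsolatedBox μ w M γ κ n l θ) {z : ℂ} (hz : z ∈ closedBox μ γ κ n)
    (m : ℕ+) : l m ≤ ‖shifted μ n (l n) z m‖ := by
  unfold shifted
  split_ifs with h
  · rw [h, Complex.norm_real]; exact le_abs_self _
  · exact hb.dist_le z hz m h

lemma le_norm_sub (hb : IsolatedBox μ w M γ κ n l θ) {z : ℂ} (hz : z ∈ bdryBox μ γ κ n)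
    (m : ℕ+) : l m ≤ ‖z - μ m‖ := by
  by_cases h : m = n
  · rw [h]; exact hb.dist_self_le z hz
  · exact hb.dist_le z hz.1 m h

lemma tsum_le (hb : IsolatedBox μ w M γ κ n l θ) (hM : 0 ≤ M) {ζ : ℕ+ → ℂ}
    (h : ∀ m, l m ≤ ‖ζ m‖) : M * ∑' k, w k ^ 2 / ‖ζ k‖ ≤ θ := by
  refine le_trans (mul_le_mul_of_nonneg_left ?_ hM) hb.small
  have hle : ∀ k, w k ^ 2 / ‖ζ k‖ ≤ w k ^ 2 / l k := fun k =>
    div_le_div_of_nonneg_left (sq_nonneg _) (hb.pos.trans_le (hb.le k)) (h k)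
  exact (Summable.of_nonneg_of_le (fun k => by positivity) hle hb.summable).tsum_le_tsum hle
    hb.summable

end Scalar

lemma comparable_shifted (hS : IsSubordinate μ ψ b w M) (hb : IsolatedBox μ w M γ κ n l θ) {z : ℂ}
    (hz : z ∈ closedBox μ γ κ n) : IsComparable μ (shifted μ n (l n) z) := by
  refine hS.comparable_of_le hb.pos (fun k => (hb.le k).trans (hb.le_norm_shifted hz k))
    (R := ‖z‖ + ‖((l n : ℝ) : ℂ) + μ n‖) fun k => ?_
  unfold shifted
  split_ifs with h
  · rw [h]; linarith [norm_nonneg z]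
  · rw [sub_add_cancel]; linarith [norm_nonneg (((l n : ℝ) : ℂ) + μ n)]

lemma comparable_sub (hS : IsSubordinate μ ψ b w M) (hb : IsolatedBox μ w M γ κ n l θ) {z : ℂ}
    (hz : z ∈ bdryBox μ γ κ n) : IsComparable μ (fun k => z - μ k) :=
  hS.comparable_sub ⟨l n, hb.pos, fun k => (hb.le k).trans (hb.le_norm_sub hz k)⟩

lemma norm_sandwich_shifted_le (hS : IsSubordinate μ ψ b w M) (hb : IsolatedBox μ w M γ κ n l θ)
    {z : ℂ} (hz : z ∈ closedBox μ γ κ n) : ‖hS.sandwich (shifted μ n (l n) z)‖ ≤ θ :=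
  (hS.norm_sandwich_le (hb.comparable_shifted hS hz)).trans
    (hb.tsum_le hS.const_pos.le (hb.le_norm_shifted hz))

lemma norm_sandwich_sub_le (hS : IsSubordinate μ ψ b w M) (hb : IsolatedBox μ w M γ κ n l θ)
    {z : ℂ} (hz : z ∈ bdryBox μ γ κ n) : ‖hS.sandwich (fun k => z - μ k)‖ ≤ θ :=
  (hS.norm_sandwich_le (hb.comparable_sub hS hz)).trans
    (hb.tsum_le hS.const_pos.le (hb.le_norm_sub hz))

lemma isUnit_shifted (hS : IsSubordinate μ ψ b w M) (hb : IsolatedBox μ w M γ κ n l θ) {z : ℂ}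
    (hz : z ∈ closedBox μ γ κ n) : IsUnit (hS.pencil (shifted μ n (l n) z)) :=
  hS.isUnit_pencil (hb.comparable_shifted hS hz)
    ((hb.norm_sandwich_shifted_le hS hz).trans_lt (by linarith [hb.theta_le]))

lemma diag_shifted_eq (hS : IsSubordinate μ ψ b w M) (n : ℕ+) (a : ℝ) (z : ℂ) :
    diagOp ψ (fun k => shifted μ n a z k / μ k) =
      z • diagOp ψ (fun k => if k = n then 0 else (μ k : ℂ)⁻¹) +
        diagOp ψ (fun k => if k = n then ((a : ℝ) : ℂ) / μ n else -1) := by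
  have h0 := isBddSeq_ite n 0 hS.bdd_inv
  rw [diagOp_smul z h0, diagOp_add ((isBddSeq_const z).mul h0)
    (isBddSeq_ite n (((a : ℝ) : ℂ) / μ n) (isBddSeq_const (-1)))]
  congr 1
  funext k
  have : (μ k : ℂ) ≠ 0 := by exact_mod_cast (hS.pos k).ne'
  unfold shifted
  split_ifs with h
  · rw [h]; ring
  · field_simp; ring

lemma differentiable_diag_shifted (hS : IsSubordinate μ ψ b w M) (n : ℕ+) (a : ℝ) :
    Differentiable ℂ (fun z => diagOp ψ (fun k => shifted μ n a z k / μ k)) := by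
  simp only [diag_shifted_eq hS]
  fun_prop

lemma differentiableOn_inverse_shifted (hS : IsSubordinate μ ψ b w M)
    (hb : IsolatedBox μ w M γ κ n l θ) {z : ℂ} (hz : z ∈ closedBox μ γ κ n) :
    DifferentiableAt ℂ (fun z => Ring.inverse (hS.pencil (shifted μ n (l n) z))) z := by
  have h1 : DifferentiableAt ℂ (fun z => hS.pencil (shifted μ n (l n) z)) z :=
    ((differentiable_diag_shifted hS n (l n)).sub_const _) z
  exact (differentiableAt_inverse (𝕜 := ℂ) (hb.isUnit_shifted hS hz)).comp z h1

/-- The entry `⟨Λ₁(z)⁻¹ ψ_n, ψ_n⟩` of the inverse of the shifted pencil. -/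
def diagEntry (hS : IsSubordinate μ ψ b w M) (n : ℕ+) (a : ℝ) (z : ℂ) : ℂ :=
  inner ℂ (ψ n) (Ring.inverse (hS.pencil (shifted μ n a z)) (ψ n))

/-- The coefficient of the rank one operator by which the pencil differs from the shifted one. -/
def shiftCoeff (μ : ℕ+ → ℝ) (n : ℕ+) (a : ℝ) (z : ℂ) : ℂ := (z - μ n - a) / μ n

/-- The characteristic function of the box: its zeros are the eigenvalues of `T` in it. -/
def charFun (hS : IsSubordinate μ ψ b w M) (n : ℕ+) (a : ℝ) (z : ℂ) : ℂ :=
  1 + shiftCoeff μ n a z * diagEntry hS n a z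

lemma pencil_sub_eq_shifted (hS : IsSubordinate μ ψ b w M) (hb : IsolatedBox μ w M γ κ n l θ)
    {z : ℂ} (hz : z ∈ closedBox μ γ κ n) :
    hS.pencil (fun k => z - μ k) =
      hS.pencil (shifted μ n (l n) z) + shiftCoeff μ n (l n) z • proj ψ n := by
  have h := diagOp_add_smul_proj (hS.bdd_div (hb.comparable_shifted hS hz)) n ((z - μ n) / μ n)
    (ψ := ψ)
  have e : (fun k => if k = n then (z - μ n) / (μ n : ℂ) else shifted μ n (l n) z k / μ k) =
      fun k => (z - μ k) / (μ k : ℂ) := by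
    funext k
    unfold shifted
    split_ifs with hk
    · rw [hk]
    · rfl
  rw [e] at h
  have e2 : (z - μ n) / (μ n : ℂ) - shifted μ n (l n) z n / μ n = shiftCoeff μ n (l n) z := by
    rw [shifted, if_pos rfl, shiftCoeff]; ring
  rw [e2] at h
  rw [IsSubordinate.pencil, h, IsSubordinate.pencil]
  abel

lemma proj_mul_mul_proj (ψ : HilbertBasis ℕ+ ℂ H) (n : ℕ+) (G : H →L[ℂ] H) :
    proj ψ n * G * proj ψ n = inner ℂ (ψ n) (G (ψ n)) • proj ψ n := by
  ext f
  change proj ψ n (G (proj ψ n f)) = inner ℂ (ψ n) (G (ψ n)) • proj ψ n f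
  rw [proj_apply, proj_apply, map_smul, inner_smul_right, smul_smul, mul_comm]

/-- The Sherman–Morrison formula for the pencil. -/
lemma pencil_mul_eq_one (hS : IsSubordinate μ ψ b w M) (hb : IsolatedBox μ w M γ κ n l θ)
    {z : ℂ} (hz : z ∈ closedBox μ γ κ n) (hE : charFun hS n (l n) z ≠ 0) :
    IsUnit (hS.pencil (fun k => z - μ k)) ∧ Ring.inverse (hS.pencil (fun k => z - μ k)) =
      Ring.inverse (hS.pencil (shifted μ n (l n) z)) -
        (shiftCoeff μ n (l n) z / charFun hS n (l n) z) •
          (Ring.inverse (hS.pencil (shifted μ n (l n) z)) * proj ψ n *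
            Ring.inverse (hS.pencil (shifted μ n (l n) z))) := by
  rw [hb.pencil_sub_eq_shifted hS hz]
  have hu := hb.isUnit_shifted hS hz
  set Λ := hS.pencil (shifted μ n (l n) z)
  set t := shiftCoeff μ n (l n) z with ht
  set G := Ring.inverse Λ with hG
  set E := charFun hS n (l n) z with hEdef
  set P := proj ψ n
  have h1 : Λ * G = 1 := Ring.mul_inverse_cancel _ hu
  have h2 : G * Λ = 1 := Ring.inverse_mul_cancel _ hu
  have h3 : P * G * P = diagEntry hS n (l n) z • P := proj_mul_mul_proj ψ n G
  have h4 : E = 1 + t * diagEntry hS n (l n) z := rfl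
  set s := diagEntry hS n (l n) z
  have key : t - t / E - t * (t / E) * s = 0 := by
    field_simp
    rw [h4]; ring
  have a1 : (Λ + t • P) * (G - (t / E) • (G * P * G)) = 1 := by
    calc (Λ + t • P) * (G - (t / E) • (G * P * G))
        = Λ * G - (t / E) • (Λ * G * P * G) + t • (P * G) - (t / E * t) • (P * G * P * G) := by
          simp only [add_mul, mul_sub, smul_mul_assoc, mul_smul_comm, smul_add, smul_smul,
            mul_assoc]
          abel
      _ = 1 + (t - t / E - t / E * t * s) • (P * G) := by
          rw [h1, h3, one_mul, smul_mul_assoc, smul_smul, sub_smul, sub_smul]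
          abel
      _ = 1 := by rw [mul_comm (t / E), key, zero_smul, add_zero]
  have a2 : (G - (t / E) • (G * P * G)) * (Λ + t • P) = 1 := by
    calc (G - (t / E) • (G * P * G)) * (Λ + t • P)
        = G * Λ - (t / E) • (G * P * (G * Λ)) + t • (G * P) - (t * (t / E)) • (G * (P * G * P)) := by
          simp only [mul_add, sub_mul, smul_mul_assoc, mul_smul_comm, smul_sub, smul_smul,
            mul_assoc]
          abel
      _ = 1 + (t - t / E - t * (t / E) * s) • (G * P) := by
          rw [h2, h3, mul_one, mul_smul_comm, smul_smul, sub_smul, sub_smul]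
          abel
      _ = 1 := by rw [key, zero_smul, add_zero]
  exact ⟨⟨⟨_, _, a1, a2⟩, rfl⟩, Ring.inverse_unit ⟨_, _, a1, a2⟩⟩

lemma differentiableAt_diagEntry (hS : IsSubordinate μ ψ b w M)
    (hb : IsolatedBox μ w M γ κ n l θ) {z : ℂ} (hz : z ∈ closedBox μ γ κ n) :
    DifferentiableAt ℂ (diagEntry hS n (l n)) z := by
  have h := hb.differentiableOn_inverse_shifted hS hz
  have h2 : DifferentiableAt ℂ
      (fun z => Ring.inverse (hS.pencil (shifted μ n (l n) z)) (ψ n)) z :=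
    h.clm_apply (differentiableAt_const _)
  exact (innerSL ℂ (ψ n)).differentiableAt.comp z h2

lemma differentiableAt_charFun (hS : IsSubordinate μ ψ b w M)
    (hb : IsolatedBox μ w M γ κ n l θ) {z : ℂ} (hz : z ∈ closedBox μ γ κ n) :
    DifferentiableAt ℂ (charFun hS n (l n)) z := by
  have h := hb.differentiableAt_diagEntry hS hz
  unfold charFun shiftCoeff
  fun_prop

/-- The relative deviation of the diagonal entry from its unperturbed value is small. -/
lemma norm_diagEntry_sub_one_le (hS : IsSubordinate μ ψ b w M)
    (hb : IsolatedBox μ w M γ κ n l θ) {z : ℂ} (hz : z ∈ closedBox μ γ κ n) :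
    ‖diagEntry hS n (l n) z * l n / μ n - 1‖ ≤ 2 * θ := by
  have hcomp := hb.comparable_shifted hS hz
  have hle := hb.norm_sandwich_shifted_le hS hz
  have hθ := hb.theta_le
  have hlt : ‖hS.sandwich (shifted μ n (l n) z)‖ < 1 := hle.trans_lt (by linarith)
  have hu := hS.bdd_rootMul hcomp
  set u := rootMul μ (shifted μ n (l n) z) with hudef
  set B := hS.sandwich (shifted μ n (l n) z)
  set G := Ring.inverse (1 - B)
  have h1 : diagEntry hS n (l n) z = u n * u n * inner ℂ (ψ n) (G (ψ n)) := by
    rw [diagEntry, hS.inverse_pencil hcomp hlt]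
    change inner ℂ (ψ n) (diagOp ψ u (G (diagOp ψ u (ψ n)))) = _
    rw [inner_diagOp hu, diagOp_basis hu, map_smul, inner_smul_right, mul_assoc]
  have h2 : u n * u n = μ n / l n := by
    rw [hudef, hS.rootMul_mul_self hcomp, shifted, if_pos rfl]
  have hμ : (μ n : ℂ) ≠ 0 := by exact_mod_cast (hS.pos n).ne'
  have hl : (l n : ℂ) ≠ 0 := by exact_mod_cast hb.pos.ne'
  have h3 : diagEntry hS n (l n) z * l n / μ n - 1 = inner ℂ (ψ n) ((B * G) (ψ n)) := by
    have hBG : B * G = G - 1 := by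
      have : (1 - B) * G = 1 := Ring.mul_inverse_cancel _ (hS.isUnit_one_sub_sandwich hlt)
      rw [sub_mul, one_mul] at this
      rw [← this]; abel
    rw [hBG, sub_apply, inner_sub_right, h1, h2]
    have : inner ℂ (ψ n) ((1 : H →L[ℂ] H) (ψ n)) = (1 : ℂ) := by
      change inner ℂ (ψ n) (ψ n) = (1 : ℂ)
      rw [inner_basis, if_pos rfl]
    rw [this]
    field_simp
  have hn : ‖ψ n‖ = 1 := ψ.orthonormal.1 n
  rw [h3]
  calc ‖inner ℂ (ψ n) ((B * G) (ψ n))‖ ≤ ‖ψ n‖ * ‖(B * G) (ψ n)‖ := norm_inner_le_norm _ _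
    _ ≤ 1 * (‖B * G‖ * ‖ψ n‖) := by rw [hn]; gcongr; rw [← hn]; exact (B * G).le_opNorm _
    _ ≤ θ * 2 := by
      rw [hn, one_mul, mul_one]
      refine (norm_mul_le _ _).trans (mul_le_mul hle (norm_inverse_one_sub_le (by linarith))
        (norm_nonneg _) ((norm_nonneg _).trans hle))
    _ = 2 * θ := by ring

/-- The characteristic function has exactly one zero in the closed box. It is simple and lies in
the open box. -/
lemma exists_zero_charFun (hS : IsSubordinate μ ψ b w M) (hb : IsolatedBox μ w M γ κ n l θ) :
    ∃ z₀ ∈ box μ γ κ n, charFun hS n (l n) z₀ = 0 ∧ deriv (charFun hS n (l n)) z₀ ≠ 0 ∧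
      ∀ z ∈ closedBox μ γ κ n, charFun hS n (l n) z = 0 → z = z₀ := by
  have hθ := hb.theta_le
  have hθ0 := hb.theta_nonneg hS.const_pos.le
  have hl := hb.pos
  have hl' : (l n : ℂ) ≠ 0 := by exact_mod_cast hb.pos.ne'
  have hμ : (μ n : ℂ) ≠ 0 := by exact_mod_cast (hS.pos n).ne'
  set η : ℂ → ℂ := fun z => diagEntry hS n (l n) z * l n / μ n - 1 with hη
  set p : ℂ → ℂ := fun z => η z * (z - μ n - l n) with hp
  have hE : ∀ z, charFun hS n (l n) z = (l n : ℂ)⁻¹ * (z - μ n + p z) := by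
    intro z
    rw [charFun, shiftCoeff, hp, hη]
    field_simp
    ring
  have hpn : ∀ z ∈ closedBox μ γ κ n, ‖p z‖ ≤ 2 * θ * (‖z - μ n‖ + l n) := by
    intro z hz
    rw [hp, norm_mul]
    refine mul_le_mul (hb.norm_diagEntry_sub_one_le hS hz) ?_ (norm_nonneg _) (by positivity)
    refine (norm_sub_le _ _).trans ?_
    rw [Complex.norm_real, Real.norm_of_nonneg hl.le]
  have hpd : ∀ z ∈ closedBox μ γ κ n, DifferentiableAt ℂ p z := by
    intro z hz
    have h := hb.differentiableAt_diagEntry hS hz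
    rw [hp, hη]
    fun_prop
  obtain ⟨z₀, hz₀, h0, hder, huniq⟩ := exists_simple_zero (p := p) hl
    (fun z hz => hpd z (hb.ball hz)) fun z hz => by
      refine (hpn z (hb.ball hz)).trans ?_
      rw [Metric.mem_closedBall, dist_eq_norm] at hz
      nlinarith
  have hz₀c : z₀ ∈ closedBox μ γ κ n :=
    hb.ball (Metric.closedBall_subset_closedBall (by linarith) hz₀)
  refine ⟨z₀, ?_, by rw [hE, h0, mul_zero], ?_, fun z hz hz0 => ?_⟩
  · by_contra hnot
    have h1 := hb.dist_self_le z₀ ⟨hz₀c, hnot⟩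
    rw [Metric.mem_closedBall, dist_eq_norm] at hz₀
    linarith
  · have h1 : HasDerivAt (charFun hS n (l n)) ((l n : ℂ)⁻¹ * (1 + deriv p z₀)) z₀ := by
      have h2 := (((hasDerivAt_id z₀).sub_const (μ n : ℂ)).add (hpd z₀ hz₀c).hasDerivAt).const_mul
        (l n : ℂ)⁻¹
      refine h2.congr_of_eventuallyEq (Eventually.of_forall fun z => ?_)
      simp [hE]
    rw [h1.deriv]
    exact mul_ne_zero (inv_ne_zero hl') hder
  · rw [hE, mul_eq_zero, or_iff_right (inv_ne_zero hl')] at hz0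
    refine huniq z ?_ hz0
    have h1 := hpn z hz
    have h2 : ‖z - μ n‖ = ‖p z‖ := by rw [← norm_neg (p z), ← eq_neg_of_add_eq_zero_left hz0]
    rw [Metric.mem_closedBall, dist_eq_norm]
    have := norm_nonneg (z - μ n)
    nlinarith

end IsolatedBox

/-! ### The Riesz projection of one box -/

lemma finrank_range_eq_one_of_rank_one {C : H →L[ℂ] H} {ℓ : H →L[ℂ] ℂ} {y : H} (hy : y ≠ 0)
    (hC : ∀ f, C f = ℓ f • y) (hCy : C y = y) :
    Module.finrank ℂ (LinearMap.range C.toLinearMap) = 1 := by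
  have h : LinearMap.range C.toLinearMap = Submodule.span ℂ {y} := by
    ext f
    rw [Submodule.mem_span_singleton, LinearMap.mem_range]
    constructor
    · rintro ⟨g, rfl⟩
      exact ⟨ℓ g, (hC g).symm⟩
    · rintro ⟨a, rfl⟩
      exact ⟨a • y, by change C (a • y) = a • y; rw [map_smul, hCy]⟩
  rw [h, finrank_span_singleton hy]

lemma hasSum_trace_of_rank_one (ψ : HilbertBasis ℕ+ ℂ H) {C : H →L[ℂ] H} {ℓ : H →L[ℂ] ℂ} {y : H}
    (hy : y ≠ 0) (hC : ∀ f, C f = ℓ f • y) (hCy : C y = y) :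
    HasSum (fun i => inner ℂ (ψ i) (C (ψ i))) 1 := by
  have h1 : ℓ y = 1 := by
    have := hC y
    rw [hCy] at this
    by_contra hne
    have h2 : (ℓ y - 1) • y = 0 := by rw [sub_smul, ← this, one_smul, sub_self]
    rcases smul_eq_zero.1 h2 with h3 | h3
    · exact hne (sub_eq_zero.1 h3)
    · exact hy h3
  have h := (ψ.hasSum_repr y).mapL ℓ
  rw [h1] at h
  convert h using 2 with i
  rw [hC, inner_smul_right, map_smul, smul_eq_mul, ψ.repr_apply_apply, mul_comm]

namespace IsolatedBox

variable {μ : ℕ+ → ℝ} {ψ : HilbertBasis ℕ+ ℂ H}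
    {b : formDomain μ ψ →ₗ[ℂ] formDomain μ ψ →ₗ⋆[ℂ] ℂ} {w : ℕ+ → ℝ} {M γ κ θ : ℝ} {n : ℕ+}
    {l : ℕ+ → ℝ}

/-- In the box the resolvent of `T` has a single simple pole. Its residue is of rank one, with
range spanned by the eigenvector `A^{-1/2} Λ₁(λ)⁻¹ ψ_n`. -/
theorem exists_eigenvalue (hS : IsSubordinate μ ψ b w M) (hb : IsolatedBox μ w M γ κ n l θ) :
    ∃ ev ∈ box μ γ κ n, spec (opT μ ψ b) ∩ box μ γ κ n = {ev} ∧
      bdryBox μ γ κ n ⊆ resSet (opT μ ψ b) ∧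
      ContinuousOn (resolv (opT μ ψ b)) (bdryBox μ γ κ n) ∧
      IsEigenvector (opT μ ψ b) ev (phi μ ψ b γ κ n) ∧
      Module.finrank ℂ (LinearMap.range (riesz μ ψ b γ κ n).toLinearMap) = 1 ∧
      HasSum (fun i => inner ℂ (ψ i) (riesz μ ψ b γ κ n (ψ i))) 1 ∧
      contour μ γ κ n (fun z => (z - μ n) • resolv (opT μ ψ b) z) =
        (ev - μ n) • riesz μ ψ b γ κ n := by
  have hκ := hb.kappa_pos
  obtain ⟨ev, hev, hE0, hder, huniq⟩ := hb.exists_zero_charFun hS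
  have hevc := box_subset_closedBox _ _ _ _ hev
  set D := invSqrtA μ ψ with hD
  set G : ℂ → H →L[ℂ] H := fun z => Ring.inverse (hS.pencil (shifted μ n (l n) z)) with hG
  set E := charFun hS n (l n) with hEdef
  set t := shiftCoeff μ n (l n) with ht
  set P := proj ψ n
  have hGd : DifferentiableOn ℂ G (closedBox μ γ κ n) := fun z hz =>
    (hb.differentiableOn_inverse_shifted hS hz).differentiableWithinAt
  have hEd : DifferentiableOn ℂ E (closedBox μ γ κ n) := fun z hz =>
    (hb.differentiableAt_charFun hS hz).differentiableWithinAt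
  have htd : Differentiable ℂ t := by
    rw [ht]; unfold shiftCoeff; fun_prop
  have hE1d : DifferentiableOn ℂ (dslope E ev) (closedBox μ γ κ n) :=
    (Complex.differentiableOn_dslope (closedBox_mem_nhds hev)).2 hEd
  have hE1 : ∀ z, E z = (z - ev) * dslope E ev z := by
    intro z
    have := sub_smul_dslope E ev z
    rw [hE0, sub_zero, smul_eq_mul] at this
    exact this.symm
  have hE1ne : ∀ z ∈ closedBox μ γ κ n, dslope E ev z ≠ 0 := by
    intro z hz h0
    by_cases h : z = ev
    · rw [h, dslope_same] at h0
      exact hder h0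
    · exact h (huniq z hz (by rw [hE1, h0, mul_zero]))
  -- Sherman–Morrison splits the resolvent as `X z + (z - ev)⁻¹ • Y z`
  set X : ℂ → H →L[ℂ] H := fun z => D * G z * D with hX
  set Y : ℂ → H →L[ℂ] H := fun z => (-(t z / dslope E ev z)) • (D * (G z * P * G z) * D) with hY
  have hXd : DifferentiableOn ℂ X (closedBox μ γ κ n) := by
    rw [hX]; fun_prop
  have hYd : DifferentiableOn ℂ Y (closedBox μ γ κ n) := by
    have h1 : DifferentiableOn ℂ (fun z => -(t z / dslope E ev z)) (closedBox μ γ κ n) :=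
      (htd.differentiableOn.div hE1d hE1ne).neg
    have h2 : DifferentiableOn ℂ (fun z => D * (G z * P * G z) * D) (closedBox μ γ κ n) := by
      fun_prop
    exact h1.smul h2
  have hres : ∀ z ∈ closedBox μ γ κ n, z ≠ ev →
      IsResolventAt (opT μ ψ b) z (X z + (z - ev)⁻¹ • Y z) := by
    intro z hz hne
    have hEz : E z ≠ 0 := fun h => hne (huniq z hz h)
    obtain ⟨hu, hinv⟩ := hb.pencil_mul_eq_one hS hz hEz
    have h := hS.isResolventAt_opT hu
    rw [hinv] at h
    convert h using 1
    have hc : (z - ev)⁻¹ * -(t z / dslope E ev z) = -(t z / E z) := by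
      rw [hE1 z]
      have h1 := sub_ne_zero.2 hne
      have h2 := hE1ne z hz
      field_simp
    change D * G z * D + (z - ev)⁻¹ • ((-(t z / dslope E ev z)) • (D * (G z * P * G z) * D)) =
      D * (G z - (t z / E z) • (G z * P * G z)) * D
    rw [smul_smul, hc, mul_sub, sub_mul, mul_smul_comm, smul_mul_assoc, neg_smul, sub_eq_add_neg]
  have hne_of_bdry : ∀ z ∈ bdryBox μ γ κ n, z ≠ ev := fun z hz =>
    sub_ne_zero.1 (sub_ne_zero_of_mem_bdryBox hev hz)
  have hresolv : ∀ z ∈ bdryBox μ γ κ n, resolv (opT μ ψ b) z = X z + (z - ev)⁻¹ • Y z :=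
    fun z hz => resolv_eq (hres z hz.1 (hne_of_bdry z hz))
  have hcont : ContinuousOn (resolv (opT μ ψ b)) (bdryBox μ γ κ n) := by
    have : ContinuousOn (fun z => X z + (z - ev)⁻¹ • Y z) (bdryBox μ γ κ n) :=
      (hXd.continuousOn.mono Set.sdiff_subset).add
        ((continuousOn_inv_sub hev).smul (hYd.continuousOn.mono Set.sdiff_subset))
    exact this.congr hresolv
  have hriesz : riesz μ ψ b γ κ n = Y ev := contour_simple_pole hκ hXd hYd hev hresolv
  -- the zero of `E` makes `Λ₁(ev)⁻¹ ψ_n` a null vector of the pencil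
  set x := G ev (ψ n) with hx
  have hΛx : hS.pencil (shifted μ n (l n) ev) x = ψ n :=
    congrArg (fun S : H →L[ℂ] H => S (ψ n)) (Ring.mul_inverse_cancel _ (hb.isUnit_shifted hS hevc))
  have hx0 : x ≠ 0 := by
    intro h0
    rw [h0, map_zero] at hΛx
    have := ψ.orthonormal.1 n
    rw [← hΛx, norm_zero] at this
    exact zero_ne_one this
  have hker : hS.pencil (fun k => ev - μ k) x = 0 := by
    rw [hb.pencil_sub_eq_shifted hS hevc]
    have h1 : inner ℂ (ψ n) x = diagEntry hS n (l n) ev := rfl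
    rw [add_apply, smul_apply, proj_apply, hΛx, h1, smul_smul]
    have h2 : (1 + t ev * diagEntry hS n (l n) ev) • ψ n = 0 := by
      have : 1 + t ev * diagEntry hS n (l n) ev = 0 := hE0
      rw [this, zero_smul]
    rwa [add_smul, one_smul] at h2
  set y := D x with hy
  have hyev : IsEigenvector (opT μ ψ b) ev y := hS.isEigenvector_opT hx0 hker
  -- `Y ev` maps into the line of `y`, and it fixes `y` because the resolvent acts on the
  -- eigenvector `y` as `(z - ev)⁻¹`
  let ℓ : H →L[ℂ] ℂ := (-(t ev / dslope E ev ev)) • ((innerSL ℂ (ψ n)) ∘L (G ev * D))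
  have hYℓ : ∀ f, Y ev f = ℓ f • y := by
    intro f
    change (-(t ev / dslope E ev ev)) • D (G ev (inner ℂ (ψ n) (G ev (D f)) • ψ n)) =
      ((-(t ev / dslope E ev ev)) • inner ℂ (ψ n) (G ev (D f))) • y
    rw [map_smul, map_smul, smul_smul, smul_eq_mul]
  have hYy : Y ev y = y := by
    rw [← hriesz, riesz]
    have h1 := contour_clm hκ hcont (ContinuousLinearMap.apply ℂ H y)
    simp only [ContinuousLinearMap.apply_apply] at h1
    rw [← h1]
    have h2 : ∀ z ∈ bdryBox μ γ κ n, resolv (opT μ ψ b) z y = (z - ev)⁻¹ • y := by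
      intro z hz
      have hne := sub_ne_zero.2 (hne_of_bdry z hz)
      have h3 := hyev.resolvent_apply (hres z hz.1 (hne_of_bdry z hz))
      rw [hresolv z hz, eq_inv_smul_iff₀ hne, h3]
    rw [contour_congr hκ h2]
    exact contour_inv_sub_smul hκ (differentiableOn_const y) hev
  have hℓψ : ℓ (ψ n) ≠ 0 := by
    change (-(t ev / dslope E ev ev)) • inner ℂ (ψ n) (G ev (D (ψ n))) ≠ 0
    have h1 : t ev * diagEntry hS n (l n) ev = -1 := by
      have : 1 + t ev * diagEntry hS n (l n) ev = 0 := hE0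
      linear_combination this
    have ht0 : t ev ≠ 0 := fun h => by rw [h, zero_mul] at h1; norm_num at h1
    have hs0 : diagEntry hS n (l n) ev ≠ 0 := fun h => by rw [h, mul_zero] at h1; norm_num at h1
    have hd0 : invSqrt μ n ≠ 0 := fun h => by
      have := sqrt_mul_invSqrt (hS.pos n)
      rw [h, mul_zero] at this
      exact zero_ne_one this
    rw [hD, diagOp_basis hS.bdd_invSqrt, map_smul, inner_smul_right, smul_eq_mul]
    exact mul_ne_zero (neg_ne_zero.2 (div_ne_zero ht0 (hE1ne ev hevc))) (mul_ne_zero hd0 hs0)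
  refine ⟨ev, hev, ?_, fun z hz => ⟨_, hres z hz.1 (hne_of_bdry z hz)⟩, hcont, ?_, ?_, ?_, ?_⟩
  · ext z
    rw [Set.mem_inter_iff, Set.mem_singleton_iff]
    constructor
    · rintro ⟨hz1, hz2⟩
      by_contra hne
      exact hz1 ⟨_, hres z (box_subset_closedBox _ _ _ _ hz2) hne⟩
    · rintro rfl
      refine ⟨fun hR => ?_, hev⟩
      obtain ⟨R, hR⟩ := hR
      have := hyev.resolvent_apply hR
      rw [sub_self, zero_smul] at this
      exact hyev.1 this.symm
  · have h1 : phi μ ψ b γ κ n = ℓ (ψ n) • y := by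
      rw [← hYℓ, ← hriesz]
      exact contour_clm hκ hcont (ContinuousLinearMap.apply ℂ H (ψ n))
    obtain ⟨hyd, hyT⟩ := hyev.2
    rw [h1]
    refine ⟨smul_ne_zero hℓψ hyev.1, (opT μ ψ b).domain.smul_mem _ hyd, ?_⟩
    have h2 := (opT μ ψ b).map_smul (ℓ (ψ n)) ⟨y, hyd⟩
    rw [hyT, smul_comm] at h2
    exact h2
  · rw [hriesz]; exact finrank_range_eq_one_of_rank_one hyev.1 hYℓ hYy
  · rw [hriesz]; exact hasSum_trace_of_rank_one ψ hyev.1 hYℓ hYy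
  · rw [hriesz]
    refine contour_simple_pole (X := fun z => (z - μ n) • X z) (Y := fun z => (z - μ n) • Y z)
      hκ (by fun_prop) (by fun_prop) hev fun z hz => ?_
    rw [hresolv z hz, smul_add, smul_comm (z - (μ n : ℂ)) (z - ev)⁻¹ (Y z)]

end IsolatedBox

/-! ### Finite rank operators and contour integrals -/

/-- Operators whose range is finite-dimensional. -/
def IsFiniteRank (C : H →L[ℂ] H) : Prop := FiniteDimensional ℂ (LinearMap.range C.toLinearMap)

lemma isFiniteRank_zero : IsFiniteRank (0 : H →L[ℂ] H) := by
  unfold IsFiniteRank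
  have : LinearMap.range (0 : H →L[ℂ] H).toLinearMap = ⊥ := LinearMap.range_zero
  rw [this]
  infer_instance

lemma IsFiniteRank.add {C C' : H →L[ℂ] H} (h : IsFiniteRank C) (h' : IsFiniteRank C') :
    IsFiniteRank (C + C') := by
  unfold IsFiniteRank at *
  refine Submodule.finiteDimensional_of_le (S₂ := LinearMap.range C.toLinearMap ⊔
    LinearMap.range C'.toLinearMap) ?_
  rintro _ ⟨f, rfl⟩
  exact Submodule.add_mem_sup ⟨f, rfl⟩ ⟨f, rfl⟩

lemma IsFiniteRank.mul_right {C : H →L[ℂ] H} (h : IsFiniteRank C) (S : H →L[ℂ] H) :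
    IsFiniteRank (C * S) := by
  unfold IsFiniteRank at *
  refine Submodule.finiteDimensional_of_le (S₂ := LinearMap.range C.toLinearMap) ?_
  rintro _ ⟨f, rfl⟩
  exact ⟨S f, rfl⟩

lemma isFiniteRank_mul_proj (ψ : HilbertBasis ℕ+ ℂ H) (n : ℕ+) (S : H →L[ℂ] H) :
    IsFiniteRank (S * proj ψ n) := by
  unfold IsFiniteRank
  refine Submodule.finiteDimensional_of_le (S₂ := Submodule.span ℂ {S (ψ n)}) ?_
  rintro _ ⟨f, rfl⟩
  change S (inner ℂ (ψ n) f • ψ n) ∈ _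
  rw [map_smul]
  exact Submodule.smul_mem _ _ (Submodule.mem_span_singleton_self _)

lemma IsFiniteRank.isTraceClass {C : H →L[ℂ] H} (h : IsFiniteRank C) : IsTraceClass C := by
  unfold IsFiniteRank at h
  set R := LinearMap.range C.toLinearMap
  let e := stdOrthonormalBasis ℂ R
  set d := Module.finrank ℂ R
  refine ⟨fun k => if hk : k < d then ContinuousLinearMap.adjoint C (e ⟨k, hk⟩ : R) else 0,
    fun k => if hk : k < d then ((e ⟨k, hk⟩ : R) : H) else 0, ?_, fun f => ?_⟩
  · refine summable_of_ne_finset_zero (s := Finset.range d) fun k hk => ?_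
    rw [Finset.mem_range] at hk
    simp [hk]
  · have h1 : C f = ∑ k : Fin d, inner ℂ (ContinuousLinearMap.adjoint C (e k : R)) f •
        ((e k : R) : H) := by
      have h2 := e.sum_repr' ⟨C f, ⟨f, rfl⟩⟩
      have h3 := congrArg (Subtype.val) h2
      refine h3.symm.trans ?_
      simp only [Submodule.coe_sum, Submodule.coe_smul, Submodule.coe_inner,
        ContinuousLinearMap.adjoint_inner_left]
    have h4 : (∑ k : Fin d, inner ℂ (ContinuousLinearMap.adjoint C (e k : R)) f •
        ((e k : R) : H)) = ∑ k ∈ Finset.range d,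
          (inner ℂ (if hk : k < d then ContinuousLinearMap.adjoint C (e ⟨k, hk⟩ : R) else 0) f •
            if hk : k < d then ((e ⟨k, hk⟩ : R) : H) else 0) := by
      rw [Finset.sum_range]
      simp
    rw [h1, h4]
    refine hasSum_sum_of_ne_finset_zero fun k hk => ?_
    rw [Finset.mem_range] at hk
    simp [hk]

section Polar

variable {μ : ℕ+ → ℝ} {γ κ : ℝ} {n : ℕ+} {ψ : HilbertBasis ℕ+ ℂ H}

/-- Operator functions on `Γ_n` for which the contour integrals of `(z - μ_n)^{-p} L(z) F(z)` have
finite rank, for all `p` and all `L` holomorphic on the closed box. The multipliers make the class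
stable under the recursion for `K B^k K`. -/
def HasFiniteRankResidues (μ : ℕ+ → ℝ) (γ κ : ℝ) (n : ℕ+) (F : ℂ → H →L[ℂ] H) : Prop :=
  ContinuousOn F (bdryBox μ γ κ n) ∧
    ∀ L : ℂ → H →L[ℂ] H, DifferentiableOn ℂ L (closedBox μ γ κ n) → ∀ p : ℕ,
      IsFiniteRank (contour μ γ κ n (fun z : ℂ => ((z - (μ n : ℂ))⁻¹) ^ p • (L z * F z)))

lemma continuousOn_inv_pow_smul (hc : (μ n : ℂ) ∈ box μ γ κ n) {F : ℂ → H →L[ℂ] H}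
    (hF : ContinuousOn F (bdryBox μ γ κ n)) (p : ℕ) :
    ContinuousOn (fun z : ℂ => ((z - (μ n : ℂ))⁻¹) ^ p • F z) (bdryBox μ γ κ n) :=
  ((continuousOn_inv_sub hc).pow p).smul hF

lemma HasFiniteRankResidues.add (hκ : 0 < κ) (hc : (μ n : ℂ) ∈ box μ γ κ n)
    {F F' : ℂ → H →L[ℂ] H} (h : HasFiniteRankResidues μ γ κ n F)
    (h' : HasFiniteRankResidues μ γ κ n F') :
    HasFiniteRankResidues μ γ κ n (fun z => F z + F' z) := by
  refine ⟨h.1.add h'.1, fun L hL p => ?_⟩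
  have hLc : ContinuousOn L (bdryBox μ γ κ n) := hL.continuousOn.mono Set.sdiff_subset
  have e : (fun z : ℂ => ((z - (μ n : ℂ))⁻¹) ^ p • (L z * (F z + F' z))) =
      fun z : ℂ => ((z - (μ n : ℂ))⁻¹) ^ p • (L z * F z) + ((z - (μ n : ℂ))⁻¹) ^ p • (L z * F' z) := by
    funext z
    rw [mul_add, smul_add]
  have c1 : ContinuousOn (fun z => L z * F z) (bdryBox μ γ κ n) := hLc.mul h.1
  have c2 : ContinuousOn (fun z => L z * F' z) (bdryBox μ γ κ n) := hLc.mul h'.1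
  rw [e, contour_add hκ (continuousOn_inv_pow_smul hc c1 p) (continuousOn_inv_pow_smul hc c2 p)]
  exact (h.2 L hL p).add (h'.2 L hL p)

lemma HasFiniteRankResidues.mul_left {F L : ℂ → H →L[ℂ] H} (h : HasFiniteRankResidues μ γ κ n F)
    (hL : DifferentiableOn ℂ L (closedBox μ γ κ n)) :
    HasFiniteRankResidues μ γ κ n (fun z => L z * F z) := by
  refine ⟨(hL.continuousOn.mono Set.sdiff_subset).mul h.1, fun L' hL' p => ?_⟩
  simp only [← mul_assoc]
  exact h.2 _ (hL'.mul hL) p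

lemma HasFiniteRankResidues.inv_smul (hc : (μ n : ℂ) ∈ box μ γ κ n) {F : ℂ → H →L[ℂ] H}
    (h : HasFiniteRankResidues μ γ κ n F) :
    HasFiniteRankResidues μ γ κ n (fun z : ℂ => (z - (μ n : ℂ))⁻¹ • F z) := by
  refine ⟨(continuousOn_inv_sub hc).smul h.1, fun L hL p => ?_⟩
  have e : (fun z : ℂ => ((z - (μ n : ℂ))⁻¹) ^ p • (L z * ((z - μ n)⁻¹ • F z))) =
      fun z : ℂ => ((z - (μ n : ℂ))⁻¹) ^ (p + 1) • (L z * F z) := by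
    funext z
    rw [mul_smul_comm, smul_smul, pow_succ]
  rw [e]
  exact h.2 L hL (p + 1)

/-- Expanding the left factor at `μ_n` lowers the order of the pole, up to an operator of finite
rank. -/
lemma hasFiniteRankResidues_proj_mul (hκ : 0 < κ) (hc : (μ n : ℂ) ∈ box μ γ κ n)
    {R : ℂ → H →L[ℂ] H} (hR : DifferentiableOn ℂ R (closedBox μ γ κ n)) :
    HasFiniteRankResidues μ γ κ n (fun z => proj ψ n * R z) := by
  have hRc : ContinuousOn (fun z => proj ψ n * R z) (bdryBox μ γ κ n) :=
    continuousOn_const.mul (hR.continuousOn.mono Set.sdiff_subset)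
  refine ⟨hRc, fun L hL p => ?_⟩
  induction p generalizing L with
  | zero =>
    simp only [pow_zero, one_smul]
    have hd : DifferentiableOn ℂ (fun z => L z * (proj ψ n * R z)) (closedBox μ γ κ n) :=
      hL.mul ((differentiableOn_const _).mul hR)
    rw [contour_eq_zero hκ hd]
    exact isFiniteRank_zero
  | succ p ih =>
    -- `L z = L (μ n) + (z - μ n) • L₁ z`; the constant term gives a factor `L (μ n) * proj ψ n`
    -- that can be taken out of the integral, the other one lowers `p`
    set L₁ := dslope L (μ n)
    have hL₁ : DifferentiableOn ℂ L₁ (closedBox μ γ κ n) :=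
      (Complex.differentiableOn_dslope (closedBox_mem_nhds hc)).2 hL
    have e : ∀ z ∈ bdryBox μ γ κ n, ((z - μ n)⁻¹) ^ (p + 1) • (L z * (proj ψ n * R z)) =
        (L (μ n) * proj ψ n) * (((z - μ n)⁻¹) ^ (p + 1) • R z) +
          ((z - μ n)⁻¹) ^ p • (L₁ z * (proj ψ n * R z)) := by
      intro z hz
      have hne := sub_ne_zero_of_mem_bdryBox hc hz
      have h1 : L z = L (μ n) + (z - μ n) • L₁ z := by
        rw [sub_smul_dslope]; abel
      have h2 : ((z - (μ n : ℂ))⁻¹) ^ (p + 1) * (z - μ n) = ((z - (μ n : ℂ))⁻¹) ^ p := by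
        rw [pow_succ, mul_assoc, inv_mul_cancel₀ hne, mul_one]
      rw [h1, add_mul, smul_add, smul_mul_assoc, smul_smul, h2, mul_smul_comm, mul_assoc]
    have hRb := continuousOn_inv_pow_smul hc (hR.continuousOn.mono Set.sdiff_subset) (p + 1)
    have c1 : ContinuousOn (fun z : ℂ => (L (μ n) * proj ψ n) * (((z - (μ n : ℂ))⁻¹) ^ (p + 1) • R z))
        (bdryBox μ γ κ n) := continuousOn_const.mul hRb
    have c2 : ContinuousOn (fun z => L₁ z * (proj ψ n * R z)) (bdryBox μ γ κ n) :=
      (hL₁.continuousOn.mono Set.sdiff_subset).mul hRc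
    rw [contour_congr hκ e, contour_add hκ c1 (continuousOn_inv_pow_smul hc c2 p)]
    refine IsFiniteRank.add ?_ (ih L₁ hL₁)
    have h3 := contour_clm hκ hRb (ContinuousLinearMap.mul ℂ (H →L[ℂ] H) (L (μ n) * proj ψ n))
    simp only [ContinuousLinearMap.mul_apply'] at h3
    rw [h3]
    exact (isFiniteRank_mul_proj ψ n (L (μ n))).mul_right _

end Polar

/-! ### The terms of the expansions -/

namespace IsSubordinate

variable {μ : ℕ+ → ℝ} {ψ : HilbertBasis ℕ+ ℂ H}
    {b : formDomain μ ψ →ₗ[ℂ] formDomain μ ψ →ₗ⋆[ℂ] ℂ} {w : ℕ+ → ℝ} {M : ℝ}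

lemma bdd_mul_inv (hS : IsSubordinate μ ψ b w M) {ζ : ℕ+ → ℂ} (hζ : IsComparable μ ζ) :
    IsBddSeq (fun k => μ k / ζ k) := by
  have := (hS.bdd_rootMul hζ).mul (hS.bdd_rootMul hζ)
  simpa only [hS.rootMul_mul_self hζ] using this

lemma inverse_diag (hS : IsSubordinate μ ψ b w M) {ζ : ℕ+ → ℂ} (hζ : IsComparable μ ζ) :
    IsUnit (diagOp ψ (fun k => ζ k / μ k)) ∧
      Ring.inverse (diagOp ψ (fun k => ζ k / μ k)) = diagOp ψ (fun k => μ k / ζ k) := by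
  have h1 := hS.bdd_div hζ
  have h2 := hS.bdd_mul_inv hζ
  have hμ : ∀ k, (μ k : ℂ) ≠ 0 := fun k => by exact_mod_cast (hS.pos k).ne'
  have hne := hS.ne_zero hζ
  have a1 : diagOp ψ (fun k => ζ k / μ k) * diagOp ψ (fun k => μ k / ζ k) = 1 := by
    rw [diagOp_mul h1 h2, ← diagOp_one ψ]
    congr 1; funext k
    have := hμ k; have := hne k
    field_simp
  have a2 : diagOp ψ (fun k => μ k / ζ k) * diagOp ψ (fun k => ζ k / μ k) = 1 := by
    rw [diagOp_mul h2 h1, ← diagOp_one ψ]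
    congr 1; funext k
    have := hμ k; have := hne k
    field_simp
  exact ⟨⟨⟨_, _, a1, a2⟩, rfl⟩, Ring.inverse_unit ⟨_, _, a1, a2⟩⟩

/-- In `K B^k K` the square roots pair up, so that no branch of the root is visible. -/
lemma opKBK_eq (hS : IsSubordinate μ ψ b w M) {z : ℂ} (hz : IsComparable μ (fun k => z - μ k))
    (k : ℕ) : opKBK μ ψ b k z = invSqrtA μ ψ * (diagOp ψ (fun k => μ k / (z - μ k)) *
      (hS.formOp * diagOp ψ (fun k => μ k / (z - μ k))) ^ k) * invSqrtA μ ψ := by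
  have hu := hS.bdd_rootMul hz
  set U := diagOp ψ (rootMul μ (fun k => z - μ k)) with hU
  set D := invSqrtA μ ψ with hD
  have hUD : D * U = U * D := by
    rw [hD, hU, diagOp_mul hS.bdd_invSqrt hu, diagOp_mul hu hS.bdd_invSqrt]
    simp only [mul_comm]
  have hUU : diagOp ψ (fun k => μ k / (z - μ k)) = U * U := by
    rw [hU, diagOp_mul hu hu]
    simp only [hS.rootMul_mul_self hz]
  have key : ∀ k : ℕ, U * (U * hS.formOp * U) ^ k * U = U * U * (hS.formOp * (U * U)) ^ k := by
    intro k
    induction k with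
    | zero => simp
    | succ k ih =>
      calc U * (U * hS.formOp * U) ^ (k + 1) * U
          = (U * (U * hS.formOp * U) ^ k * U) * (hS.formOp * (U * U)) := by
            rw [pow_succ]; noncomm_ring
        _ = _ := by rw [ih, pow_succ]; noncomm_ring
  rw [opKBK, hS.opB_eq hz, hS.opK_eq hz, hUU, ← key, sandwich, ← hU, ← hD]
  calc D * U * (U * hS.formOp * U) ^ k * (D * U)
      = D * U * (U * hS.formOp * U) ^ k * (U * D) := by rw [hUD]
    _ = _ := by simp only [mul_assoc]

/-- The factorization `(z - T)⁻¹ = K(z) (1 - B(z))⁻¹ K(z)`. -/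
lemma resolv_eq_mul (hS : IsSubordinate μ ψ b w M) {z : ℂ}
    (hz : IsComparable μ (fun k => z - μ k)) (h : ‖hS.sandwich (fun k => z - μ k)‖ < 1) :
    resolv (opT μ ψ b) z =
      opK μ ψ z * Ring.inverse (1 - hS.sandwich (fun k => z - μ k)) * opK μ ψ z := by
  have hu := hS.bdd_rootMul hz
  rw [resolv_eq (hS.isResolventAt_opT (hS.isUnit_pencil hz h)), hS.inverse_pencil hz h]
  set U := diagOp ψ (rootMul μ (fun k => z - μ k)) with hU
  set D := invSqrtA μ ψ with hD
  have hUD : D * U = U * D := by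
    rw [hD, hU, diagOp_mul hS.bdd_invSqrt hu, diagOp_mul hu hS.bdd_invSqrt]
    simp only [mul_comm]
  have e : opK μ ψ z = D * U := hS.opK_eq hz
  rw [e]
  calc _ = D * U * Ring.inverse (1 - hS.sandwich (fun k => z - μ k)) * (U * D) := by
        simp only [mul_assoc]
    _ = _ := by rw [hUD]

end IsSubordinate

/-! ### Size of the boxes -/

/-- Half the perimeter of the box, which also bounds the distance of its points to `μ_n`. -/
def boxLength (γ κ : ℝ) (n : ℕ+) : ℝ :=
  κ / 2 * ((n : ℝ) - 1) ^ (γ - 1) + 3 * (κ / 2 * (n : ℝ) ^ (γ - 1))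

lemma boxLength_nonneg {γ κ : ℝ} (hκ : 0 < κ) (n : ℕ+) : 0 ≤ boxLength γ κ n := by
  have h1 := mul_nonneg (half_pos hκ).le (pred_rpow_nonneg n (γ - 1))
  have h2 := mul_pos (half_pos hκ) (rpow_pnat_pos n (γ - 1))
  unfold boxLength
  linarith

lemma norm_sub_le_boxLength {μ : ℕ+ → ℝ} {γ κ : ℝ} (hκ : 0 < κ) {n : ℕ+} {z : ℂ}
    (hz : z ∈ closedBox μ γ κ n) : ‖z - μ n‖ ≤ boxLength γ κ n := by
  have h1 := mul_nonneg (half_pos hκ).le (pred_rpow_nonneg n (γ - 1))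
  have h2 := mul_pos (half_pos hκ) (rpow_pnat_pos n (γ - 1))
  obtain ⟨⟨a1, a2⟩, a3, a4⟩ := hz
  refine (Complex.norm_le_abs_re_add_abs_im _).trans ?_
  have e1 : (z - μ n).re = z.re - μ n := by simp
  have e2 : (z - μ n).im = z.im := by simp
  rw [e1, e2]
  have b1 : |z.re - μ n| ≤ κ / 2 * ((n : ℝ) - 1) ^ (γ - 1) + κ / 2 * (n : ℝ) ^ (γ - 1) :=
    abs_le.2 ⟨by linarith, by linarith⟩
  have b2 : |z.im| ≤ κ / 2 * (n : ℝ) ^ (γ - 1) := abs_le.2 ⟨by linarith, by linarith⟩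
  unfold boxLength
  linarith

namespace IsolatedBox

variable {μ : ℕ+ → ℝ} {ψ : HilbertBasis ℕ+ ℂ H}
    {b : formDomain μ ψ →ₗ[ℂ] formDomain μ ψ →ₗ⋆[ℂ] ℂ} {w : ℕ+ → ℝ} {M γ κ θ : ℝ} {n : ℕ+}
    {l : ℕ+ → ℝ}

/-! ### The polar part of the terms -/

lemma center_mem (hb : IsolatedBox μ w M γ κ n l θ) : (μ n : ℂ) ∈ box μ γ κ n :=
  mem_box_self hb.kappa_pos hb.one_lt

lemma differentiableOn_regDiag (hS : IsSubordinate μ ψ b w M)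
    (hb : IsolatedBox μ w M γ κ n l θ) :
    DifferentiableOn ℂ (fun z => diagOp ψ (fun k => μ k / shifted μ n (l n) z k))
      (closedBox μ γ κ n) := by
  intro z hz
  have h := hS.inverse_diag (hb.comparable_shifted hS hz)
  have h1 : DifferentiableAt ℂ
      (fun z => Ring.inverse (diagOp ψ (fun k => shifted μ n (l n) z k / μ k))) z :=
    DifferentiableAt.comp (g := Ring.inverse) z (differentiableAt_inverse (𝕜 := ℂ) h.1)
      (differentiable_diag_shifted hS n (l n) z)
  exact h1.differentiableWithinAt.congr
    (fun x hx => (hS.inverse_diag (hb.comparable_shifted hS hx)).2.symm) h.2.symm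

/-- The diagonal operator with entries `μ_k / (z - μ_k)` has a simple pole at `μ_n`, with a rank one
residue. -/
lemma diag_eq_add_pole (hS : IsSubordinate μ ψ b w M) (hb : IsolatedBox μ w M γ κ n l θ)
    {z : ℂ} (hz : z ∈ bdryBox μ γ κ n) :
    diagOp ψ (fun k => μ k / (z - μ k)) = diagOp ψ (fun k => μ k / shifted μ n (l n) z k) +
      (z - (μ n : ℂ))⁻¹ • ((μ n - (z - μ n) * (μ n / l n)) • proj ψ n) := by
  have hne := sub_ne_zero_of_mem_bdryBox hb.center_mem hz
  have hl : (l n : ℂ) ≠ 0 := by exact_mod_cast hb.pos.ne'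
  have h := diagOp_add_smul_proj (hS.bdd_mul_inv (hb.comparable_shifted hS hz.1)) n
    (μ n / (z - μ n)) (ψ := ψ)
  have e : (fun k => if k = n then μ n / (z - μ n) else μ k / shifted μ n (l n) z k) =
      fun k => μ k / (z - (μ k : ℂ)) := by
    funext k
    unfold shifted
    split_ifs with hk
    · rw [hk]
    · rfl
  rw [e] at h
  rw [h, smul_smul]
  congr 2
  rw [shifted, if_pos rfl]
  field_simp

/-- Up to a function holomorphic on the closed box, `Q (B₀ Q)^k` with `Q = diag(μ_k / (z - μ_k))`
has residues of finite rank: in the recursion `Q (B₀ Q)^{k+1} = Q B₀ · Q (B₀ Q)^k` the polar part of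
`Q` is a multiple of the projection onto `ψ_n`. -/
lemma exists_polar_part (hS : IsSubordinate μ ψ b w M) (hb : IsolatedBox μ w M γ κ n l θ)
    (k : ℕ) : ∃ X Y : ℂ → H →L[ℂ] H, DifferentiableOn ℂ X (closedBox μ γ κ n) ∧
      HasFiniteRankResidues μ γ κ n Y ∧ ∀ z ∈ bdryBox μ γ κ n,
        diagOp ψ (fun k => μ k / (z - μ k)) *
          (hS.formOp * diagOp ψ (fun k => μ k / (z - μ k))) ^ k = X z + Y z := by
  have hκ := hb.kappa_pos
  have hc := hb.center_mem
  set Q₁ : ℂ → H →L[ℂ] H := fun z => diagOp ψ (fun k => μ k / shifted μ n (l n) z k) with hQ₁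
  have hQd : DifferentiableOn ℂ Q₁ (closedBox μ γ κ n) := hb.differentiableOn_regDiag hS
  set τ : ℂ → ℂ := fun z => μ n - (z - μ n) * (μ n / l n) with hτ
  have hτd : DifferentiableOn ℂ τ (closedBox μ γ κ n) := by rw [hτ]; fun_prop
  have hQ : ∀ z ∈ bdryBox μ γ κ n, diagOp ψ (fun k => μ k / (z - μ k)) =
      Q₁ z + (z - (μ n : ℂ))⁻¹ • (τ z • proj ψ n) := fun z hz => hb.diag_eq_add_pole hS hz
  induction k with
  | zero =>
    have hR : DifferentiableOn ℂ (fun z => τ z • (1 : H →L[ℂ] H)) (closedBox μ γ κ n) :=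
      hτd.smul (differentiableOn_const _)
    refine ⟨Q₁, _, hQd, (hasFiniteRankResidues_proj_mul hκ hc (ψ := ψ) hR).inv_smul hc,
      fun z hz => ?_⟩
    rw [hQ z hz, pow_zero, mul_one, mul_smul_comm, mul_one]
  | succ k ih =>
    obtain ⟨X, Y, hX, hY, hXY⟩ := ih
    have hL : DifferentiableOn ℂ (fun z => Q₁ z * hS.formOp) (closedBox μ γ κ n) :=
      hQd.mul (differentiableOn_const _)
    have hL2 : DifferentiableOn ℂ (fun z => τ z • (proj ψ n * hS.formOp)) (closedBox μ γ κ n) :=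
      hτd.smul (differentiableOn_const _)
    have hX2 : DifferentiableOn ℂ (fun z => hS.formOp * X z) (closedBox μ γ κ n) :=
      (differentiableOn_const _).mul hX
    have hR : DifferentiableOn ℂ (fun z => τ z • (hS.formOp * X z)) (closedBox μ γ κ n) :=
      hτd.smul hX2
    refine ⟨fun z => Q₁ z * hS.formOp * X z, _, hL.mul hX,
      (((hasFiniteRankResidues_proj_mul hκ hc (ψ := ψ) hR).inv_smul hc).add hκ hc
        (hY.mul_left hL)).add hκ hc ((hY.mul_left hL2).inv_smul hc), fun z hz => ?_⟩
    have e : diagOp ψ (fun k => μ k / (z - μ k)) *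
          (hS.formOp * diagOp ψ (fun k => μ k / (z - μ k))) ^ (k + 1) =
        diagOp ψ (fun k => μ k / (z - μ k)) * hS.formOp * (diagOp ψ (fun k => μ k / (z - μ k)) *
          (hS.formOp * diagOp ψ (fun k => μ k / (z - μ k))) ^ k) := by
      rw [pow_succ']
      simp only [mul_assoc]
    rw [e, hXY z hz, hQ z hz]
    simp only [add_mul, mul_add, smul_mul_assoc, mul_smul_comm, mul_assoc]
    abel

lemma exists_polar_part_opKBK (hS : IsSubordinate μ ψ b w M) (hb : IsolatedBox μ w M γ κ n l θ)
    (k : ℕ) : ∃ X Y : ℂ → H →L[ℂ] H, DifferentiableOn ℂ X (closedBox μ γ κ n) ∧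
      HasFiniteRankResidues μ γ κ n Y ∧ ∀ z ∈ bdryBox μ γ κ n,
        opKBK μ ψ b k z = X z + Y z * invSqrtA μ ψ := by
  obtain ⟨X, Y, hX, hY, hXY⟩ := hb.exists_polar_part hS k
  refine ⟨fun z => invSqrtA μ ψ * X z * invSqrtA μ ψ, _,
    ((differentiableOn_const _).mul hX).mul (differentiableOn_const _),
    hY.mul_left (differentiableOn_const (invSqrtA μ ψ)), fun z hz => ?_⟩
  rw [hS.opKBK_eq (hb.comparable_sub hS hz), hXY z hz, mul_add, add_mul]

lemma continuousOn_opKBK (hS : IsSubordinate μ ψ b w M) (hb : IsolatedBox μ w M γ κ n l θ)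
    (k : ℕ) : ContinuousOn (opKBK μ ψ b k) (bdryBox μ γ κ n) := by
  obtain ⟨X, Y, hX, hY, hXY⟩ := hb.exists_polar_part_opKBK hS k
  refine ContinuousOn.congr (f := fun z => X z + Y z * invSqrtA μ ψ) ?_ hXY
  exact (hX.continuousOn.mono Set.sdiff_subset).add (hY.1.mul continuousOn_const)

lemma continuousOn_sub_smul {F : ℂ → H →L[ℂ] H} {s : Set ℂ} (c : ℂ) (hF : ContinuousOn F s) :
    ContinuousOn (fun z => (z - c) • F z) s :=
  ContinuousOn.smul (f := fun z : ℂ => z - c) (by fun_prop) hF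

lemma isTraceClass_evOp (hS : IsSubordinate μ ψ b w M) (hb : IsolatedBox μ w M γ κ n l θ)
    (k : ℕ) : IsTraceClass (evOp μ ψ b γ κ k n) := by
  have hκ := hb.kappa_pos
  obtain ⟨X, Y, hX, hY, hXY⟩ := hb.exists_polar_part_opKBK hS k
  have hzd : DifferentiableOn ℂ (fun z : ℂ => z - μ n) (closedBox μ γ κ n) := by fun_prop
  have h1 : DifferentiableOn ℂ (fun z : ℂ => (z - (μ n : ℂ)) • X z) (closedBox μ γ κ n) := hzd.smul hX
  have hL : DifferentiableOn ℂ (fun z : ℂ => (z - μ n) • (1 : H →L[ℂ] H)) (closedBox μ γ κ n) :=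
    hzd.smul (differentiableOn_const _)
  have hY' := hY.mul_left hL
  have e : ∀ z ∈ bdryBox μ γ κ n, (z - (μ n : ℂ)) • opKBK μ ψ b k z =
      (z - μ n) • X z + ((z - (μ n : ℂ)) • (1 : H →L[ℂ] H) * Y z) * invSqrtA μ ψ := by
    intro z hz
    rw [hXY z hz, smul_add, smul_one_mul, smul_mul_assoc]
  have h3 := contour_clm hκ hY'.1
    ((ContinuousLinearMap.mul ℂ (H →L[ℂ] H)).flip (invSqrtA μ ψ))
  simp only [ContinuousLinearMap.flip_apply, ContinuousLinearMap.mul_apply'] at h3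
  have h4 : ContinuousOn (fun z => ((z - (μ n : ℂ)) • (1 : H →L[ℂ] H) * Y z) * invSqrtA μ ψ)
      (bdryBox μ γ κ n) := hY'.1.mul continuousOn_const
  have h5 := hY.2 _ hL 0
  simp only [pow_zero, one_smul] at h5
  refine IsFiniteRank.isTraceClass ?_
  rw [evOp, contour_congr hκ e, contour_add hκ (h1.continuousOn.mono Set.sdiff_subset) h4,
    contour_eq_zero hκ h1, zero_add, h3]
  exact h5.mul_right _

/-- The unperturbed resolvent contributes nothing to the expansion of the eigenvalue. -/
lemma evOp_zero (hS : IsSubordinate μ ψ b w M) (hb : IsolatedBox μ w M γ κ n l θ) :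
    evOp μ ψ b γ κ 0 n = 0 := by
  have hκ := hb.kappa_pos
  have hzd : DifferentiableOn ℂ (fun z : ℂ => z - μ n) (closedBox μ γ κ n) := by fun_prop
  have hτd : DifferentiableOn ℂ (fun z : ℂ => μ n - (z - μ n) * (μ n / l n : ℂ))
    (closedBox μ γ κ n) := by fun_prop
  have h0 : DifferentiableOn ℂ (fun z : ℂ => (z - μ n) •
      diagOp ψ (fun k => μ k / shifted μ n (l n) z k) +
        (μ n - (z - μ n) * (μ n / l n : ℂ)) • proj ψ n) (closedBox μ γ κ n) :=
    (hzd.smul (hb.differentiableOn_regDiag hS)).add (hτd.smul (differentiableOn_const _))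
  have h : DifferentiableOn ℂ (fun z : ℂ => invSqrtA μ ψ * ((z - μ n) •
      diagOp ψ (fun k => μ k / shifted μ n (l n) z k) +
        (μ n - (z - μ n) * (μ n / l n : ℂ)) • proj ψ n) * invSqrtA μ ψ) (closedBox μ γ κ n) :=
    ((differentiableOn_const _).mul h0).mul (differentiableOn_const _)
  rw [evOp, ← contour_eq_zero hκ h]
  refine contour_congr hκ fun z hz => ?_
  have hne := sub_ne_zero_of_mem_bdryBox hb.center_mem hz
  rw [hS.opKBK_eq (hb.comparable_sub hS hz), pow_zero, mul_one, hb.diag_eq_add_pole hS hz,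
    ← smul_mul_assoc, ← mul_smul_comm, smul_add, smul_smul (z - (μ n : ℂ)), mul_inv_cancel₀ hne,
    one_smul]

/-! ### Norm estimates on the boundary of the box -/

lemma norm_cpow_le (hb : IsolatedBox μ w M γ κ n l θ) {z : ℂ} (hz : z ∈ bdryBox μ γ κ n)
    (k : ℕ+) : ‖(z - (μ k : ℂ)) ^ (-(1 / 2) : ℂ)‖ ≤ (√(l n))⁻¹ := by
  have h := (hb.le k).trans (hb.le_norm_sub hz k)
  rw [norm_cpow_neg_half (norm_pos_iff.1 (hb.pos.trans_le h))]
  exact inv_anti₀ (Real.sqrt_pos.2 hb.pos) (Real.sqrt_le_sqrt h)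

lemma bdd_cpow (hb : IsolatedBox μ w M γ κ n l θ) {z : ℂ} (hz : z ∈ bdryBox μ γ κ n) :
    IsBddSeq (fun k => (z - (μ k : ℂ)) ^ (-(1 / 2) : ℂ)) :=
  ⟨(√(l n))⁻¹, by positivity, hb.norm_cpow_le hz⟩

lemma norm_opK_mul_mul_le (hb : IsolatedBox μ w M γ κ n l θ) {z : ℂ}
    (hz : z ∈ bdryBox μ γ κ n) (X : H →L[ℂ] H) :
    ‖opK μ ψ z * X * opK μ ψ z‖ ≤ ‖X‖ / l n := by
  have h : ‖opK μ ψ z‖ ≤ (√(l n))⁻¹ := norm_diagOp_le (by positivity) (hb.norm_cpow_le hz)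
  calc ‖opK μ ψ z * X * opK μ ψ z‖ ≤ ‖opK μ ψ z‖ * ‖X‖ * ‖opK μ ψ z‖ :=
        (norm_mul_le _ _).trans (mul_le_mul_of_nonneg_right (norm_mul_le _ _) (norm_nonneg _))
    _ ≤ (√(l n))⁻¹ * ‖X‖ * (√(l n))⁻¹ := by gcongr
    _ = ‖X‖ * ((√(l n)) * √(l n))⁻¹ := by rw [mul_inv]; ring
    _ = ‖X‖ / l n := by rw [Real.mul_self_sqrt hb.pos.le, div_eq_mul_inv]

/-- `K` is diagonal, so it only rescales the diagonal entries. -/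
lemma norm_inner_opK_mul_mul_le (hb : IsolatedBox μ w M γ κ n l θ) {z : ℂ}
    (hz : z ∈ bdryBox μ γ κ n) (X : H →L[ℂ] H) (i : ℕ+) :
    ‖inner ℂ (ψ i) ((opK μ ψ z * X * opK μ ψ z) (ψ i))‖ ≤ ‖inner ℂ (ψ i) (X (ψ i))‖ / l n := by
  have hk := hb.bdd_cpow hz
  have hle := hb.norm_cpow_le hz i
  change ‖inner ℂ (ψ i) (opK μ ψ z (X (opK μ ψ z (ψ i))))‖ ≤ _
  rw [opK, inner_diagOp hk, diagOp_basis hk, map_smul, inner_smul_right, norm_mul, norm_mul]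
  calc _ ≤ (√(l n))⁻¹ * ((√(l n))⁻¹ * ‖inner ℂ (ψ i) (X (ψ i))‖) := by gcongr
    _ = ‖inner ℂ (ψ i) (X (ψ i))‖ * ((√(l n)) * √(l n))⁻¹ := by rw [mul_inv]; ring
    _ = _ := by rw [Real.mul_self_sqrt hb.pos.le, div_eq_mul_inv]

lemma norm_sandwich_pow_le (hS : IsSubordinate μ ψ b w M) (hb : IsolatedBox μ w M γ κ n l θ)
    {z : ℂ} (hz : z ∈ bdryBox μ γ κ n) (k : ℕ) :
    ‖hS.sandwich (fun k => z - μ k) ^ k‖ ≤ θ ^ k := by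
  have hθ := hb.theta_nonneg hS.const_pos.le
  induction k with
  | zero => rw [pow_zero, pow_zero]; exact ContinuousLinearMap.norm_id_le
  | succ k ih =>
    rw [pow_succ, pow_succ]
    exact (norm_mul_le _ _).trans (mul_le_mul ih (hb.norm_sandwich_sub_le hS hz)
      (norm_nonneg _) (by positivity))

/-- The diagonal entries of `B X B`, for the sandwiched operator `B` on the boundary. -/
lemma norm_inner_mul_mul_le (hS : IsSubordinate μ ψ b w M) (hb : IsolatedBox μ w M γ κ n l θ)
    {z : ℂ} (hz : z ∈ bdryBox μ γ κ n) (X : H →L[ℂ] H) (i : ℕ+) :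
    ‖inner ℂ (ψ i) ((hS.sandwich (fun k => z - μ k) * X * hS.sandwich (fun k => z - μ k)) (ψ i))‖ ≤
      M * θ * ‖X‖ * (w i ^ 2 / l i) := by
  have hM := hS.const_pos
  have hθ := hb.theta_nonneg hS.const_pos.le
  refine (hS.norm_inner_sandwich_mul_mul_le (hb.comparable_sub hS hz) X i).trans ?_
  have h1 := hb.tsum_le hS.const_pos.le (ζ := fun k => z - μ k) (hb.le_norm_sub hz)
  have h2 : w i ^ 2 / ‖z - μ i‖ ≤ w i ^ 2 / l i :=
    div_le_div_of_nonneg_left (sq_nonneg _) (hb.pos.trans_le (hb.le i)) (hb.le_norm_sub hz i)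
  calc M ^ 2 * ‖X‖ * (∑' k, w k ^ 2 / ‖z - μ k‖) * (w i ^ 2 / ‖z - μ i‖)
      = M * (M * ∑' k, w k ^ 2 / ‖z - μ k‖) * ‖X‖ * (w i ^ 2 / ‖z - μ i‖) := by ring
    _ ≤ M * θ * ‖X‖ * (w i ^ 2 / l i) := by gcongr

lemma norm_inner_sandwich_pow_le (hS : IsSubordinate μ ψ b w M)
    (hb : IsolatedBox μ w M γ κ n l θ) {z : ℂ} (hz : z ∈ bdryBox μ γ κ n) (k : ℕ) (i : ℕ+) :
    ‖inner ℂ (ψ i) ((hS.sandwich (fun k => z - μ k) ^ (k + 1)) (ψ i))‖ ≤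
      M * θ ^ k * (w i ^ 2 / l i) := by
  have hM := hS.const_pos
  have hθ := hb.theta_nonneg hS.const_pos.le
  have hl : 0 < l i := hb.pos.trans_le (hb.le i)
  cases k with
  | zero =>
    rw [zero_add, pow_one, pow_zero, mul_one]
    refine (hS.norm_inner_sandwich_basis_le (hb.comparable_sub hS hz) i).trans ?_
    exact mul_le_mul_of_nonneg_left
      (div_le_div_of_nonneg_left (sq_nonneg _) hl (hb.le_norm_sub hz i)) hM.le
  | succ k =>
    have e : hS.sandwich (fun k => z - μ k) ^ (k + 1 + 1) = hS.sandwich (fun k => z - μ k) *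
        hS.sandwich (fun k => z - μ k) ^ k * hS.sandwich (fun k => z - μ k) := by
      rw [pow_succ, pow_succ']
    rw [e]
    refine (hb.norm_inner_mul_mul_le hS hz _ i).trans ?_
    have := hb.norm_sandwich_pow_le hS hz k
    calc M * θ * ‖hS.sandwich (fun k => z - μ k) ^ k‖ * (w i ^ 2 / l i)
        ≤ M * θ * θ ^ k * (w i ^ 2 / l i) := by gcongr
      _ = _ := by ring

/-! ### Contour integrals: norms and traces -/

lemma norm_contour_apply_le (hb : IsolatedBox μ w M γ κ n l θ) {F : ℂ → H →L[ℂ] H} {C : ℝ}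
    (hF : ∀ z ∈ bdryBox μ γ κ n, ‖F z‖ ≤ C) :
    ‖contour μ γ κ n (fun z => F z (ψ n))‖ ≤ boxLength γ κ n / l n * (C * l n) := by
  have h := norm_contour_le hb.kappa_pos (μ := μ) (γ := γ) (n := n) (F := fun z => F z (ψ n))
    (C := C) fun z hz => by
      refine ((F z).le_opNorm _).trans ?_
      rw [ψ.orthonormal.1 n, mul_one]
      exact hF z hz
  refine h.trans (le_of_eq ?_)
  have := hb.pos.ne'
  rw [boxLength]
  field_simp

/-- The trace of `(2πi)⁻¹ ∮ (z - μ_n) F(z) dz` may be computed from the entries of `F`. -/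
lemma hasSum_trace_contour (hb : IsolatedBox μ w M γ κ n l θ)
    {F : ℂ → H →L[ℂ] H} {C : ℝ} (hC : 0 ≤ C) (hFc : ContinuousOn F (bdryBox μ γ κ n))
    (hF : ∀ z ∈ bdryBox μ γ κ n, ∀ i,
      ‖inner ℂ (ψ i) (F z (ψ i))‖ ≤ M * C * (w i ^ 2 / l i) / l n) :
    HasSum (fun i => inner ℂ (ψ i) (contour μ γ κ n (fun z => (z - (μ n : ℂ)) • F z) (ψ i)))
      (trace ψ (contour μ γ κ n (fun z => (z - (μ n : ℂ)) • F z))) ∧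
    ‖trace ψ (contour μ γ κ n (fun z => (z - (μ n : ℂ)) • F z))‖ ≤
      boxLength γ κ n ^ 2 / l n * (C * θ) := by
  have hκ := hb.kappa_pos
  have hlen := boxLength_nonneg (γ := γ) hκ n
  have hln := hb.pos
  have hle : ∀ i, ‖inner ℂ (ψ i) (contour μ γ κ n (fun z => (z - (μ n : ℂ)) • F z) (ψ i))‖ ≤
      boxLength γ κ n ^ 2 / l n * C * (M * (w i ^ 2 / l i)) := by
    intro i
    have h1 := contour_clm hκ (continuousOn_sub_smul (μ n : ℂ) hFc)
      ((innerSL ℂ (ψ i)).comp (ContinuousLinearMap.apply ℂ H (ψ i)))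
    have h2 : inner ℂ (ψ i) (contour μ γ κ n (fun z => (z - (μ n : ℂ)) • F z) (ψ i)) =
        contour μ γ κ n (fun z => (z - (μ n : ℂ)) * inner ℂ (ψ i) (F z (ψ i))) := by
      refine Eq.trans h1.symm ?_
      congr 1
      funext z
      change inner ℂ (ψ i) ((z - (μ n : ℂ)) • F z (ψ i)) = _
      rw [inner_smul_right]
    rw [h2]
    have h3 := norm_contour_le hκ (μ := μ) (γ := γ) (n := n)
      (F := fun z => (z - (μ n : ℂ)) * inner ℂ (ψ i) (F z (ψ i)))
      (C := boxLength γ κ n * (M * C * (w i ^ 2 / l i) / l n)) fun z hz => by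
        rw [norm_mul]
        exact mul_le_mul (norm_sub_le_boxLength hκ hz.1) (hF z hz i) (norm_nonneg _) hlen
    refine h3.trans (le_of_eq ?_)
    rw [← boxLength]
    ring
  have hs := (hb.summable.mul_left M).mul_left (boxLength γ κ n ^ 2 / l n * C)
  have hsum := Summable.of_norm_bounded hs hle
  refine ⟨hsum.hasSum, (tsum_of_norm_bounded hs.hasSum hle).trans ?_⟩
  rw [tsum_mul_left, tsum_mul_left]
  calc _ ≤ boxLength γ κ n ^ 2 / l n * C * θ :=
        mul_le_mul_of_nonneg_left hb.small (by positivity)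
    _ = _ := by ring

/-! ### The expansions on one box -/

lemma opKBK_eq_sandwich (hS : IsSubordinate μ ψ b w M) (hb : IsolatedBox μ w M γ κ n l θ)
    {z : ℂ} (hz : z ∈ bdryBox μ γ κ n) (k : ℕ) :
    opKBK μ ψ b k z = opK μ ψ z * hS.sandwich (fun k => z - μ k) ^ k * opK μ ψ z := by
  rw [opKBK, hS.opB_eq (hb.comparable_sub hS hz)]

lemma norm_vecCorr_le (hS : IsSubordinate μ ψ b w M) (hb : IsolatedBox μ w M γ κ n l θ) (k : ℕ) :
    ‖vecCorr μ ψ b γ κ k n‖ ≤ boxLength γ κ n / l n * θ ^ k := by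
  have hl := hb.pos
  refine (hb.norm_contour_apply_le (C := θ ^ k / l n) fun z hz => ?_).trans (le_of_eq ?_)
  · rw [hb.opKBK_eq_sandwich hS hz]
    refine (hb.norm_opK_mul_mul_le hz _).trans ?_
    exact div_le_div_of_nonneg_right (hb.norm_sandwich_pow_le hS hz k) hl.le
  · rw [div_mul_cancel₀ _ hl.ne']

lemma hasSum_evCorr (hS : IsSubordinate μ ψ b w M) (hb : IsolatedBox μ w M γ κ n l θ) {k : ℕ}
    (hk : 1 ≤ k) :
    HasSum (fun i => inner ℂ (ψ i) (evOp μ ψ b γ κ k n (ψ i))) (evCorr μ ψ b γ κ k n) ∧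
      ‖evCorr μ ψ b γ κ k n‖ ≤ boxLength γ κ n ^ 2 / l n * θ ^ k := by
  have hθ := hb.theta_nonneg hS.const_pos.le
  obtain ⟨k, rfl⟩ := Nat.exists_eq_add_of_le' hk
  have h := hb.hasSum_trace_contour (ψ := ψ) (C := θ ^ k) (by positivity)
    (hb.continuousOn_opKBK hS (k + 1)) fun z hz i => by
      rw [hb.opKBK_eq_sandwich hS hz]
      refine (hb.norm_inner_opK_mul_mul_le hz _ i).trans ?_
      exact div_le_div_of_nonneg_right (hb.norm_inner_sandwich_pow_le hS hz k i) hb.pos.le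
  rw [← pow_succ] at h
  exact h

/-- The remainder of the Neumann series of the resolvent. -/
def neumannRem (μ : ℕ+ → ℝ) (ψ : HilbertBasis ℕ+ ℂ H)
    (b : formDomain μ ψ →ₗ[ℂ] formDomain μ ψ →ₗ⋆[ℂ] ℂ) (j : ℕ) (z : ℂ) : H →L[ℂ] H :=
  resolv (opT μ ψ b) z - ∑ k ∈ Finset.range (j + 1), opKBK μ ψ b k z

lemma neumannRem_eq (hS : IsSubordinate μ ψ b w M) (hb : IsolatedBox μ w M γ κ n l θ) (j : ℕ)
    {z : ℂ} (hz : z ∈ bdryBox μ γ κ n) :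
    neumannRem μ ψ b j z = opK μ ψ z * (hS.sandwich (fun k => z - μ k) ^ (j + 1) *
      Ring.inverse (1 - hS.sandwich (fun k => z - μ k))) * opK μ ψ z := by
  have hlt : ‖hS.sandwich (fun k => z - μ k)‖ < 1 :=
    (hb.norm_sandwich_sub_le hS hz).trans_lt (by linarith [hb.theta_le])
  rw [neumannRem, hS.resolv_eq_mul (hb.comparable_sub hS hz) hlt]
  simp only [hb.opKBK_eq_sandwich hS hz]
  rw [← Finset.sum_mul, ← Finset.mul_sum, ← sub_mul, ← mul_sub]
  congr 2
  set B := hS.sandwich (fun k => z - μ k)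
  have h1 : (1 - B) * Ring.inverse (1 - B) = 1 :=
    Ring.mul_inverse_cancel _ (hS.isUnit_one_sub_sandwich hlt)
  have h2 : ∑ k ∈ Finset.range (j + 1), B ^ k =
      (1 - B ^ (j + 1)) * Ring.inverse (1 - B) := by
    rw [← geom_sum_mul_neg, mul_assoc, h1, mul_one]
  rw [h2, sub_mul, one_mul, sub_sub_cancel]

lemma norm_neumannRem_le (hS : IsSubordinate μ ψ b w M) (hb : IsolatedBox μ w M γ κ n l θ) (j : ℕ)
    {z : ℂ} (hz : z ∈ bdryBox μ γ κ n) : ‖neumannRem μ ψ b j z‖ ≤ 2 * θ ^ (j + 1) / l n := by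
  have hθ := hb.theta_nonneg hS.const_pos.le
  have hle := hb.norm_sandwich_sub_le hS hz
  rw [hb.neumannRem_eq hS j hz]
  refine (hb.norm_opK_mul_mul_le hz _).trans (div_le_div_of_nonneg_right ?_ hb.pos.le)
  rw [mul_comm 2]
  exact (norm_mul_le _ _).trans (mul_le_mul (hb.norm_sandwich_pow_le hS hz _)
    (norm_inverse_one_sub_le (hle.trans (by linarith [hb.theta_le]))) (norm_nonneg _)
    (by positivity))

/-- The remainder `B^{j+1} (1 - B)⁻¹` is written as `B X B` with `X = B^{j-1} (1 - B)⁻¹`, which is why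
`j ≥ 1` is needed here. -/
lemma norm_inner_neumannRem_le (hS : IsSubordinate μ ψ b w M)
    (hb : IsolatedBox μ w M γ κ n l θ) {j : ℕ} (hj : 1 ≤ j) {z : ℂ} (hz : z ∈ bdryBox μ γ κ n)
    (i : ℕ+) : ‖inner ℂ (ψ i) (neumannRem μ ψ b j z (ψ i))‖ ≤
      M * (2 * θ ^ j) * (w i ^ 2 / l i) / l n := by
  have hM := hS.const_pos
  have hθ := hb.theta_nonneg hS.const_pos.le
  have hle := hb.norm_sandwich_sub_le hS hz
  have hl : 0 < l i := hb.pos.trans_le (hb.le i)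
  obtain ⟨j, rfl⟩ := Nat.exists_eq_add_of_le' hj
  rw [hb.neumannRem_eq hS _ hz]
  refine (hb.norm_inner_opK_mul_mul_le hz _ i).trans (div_le_div_of_nonneg_right ?_ hb.pos.le)
  have hpow := hb.norm_sandwich_pow_le hS hz j
  set B := hS.sandwich (fun k => z - μ k)
  set G := Ring.inverse (1 - B)
  have hG : ‖G‖ ≤ 2 := norm_inverse_one_sub_le (hle.trans (by linarith [hb.theta_le]))
  have hcomm : B * G = G * B := by
    have hu : IsUnit (1 - B) := hS.isUnit_one_sub_sandwich
      (hle.trans_lt (by linarith [hb.theta_le]))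
    have h1 : (1 - B) * G = 1 := Ring.mul_inverse_cancel _ hu
    have h2 : G * (1 - B) = 1 := Ring.inverse_mul_cancel _ hu
    rw [sub_mul, one_mul] at h1
    rw [mul_sub, mul_one] at h2
    exact sub_right_injective (h1.trans h2.symm)
  have e : B ^ (j + 1 + 1) * G = B * (B ^ j * G) * B := by
    rw [pow_succ, mul_assoc, hcomm, pow_succ']
    simp only [mul_assoc]
  rw [e]
  refine (hb.norm_inner_mul_mul_le hS hz _ i).trans ?_
  have h3 : ‖B ^ j * G‖ ≤ θ ^ j * 2 :=
    (norm_mul_le _ _).trans (mul_le_mul hpow hG (norm_nonneg _) (by positivity))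
  calc M * θ * ‖B ^ j * G‖ * (w i ^ 2 / l i) ≤ M * θ * (θ ^ j * 2) * (w i ^ 2 / l i) := by gcongr
    _ = _ := by ring

lemma continuousOn_neumannRem (hS : IsSubordinate μ ψ b w M)
    (hb : IsolatedBox μ w M γ κ n l θ) (j : ℕ)
    (hc : ContinuousOn (resolv (opT μ ψ b)) (bdryBox μ γ κ n)) :
    ContinuousOn (neumannRem μ ψ b j) (bdryBox μ γ κ n) :=
  hc.sub (continuousOn_finsetSum _ fun k _ => hb.continuousOn_opKBK hS k)

lemma resolv_eq_sum (j : ℕ) (z : ℂ) : resolv (opT μ ψ b) z =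
    ∑ k ∈ Finset.range (j + 1), opKBK μ ψ b k z + neumannRem μ ψ b j z := by
  rw [neumannRem]; abel

lemma sum_range_eq_Icc {E : Type*} [AddCommMonoid E] (f : ℕ → E) (j : ℕ) :
    ∑ k ∈ Finset.range (j + 1), f k = f 0 + ∑ k ∈ Finset.Icc 1 j, f k := by
  rw [Finset.range_eq_Ico, Finset.sum_eq_sum_Ico_succ_bot (Nat.succ_pos j)]
  rfl

lemma vecCorr_zero (hb : IsolatedBox μ w M γ κ n l θ) : vecCorr μ ψ b γ κ 0 n = ψ n := by
  have h := contour_inv_sub_smul (μ := μ) (γ := γ) (n := n) hb.kappa_pos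
    (F := fun _ => ψ n) (differentiableOn_const _) hb.center_mem
  rw [← h, vecCorr]
  refine contour_congr hb.kappa_pos fun z hz => ?_
  have hne := sub_ne_zero_of_mem_bdryBox hb.center_mem hz
  have hk := hb.bdd_cpow hz
  rw [opKBK, pow_zero, mul_one]
  change diagOp ψ _ (diagOp ψ _ (ψ n)) = _
  rw [diagOp_basis hk, map_smul, diagOp_basis hk, smul_smul, cpow_neg_half_mul_self hne]

/-- The expansion of `φ_n` on one box. -/
theorem norm_phi_sub_le (hS : IsSubordinate μ ψ b w M) (hb : IsolatedBox μ w M γ κ n l θ)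
    (hc : ContinuousOn (resolv (opT μ ψ b)) (bdryBox μ γ κ n)) (j : ℕ) :
    ‖phi μ ψ b γ κ n - (ψ n + ∑ k ∈ Finset.Icc 1 j, vecCorr μ ψ b γ κ k n)‖ ≤
      boxLength γ κ n / l n * (2 * θ ^ (j + 1)) := by
  have hκ := hb.kappa_pos
  have happ : ∀ {F : ℂ → H →L[ℂ] H}, ContinuousOn F (bdryBox μ γ κ n) →
      ContinuousOn (fun z => F z (ψ n)) (bdryBox μ γ κ n) := fun hF =>
    hF.clm_apply continuousOn_const
  have hcont : ∀ k, ContinuousOn (fun z => opKBK μ ψ b k z (ψ n)) (bdryBox μ γ κ n) := fun k =>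
    happ (hb.continuousOn_opKBK hS k)
  have e : phi μ ψ b γ κ n = ∑ k ∈ Finset.range (j + 1), vecCorr μ ψ b γ κ k n +
      contour μ γ κ n (fun z => neumannRem μ ψ b j z (ψ n)) := by
    have e1 : ∀ z, resolv (opT μ ψ b) z (ψ n) =
        ∑ k ∈ Finset.range (j + 1), opKBK μ ψ b k z (ψ n) + neumannRem μ ψ b j z (ψ n) := by
      intro z
      rw [resolv_eq_sum j z, add_apply, sum_apply]
    simp only [phi, e1]
    rw [contour_add hκ (continuousOn_finsetSum _ fun k _ => hcont k)
      (happ (hb.continuousOn_neumannRem hS j hc)), contour_sum hκ _ fun k _ => hcont k]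
    rfl
  rw [e, sum_range_eq_Icc, hb.vecCorr_zero, add_sub_cancel_left]
  refine (hb.norm_contour_apply_le fun z hz => hb.norm_neumannRem_le hS j hz).trans (le_of_eq ?_)
  rw [div_mul_cancel₀ _ hb.pos.ne']

/-- The expansion of the eigenvalue on one box: the trace of
`(2πi)⁻¹ ∮ (z - μ_n) (z - T)⁻¹ dz = (λ_n - μ_n) P_n`, where `P_n` has trace one. -/
theorem norm_eigenvalue_sub_le (hS : IsSubordinate μ ψ b w M) (hb : IsolatedBox μ w M γ κ n l θ)
    (hc : ContinuousOn (resolv (opT μ ψ b)) (bdryBox μ γ κ n)) {ev : ℂ}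
    (htr : HasSum (fun i => inner ℂ (ψ i) (riesz μ ψ b γ κ n (ψ i))) 1)
    (hev : contour μ γ κ n (fun z => (z - μ n) • resolv (opT μ ψ b) z) =
        (ev - μ n) • riesz μ ψ b γ κ n) {j : ℕ} (hj : 1 ≤ j) :
    ‖ev - (μ n + ∑ k ∈ Finset.Icc 1 j, evCorr μ ψ b γ κ k n)‖ ≤
      boxLength γ κ n ^ 2 / l n * (2 * θ ^ (j + 1)) := by
  have hκ := hb.kappa_pos
  have hθ := hb.theta_nonneg hS.const_pos.le
  have hrem := hb.continuousOn_neumannRem hS j hc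
  obtain ⟨hR, hRle⟩ := hb.hasSum_trace_contour (ψ := ψ) (C := 2 * θ ^ j)
    (by positivity) hrem fun z hz i => hb.norm_inner_neumannRem_le hS hj hz i
  set Rop := contour μ γ κ n (fun z => (z - (μ n : ℂ)) • neumannRem μ ψ b j z)
  have e : contour μ γ κ n (fun z => (z - μ n) • resolv (opT μ ψ b) z) =
      ∑ k ∈ Finset.Icc 1 j, evOp μ ψ b γ κ k n + Rop := by
    have hcont : ∀ k, ContinuousOn (fun z => (z - (μ n : ℂ)) • opKBK μ ψ b k z)
        (bdryBox μ γ κ n) := fun k => continuousOn_sub_smul _ (hb.continuousOn_opKBK hS k)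
    have e1 : ∀ z, (z - (μ n : ℂ)) • resolv (opT μ ψ b) z =
        ∑ k ∈ Finset.range (j + 1), (z - (μ n : ℂ)) • opKBK μ ψ b k z +
          (z - (μ n : ℂ)) • neumannRem μ ψ b j z := by
      intro z
      rw [resolv_eq_sum j z, smul_add, Finset.smul_sum]
    simp only [e1]
    rw [contour_add hκ (continuousOn_finsetSum _ fun k _ => hcont k)
      (continuousOn_sub_smul _ hrem), contour_sum hκ _ fun k _ => hcont k,
      sum_range_eq_Icc]
    change evOp μ ψ b γ κ 0 n + _ + _ = _
    rw [hb.evOp_zero hS, zero_add]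
    rfl
  have h1 : HasSum (fun i => inner ℂ (ψ i) (((ev - μ n) • riesz μ ψ b γ κ n) (ψ i)))
      (ev - μ n) := by
    have := htr.mul_left (ev - μ n)
    rw [mul_one] at this
    refine this.congr_fun fun i => ?_
    rw [smul_apply, inner_smul_right]
  have h2 := (hasSum_sum (s := Finset.Icc 1 j) fun k hk => (hb.hasSum_evCorr hS (Finset.mem_Icc.1 hk).1).1).add hR
  have h3 : ev - μ n = ∑ k ∈ Finset.Icc 1 j, evCorr μ ψ b γ κ k n + trace ψ Rop := by
    refine h1.unique (h2.congr_fun fun i => ?_)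
    rw [← hev, e, add_apply, inner_add_right, sum_apply, inner_sum]
  have h4 : ev - (μ n + ∑ k ∈ Finset.Icc 1 j, evCorr μ ψ b γ κ k n) = trace ψ Rop := by
    rw [← sub_sub, h3, add_sub_cancel_left]
  rw [h4]
  refine hRle.trans (le_of_eq ?_)
  ring

end IsolatedBox

/-! ### Geometry of the boxes -/

section Geometry

variable {μ : ℕ+ → ℝ} {γ κ c : ℝ} {n : ℕ+}

lemma gapModel_self (γ : ℝ) (n : ℕ+) : gapModel γ n n = (n : ℝ) ^ (γ - 1) := by
  simp [gapModel]

/-- The model gap is smallest on the diagonal: for `m ≥ n` one has `m - n + 1 ≥ m / n`, so that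
`gapModel γ n m ≥ m ^ γ / n`. -/
lemma gapModel_self_le (hγ : 0 < γ) (n m : ℕ+) : gapModel γ n n ≤ gapModel γ n m := by
  have hn := pnat_one_le_cast n
  have hn0 := pnat_cast_pos n
  rw [gapModel_self, gapModel]
  rcases le_total (m : ℝ) n with h | h
  · rw [max_eq_left h]
    exact le_mul_of_one_le_left (rpow_pnat_pos n _).le (by linarith [abs_nonneg ((n : ℝ) - m)])
  · rw [max_eq_right h, abs_sub_comm, abs_of_nonneg (sub_nonneg.2 h)]
    have hm0 := pnat_cast_pos m
    have h1 : (m : ℝ) / n ≤ (m : ℝ) - n + 1 := by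
      rw [div_le_iff₀ hn0]
      nlinarith [mul_nonneg (sub_nonneg.2 h) (sub_nonneg.2 hn)]
    have h2 : (n : ℝ) ^ γ ≤ (m : ℝ) ^ γ := Real.rpow_le_rpow hn0.le h hγ.le
    calc (n : ℝ) ^ (γ - 1) = (n : ℝ) ^ γ / n := Real.rpow_sub_one hn0.ne' γ
      _ ≤ (m : ℝ) ^ γ / n := by gcongr
      _ = (m : ℝ) / n * (m : ℝ) ^ (γ - 1) := by
        rw [Real.rpow_sub_one hm0.ne']; field_simp
      _ ≤ _ := by gcongr

/-- The gap condition in a form symmetric in the two indices. -/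
lemma gapModel_le_abs_sub {N₁ : ℕ+} (h : ∀ n, N₁ ≤ n → ∀ m, m < n →
      c * (((n : ℝ) - m + 1) * (n : ℝ) ^ (γ - 1)) ≤ μ n - μ m) (hn : N₁ ≤ n) {m : ℕ+}
    (hmn : m ≠ n) : c * gapModel γ n m ≤ |μ m - μ n| := by
  rcases lt_or_gt_of_ne hmn with hlt | hlt
  · have h1 := h n hn m hlt
    have h2 : (m : ℝ) ≤ n := by exact_mod_cast hlt.le
    rw [gapModel, max_eq_left h2, abs_of_nonneg (sub_nonneg.2 h2), abs_sub_comm]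
    exact h1.trans (le_abs_self _)
  · have h1 := h m (hn.trans hlt.le) n hlt
    have h2 : (n : ℝ) ≤ m := by exact_mod_cast hlt.le
    rw [gapModel, max_eq_right h2, abs_sub_comm, abs_of_nonneg (sub_nonneg.2 h2)]
    exact h1.trans (le_abs_self _)

lemma pred_rpow_comparable (hn : 1 < n) (s : ℝ) :
    2 ^ (-|s|) * (n : ℝ) ^ s ≤ ((n : ℝ) - 1) ^ s ∧ ((n : ℝ) - 1) ^ s ≤ 2 ^ |s| * (n : ℝ) ^ s := by
  have h : (2 : ℝ) ≤ n := by exact_mod_cast (PNat.add_one_le_iff.2 hn : (1 : ℕ+) + 1 ≤ n)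
  exact rpow_comparable s (by linarith) (by linarith) (by linarith)

lemma two_rpow_neg_abs_le_one (s : ℝ) : (2 : ℝ) ^ (-|s|) ≤ 1 :=
  Real.rpow_le_one_of_one_le_of_nonpos one_le_two (neg_nonpos.2 (abs_nonneg s))

lemma le_norm_sub_of_notMem_box (hκ : 0 < κ) (hn : 1 < n) {z : ℂ} (hz : z ∉ box μ γ κ n) :
    κ / 2 * 2 ^ (-|γ - 1|) * (n : ℝ) ^ (γ - 1) ≤ ‖z - μ n‖ := by
  have h1 := (pred_rpow_comparable hn (γ - 1)).1
  have h2 := two_rpow_neg_abs_le_one (γ - 1)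
  have hp := rpow_pnat_pos n (γ - 1)
  have a1 : κ / 2 * 2 ^ (-|γ - 1|) * (n : ℝ) ^ (γ - 1) ≤ κ / 2 * ((n : ℝ) - 1) ^ (γ - 1) := by
    rw [mul_assoc]; gcongr
  have a2 : κ / 2 * 2 ^ (-|γ - 1|) * (n : ℝ) ^ (γ - 1) ≤ κ / 2 * (n : ℝ) ^ (γ - 1) := by
    rw [mul_assoc]; gcongr; exact mul_le_of_le_one_left hp.le h2
  have hre : |z.re - μ n| ≤ ‖z - μ n‖ := by
    simpa using Complex.abs_re_le_norm (z - μ n)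
  have him : |z.im| ≤ ‖z - μ n‖ := by
    simpa using Complex.abs_im_le_norm (z - μ n)
  by_contra! hlt
  refine hz ⟨?_, ?_, ?_⟩
  · linarith [neg_abs_le (z.re - μ n)]
  · linarith [le_abs_self (z.re - μ n)]
  · linarith

lemma closedBall_subset_closedBox (hκ : 0 < κ) (hn : 1 < n) {r : ℝ}
    (hr : r ≤ κ / 2 * 2 ^ (-|γ - 1|) * (n : ℝ) ^ (γ - 1)) :
    Metric.closedBall (μ n : ℂ) r ⊆ closedBox μ γ κ n := by
  intro z hz
  rw [Metric.mem_closedBall, dist_eq_norm] at hz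
  have h1 := (pred_rpow_comparable hn (γ - 1)).1
  have h2 := two_rpow_neg_abs_le_one (γ - 1)
  have hp := rpow_pnat_pos n (γ - 1)
  have a1 : κ / 2 * 2 ^ (-|γ - 1|) * (n : ℝ) ^ (γ - 1) ≤ κ / 2 * ((n : ℝ) - 1) ^ (γ - 1) := by
    rw [mul_assoc]; gcongr
  have a2 : κ / 2 * 2 ^ (-|γ - 1|) * (n : ℝ) ^ (γ - 1) ≤ κ / 2 * (n : ℝ) ^ (γ - 1) := by
    rw [mul_assoc]; gcongr; exact mul_le_of_le_one_left hp.le h2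
  have hre : |z.re - μ n| ≤ ‖z - μ n‖ := by
    simpa using Complex.abs_re_le_norm (z - μ n)
  have him : |z.im| ≤ ‖z - μ n‖ := by
    simpa using Complex.abs_im_le_norm (z - μ n)
  have hre' := abs_le.1 hre
  have him' := abs_le.1 him
  exact ⟨⟨by linarith, by linarith⟩, by linarith, by linarith⟩

/-- The closed box does not reach beyond the midpoint between `μ_n` and `μ_m`. -/
lemma half_abs_sub_le_of_mem_closedBox {N₀ N₁ : ℕ+} (hκ : 0 < κ) (hc : 0 < c) (hN : N₀ ≤ N₁)
    (hgap : ∀ k, N₀ ≤ k → κ * (k : ℝ) ^ (γ - 1) ≤ μ (k + 1) - μ k)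
    (h : ∀ n, N₁ ≤ n → ∀ m, m < n →
      c * (((n : ℝ) - m + 1) * (n : ℝ) ^ (γ - 1)) ≤ μ n - μ m) (hn : N₁ < n) {m : ℕ+}
    (hmn : m ≠ n) {z : ℂ} (hz : z ∈ closedBox μ γ κ n) : |μ m - μ n| / 2 ≤ ‖z - μ m‖ := by
  have hre : |z.re - μ m| ≤ ‖z - μ m‖ := by
    simpa using Complex.abs_re_le_norm (z - μ m)
  have hmono : ∀ k, N₁ ≤ k → ∀ m, m ≤ k → μ m ≤ μ k := by
    intro k hk m hmk
    rcases hmk.eq_or_lt with rfl | hlt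
    · exact le_rfl
    · have h1 := h k hk m hlt
      have h2 : (m : ℝ) ≤ k := by exact_mod_cast hlt.le
      have : 0 ≤ c * (((k : ℝ) - m + 1) * (k : ℝ) ^ (γ - 1)) :=
        mul_nonneg hc.le (mul_nonneg (by linarith) (rpow_pnat_pos k _).le)
      linarith
  obtain ⟨⟨b1, b2⟩, -, -⟩ := hz
  refine le_trans ?_ hre
  rcases lt_or_gt_of_ne hmn with hlt | hlt
  · obtain ⟨p, rfl⟩ := PNat.exists_eq_succ_of_ne_one (ne_of_gt (lt_of_le_of_lt one_le hn))
    have hp : N₁ ≤ p := PNat.lt_add_one_iff.1 hn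
    have h1 := hmono p hp m (PNat.lt_add_one_iff.1 hlt)
    have h2 := hgap p (hN.trans hp)
    have h3 : (((p + 1 : ℕ+) : ℝ)) - 1 = p := by push_cast; ring
    rw [h3] at b1
    have h4 : 0 ≤ κ * (p : ℝ) ^ (γ - 1) := mul_nonneg hκ.le (rpow_pnat_pos p _).le
    rw [abs_sub_comm, abs_of_nonneg (by linarith)]
    refine le_trans ?_ (le_abs_self _)
    linarith
  · have h1 := hmono m (hn.le.trans hlt.le) (n + 1) (PNat.add_one_le_iff.2 hlt)
    have h2 := hgap n (hN.trans hn.le)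
    have h4 : 0 ≤ κ * (n : ℝ) ^ (γ - 1) := mul_nonneg hκ.le (rpow_pnat_pos n _).le
    rw [abs_of_nonneg (by linarith), abs_sub_comm]
    refine le_trans ?_ (le_abs_self _)
    linarith

lemma boxLength_le (hκ : 0 < κ) (hn : 1 < n) :
    boxLength γ κ n ≤ κ / 2 * (2 ^ |γ - 1| + 3) * (n : ℝ) ^ (γ - 1) := by
  have h := mul_le_mul_of_nonneg_left (pred_rpow_comparable hn (γ - 1)).2 (half_pos hκ).le
  unfold boxLength
  linarith

end Geometry

/-! ### Power weights -/

/-- The weights `m ^ (-α)`. -/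
def powWeight (α : ℝ) (m : ℕ+) : ℝ := (m : ℝ) ^ (-α)

lemma powWeight_sq (α : ℝ) (m : ℕ+) : powWeight α m ^ 2 = (m : ℝ) ^ (-(2 * α)) := by
  rw [powWeight, ← Real.rpow_natCast, ← Real.rpow_mul (pnat_cast_pos m).le]
  congr 1
  push_cast
  ring

/-- The gap condition isolates all but finitely many of the `μ_n`, in a form which also controls
the points that lie outside all boxes. -/
lemma exists_isolatedBox {μ : ℕ+ → ℝ} {γ κ α M : ℝ} (hγ : 0 < γ) (hκ : 0 < κ) (hM : 0 < M)
    (hα : 1 < 2 * α + γ) {N₀ : ℕ+}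
    (hgap : ∀ k, N₀ ≤ k → κ * (k : ℝ) ^ (γ - 1) ≤ μ (k + 1) - μ k) :
    ∃ c > 0, ∃ C > 0, ∃ N, N₀ < N ∧
      (∀ n, N ≤ n → IsolatedBox μ (powWeight α) M γ κ n (fun m => c * gapModel γ n m)
        (C * sigma (2 * α) γ n)) ∧
      (∀ n, N ≤ n → ∀ m, m < n → μ m < μ n) ∧
      ∀ n, N ≤ n → ∀ z, z ∉ box μ γ κ n → (∀ m, |z.re - μ n| ≤ |z.re - μ m|) →
        ∀ m, c * gapModel γ n m ≤ ‖z - μ m‖ := by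
  obtain ⟨c₀, hc₀, N₁, hN₁, h⟩ := exists_gap hγ hκ hgap
  obtain ⟨C₀, hC₀, hsum⟩ := tsum_gapModel_le (s := 2 * α) (γ := γ) hα
  -- half of the gap constant, and half the side of the box up to replacing `n - 1` by `n`
  set c := min (c₀ / 2) (κ / 2 * 2 ^ (-|γ - 1|)) with hc
  have hcpos : 0 < c := by positivity
  have hc1 : c ≤ c₀ / 2 := min_le_left _ _
  have hc2 : c ≤ κ / 2 * 2 ^ (-|γ - 1|) := min_le_right _ _
  have hself : ∀ n : ℕ+, c * gapModel γ n n ≤ κ / 2 * 2 ^ (-|γ - 1|) * (n : ℝ) ^ (γ - 1) := by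
    intro n
    rw [gapModel_self]
    exact mul_le_mul_of_nonneg_right hc2 (rpow_pnat_pos n _).le
  have hhalf : ∀ n, N₁ ≤ n → ∀ m, m ≠ n → c * gapModel γ n m ≤ |μ m - μ n| / 2 := by
    intro n hn m hmn
    have h1 := gapModel_le_abs_sub h hn hmn
    have h2 := mul_le_mul_of_nonneg_right hc1 (gapModel_pos γ n m).le
    linarith
  have hσ := ((tendsto_sigma (s := 2 * α) hγ hα).const_mul (M * C₀ / c)).eventually_le_const
    (u := 1 / 64) (by norm_num)
  obtain ⟨N₂, hN₂⟩ := eventually_atTop.1 hσ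
  refine ⟨c, hcpos, M * C₀ / c, by positivity, max N₂ (N₁ + 1),
    lt_max_of_lt_right (PNat.lt_add_one_iff.2 hN₁), fun n hn => ?_, fun n hn m hm => ?_,
    fun n hn z hz hmin m => ?_⟩
  · have hnN₁ : N₁ < n := PNat.add_one_le_iff.1 ((le_max_right _ _).trans hn)
    have hn1 : 1 < n := lt_of_le_of_lt one_le hnN₁
    have e : ∀ m, powWeight α m ^ 2 / (c * gapModel γ n m) =
        c⁻¹ * ((m : ℝ) ^ (-(2 * α)) / gapModel γ n m) := by
      intro m
      rw [powWeight_sq, div_mul_eq_div_div_swap, div_eq_mul_inv, mul_comm]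
    refine ⟨hn1, hκ, mul_pos hcpos (gapModel_pos γ n n), fun m =>
      mul_le_mul_of_nonneg_left (gapModel_self_le hγ n m) hcpos.le, fun z hz m hmn => ?_,
      fun z hz => ?_, closedBall_subset_closedBox hκ hn1 (hself n), ?_, ?_,
      hN₂ n ((le_max_left _ _).trans hn)⟩
    · exact (hhalf n hnN₁.le m hmn).trans
        (half_abs_sub_le_of_mem_closedBox hκ hc₀ hN₁ hgap h hnN₁ hmn hz)
    · exact (hself n).trans (le_norm_sub_of_notMem_box hκ hn1 hz.2)
    · simp only [e]
      exact (hsum n).1.mul_left _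
    · simp only [e]
      rw [tsum_mul_left]
      calc M * (c⁻¹ * ∑' m : ℕ+, (m : ℝ) ^ (-(2 * α)) / gapModel γ n m)
          ≤ M * (c⁻¹ * (C₀ * sigma (2 * α) γ n)) := by
            gcongr; exact (hsum n).2
        _ = _ := by rw [div_eq_mul_inv]; ring
  · have hnN₁ : N₁ < n := PNat.add_one_le_iff.1 ((le_max_right _ _).trans hn)
    have h1 := h n hnN₁.le m hm
    have h2 : (m : ℝ) ≤ n := by exact_mod_cast hm.le
    have : 0 < c₀ * (((n : ℝ) - m + 1) * (n : ℝ) ^ (γ - 1)) :=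
      mul_pos hc₀ (mul_pos (by linarith) (rpow_pnat_pos n _))
    linarith
  · have hnN₁ : N₁ < n := PNat.add_one_le_iff.1 ((le_max_right _ _).trans hn)
    have hn1 : 1 < n := lt_of_le_of_lt one_le hnN₁
    by_cases hmn : m = n
    · rw [hmn]
      exact (hself n).trans (le_norm_sub_of_notMem_box hκ hn1 hz)
    · have hre : |z.re - μ m| ≤ ‖z - μ m‖ := by
        simpa using Complex.abs_re_le_norm (z - μ m)
      have h1 : |μ m - μ n| ≤ |z.re - μ n| + |z.re - μ m| := by
        have := abs_sub (z.re - μ n) (z.re - μ m)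
        rwa [sub_sub_sub_cancel_left] at this
      have := hmin m
      have := hhalf n hnN₁.le m hmn
      linarith

/-- Local form-subordination with the weights `m ^ (-α)`; the series `∑ w_k² / μ_k` is dominated by
`∑ k ^ (-(2α + γ))`. -/
lemma isSubordinate_powWeight {μ : ℕ+ → ℝ} {ψ : HilbertBasis ℕ+ ℂ H} (hμ : ∀ k, 0 < μ k)
    {γ κ : ℝ} (hγ : 0 < γ) (hκ : 0 < κ) {N₀ : ℕ+}
    (hgap : ∀ k, N₀ ≤ k → κ * (k : ℝ) ^ (γ - 1) ≤ μ (k + 1) - μ k)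
    {b : formDomain μ ψ →ₗ[ℂ] formDomain μ ψ →ₗ⋆[ℂ] ℂ}
    (hb : ∀ f g : formDomain μ ψ,
      Tendsto (fun n => b (trunc μ ψ n f) (trunc μ ψ n g)) atTop (𝓝 (b f g)))
    {α : ℝ} (hα : 1 < 2 * α + γ) {M : ℝ} (hM : 0 < M)
    (hsub : ∀ m n : ℕ+,
      ‖b (basisVec μ ψ m) (basisVec μ ψ n)‖ ≤ M / ((m : ℝ) ^ α * (n : ℝ) ^ α)) :
    IsSubordinate μ ψ b (powWeight α) M ∧ Tendsto μ cofinite atTop := by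
  obtain ⟨c₀, hc₀, N₁, -, h⟩ := exists_gap hγ hκ hgap
  obtain ⟨c, hc, hgrow⟩ := exists_growth hμ hc₀ h
  refine ⟨⟨⟨c, hc, fun k => ?_⟩, fun k => (rpow_pnat_pos k _).le, hM, fun m n => ?_, hb, ?_⟩, ?_⟩
  · exact (le_mul_of_one_le_right hc.le (Real.one_le_rpow (pnat_one_le_cast k) hγ.le)).trans
      (hgrow k)
  · refine (hsub m n).trans (le_of_eq ?_)
    rw [powWeight, powWeight, Real.rpow_neg (pnat_cast_pos m).le,
      Real.rpow_neg (pnat_cast_pos n).le, ← mul_inv, div_eq_mul_inv]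
  · have h1 : Summable fun k : ℕ+ => c⁻¹ * (k : ℝ) ^ (-(2 * α + γ)) := by
      have h2 : Summable fun k : ℕ => (k : ℝ) ^ (-(2 * α + γ)) :=
        Real.summable_nat_rpow.2 (by linarith)
      exact (h2.comp_injective PNat.coe_injective).mul_left _
    refine Summable.of_nonneg_of_le (fun k => div_nonneg (sq_nonneg _) (hμ k).le) (fun k => ?_) h1
    have hk := pnat_cast_pos k
    rw [powWeight_sq]
    calc (k : ℝ) ^ (-(2 * α)) / μ k ≤ (k : ℝ) ^ (-(2 * α)) / (c * (k : ℝ) ^ γ) :=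
          div_le_div_of_nonneg_left (rpow_pnat_pos k _).le (mul_pos hc (rpow_pnat_pos k _))
            (hgrow k)
      _ = _ := by
        rw [neg_add, Real.rpow_add hk, Real.rpow_neg hk.le γ, div_eq_mul_inv, mul_inv]
        ring
  · have h1 : Tendsto (fun k : ℕ => c * (k : ℝ) ^ γ) atTop atTop :=
      ((tendsto_rpow_atTop hγ).comp tendsto_natCast_atTop_atTop).const_mul_atTop hc
    rw [← Nat.cofinite_eq_atTop] at h1
    exact tendsto_atTop_mono hgrow (h1.comp PNat.coe_injective.tendsto_cofinite)

/-! ### The spectrum outside the boxes and the factorization of `T` -/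

namespace IsSubordinate

variable {μ : ℕ+ → ℝ} {ψ : HilbertBasis ℕ+ ℂ H}
    {b : formDomain μ ψ →ₗ[ℂ] formDomain μ ψ →ₗ⋆[ℂ] ℂ} {w : ℕ+ → ℝ} {M : ℝ}

/-- If `M ∑ w_k² / |z - μ_k| < 1`, then `B(z)` has norm less than one and `z` is in the resolvent
set. -/
lemma mem_resSet_of_le (hS : IsSubordinate μ ψ b w M) {z : ℂ} {l : ℕ+ → ℝ} {c : ℝ} (hc : 0 < c)
    (hcl : ∀ k, c ≤ l k) (hl : ∀ k, l k ≤ ‖z - μ k‖) (hs : Summable fun k => w k ^ 2 / l k)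
    (h : M * ∑' k, w k ^ 2 / l k < 1) : z ∈ resSet (opT μ ψ b) := by
  have hz : IsComparable μ (fun k => z - μ k) :=
    hS.comparable_sub ⟨c, hc, fun k => (hcl k).trans (hl k)⟩
  refine ⟨_, hS.isResolventAt_opT (hS.isUnit_pencil hz ?_)⟩
  refine ((hS.norm_sandwich_le hz).trans (mul_le_mul_of_nonneg_left ?_ hS.const_pos.le)).trans_lt h
  exact (hS.summable_weight_div hz).tsum_le_tsum (fun k => div_le_div_of_nonneg_left (sq_nonneg _)
    (hc.trans_le (hcl k)) (hl k)) hs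

/-- Left of any vertical line the spectrum of `T` is bounded: there `|z - μ_k| ≥ max(h, μ_k - R)`,
and the corresponding sum tends to zero as `h → ∞` by dominated convergence. -/
lemma exists_bound_spec (hS : IsSubordinate μ ψ b w M) {R : ℝ} (hR : 0 ≤ R) :
    ∃ h > 0, ∀ z : ℂ, z.re < R → (z.re ≤ -h ∨ h ≤ |z.im|) → z ∈ resSet (opT μ ψ b) := by
  -- for `h ≥ 1` the maximum is at least the convex combination `(R h + (μ_k - R)) / (1 + R)`
  have hdom : ∀ h : ℝ, 1 ≤ h → ∀ k, w k ^ 2 / max h (μ k - R) ≤ (1 + R) * (w k ^ 2 / μ k) := by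
    intro h hh k
    have hk := hS.pos k
    have h1 : μ k / (1 + R) ≤ max h (μ k - R) := by
      rw [div_le_iff₀ (by linarith)]
      nlinarith [le_max_left h (μ k - R), le_max_right h (μ k - R)]
    calc w k ^ 2 / max h (μ k - R) ≤ w k ^ 2 / (μ k / (1 + R)) :=
          div_le_div_of_nonneg_left (sq_nonneg _) (by positivity) h1
      _ = _ := by field_simp
  have hsum := hS.summable.mul_left (1 + R)
  have hlim : Tendsto (fun h : ℝ => M * ∑' k, w k ^ 2 / max h (μ k - R)) atTop (𝓝 (M * 0)) := by
    have h0 : Tendsto (fun h : ℝ => ∑' k, w k ^ 2 / max h (μ k - R)) atTop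
        (𝓝 (∑' _ : ℕ+, (0 : ℝ))) := by
      refine tendsto_tsum_of_dominated_convergence hsum (fun k => ?_) ?_
      · exact Tendsto.const_div_atTop
          (tendsto_atTop_mono (fun h => le_max_left h (μ k - R)) tendsto_id) _
      · filter_upwards [eventually_ge_atTop 1] with h hh k
        rw [Real.norm_of_nonneg (div_nonneg (sq_nonneg _)
          ((zero_le_one.trans hh).trans (le_max_left _ _)))]
        exact hdom h hh k
    rw [tsum_zero] at h0
    exact h0.const_mul M
  rw [mul_zero] at hlim
  obtain ⟨h, h1, hh⟩ := ((hlim.eventually_lt_const one_pos).and (eventually_ge_atTop 1)).exists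
  have hh0 : 0 < h := one_pos.trans_le hh
  refine ⟨h, hh0, fun z hz hzh => hS.mem_resSet_of_le hh0 (fun k => le_max_left h (μ k - R))
    (fun k => ?_) ?_ h1⟩
  · have hk := hS.pos k
    have hre : |z.re - μ k| ≤ ‖z - μ k‖ := by
      simpa using Complex.abs_re_le_norm (z - μ k)
    have him : |z.im| ≤ ‖z - μ k‖ := by
      simpa using Complex.abs_im_le_norm (z - μ k)
    have h2 := neg_abs_le (z.re - μ k)
    refine max_le ?_ (by linarith)
    rcases hzh with h3 | h3
    · linarith
    · linarith
  · exact Summable.of_nonneg_of_le (fun k => div_nonneg (sq_nonneg _)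
      (hh0.le.trans (le_max_left _ _))) (hdom h hh) hsum

/-- The factorization `T = A^{1/2} (1 - B(0)) A^{1/2}`, including the domain. -/
lemma mem_graph_opT_iff_opB (hS : IsSubordinate μ ψ b w M) (f y : H) :
    (f, y) ∈ (opT μ ψ b).graph ↔
      ∃ (hf : f ∈ formDomain μ ψ)
        (hg : sqrtA μ ψ ⟨f, hf⟩ - opB μ ψ b 0 (sqrtA μ ψ ⟨f, hf⟩) ∈ formDomain μ ψ),
        sqrtA μ ψ ⟨_, hg⟩ = y := by
  rw [hS.mem_graph_opT, hS.opB_zero]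
  refine exists_congr fun hf => ?_
  rw [neg_apply, sub_neg_eq_add]
  constructor
  · intro h
    refine ⟨h ▸ hS.invSqrtA_mem y, ?_⟩
    have e : ∀ x (hx : x ∈ formDomain μ ψ), x = invSqrtA μ ψ y → sqrtA μ ψ ⟨x, hx⟩ = y := by
      rintro x hx rfl
      exact hS.sqrtA_invSqrtA y hx
    exact e _ _ h
  · rintro ⟨hg, h⟩
    rw [← h]
    exact (hS.invSqrtA_sqrtA ⟨_, hg⟩).symm

end IsSubordinate

end

end LocalSub

open LocalSub in
theorem theorem3p2 {H : Type*} [NormedAddCommGroup H] [InnerProductSpace ℂ H] [CompleteSpace H]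
    -- the self-adjoint operator `A` with compact resolvent, its eigenvalues and eigenvectors
    (A : H →ₗ.[ℂ] H) (hA : IsSelfAdjoint A) (hAc : HasCompactResolvent A)
    (μ : ℕ+ → ℝ) (ψ : HilbertBasis ℕ+ ℂ H)
    (hψ : ∀ k, IsEigenvector A (μ k) (ψ k)) (hμ : ∀ k, 0 < μ k)
    (γ κ : ℝ) (hγ : 0 < γ) (hκ : 0 < κ) (N₀ : ℕ+)
    (hgap : ∀ k, N₀ ≤ k → κ * (k : ℝ) ^ (γ - 1) ≤ μ (k + 1) - μ k)
    -- the form `b` on `Dom(a)`; it is given by its values on the eigenvectors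
    (b : formDomain μ ψ →ₗ[ℂ] formDomain μ ψ →ₗ⋆[ℂ] ℂ)
    (hb : ∀ f g : formDomain μ ψ,
      Tendsto (fun n => b (trunc μ ψ n f) (trunc μ ψ n g)) atTop (𝓝 (b f g)))
    -- local form-subordination
    (α : ℝ) (hα : 1 < 2 * α + γ) (M : ℝ) (hM : 0 < M)
    (hsub : ∀ m n : ℕ+,
      ‖b (basisVec μ ψ m) (basisVec μ ψ n)‖ ≤ M / ((m : ℝ) ^ α * (n : ℝ) ^ α)) :
    -- `B(z)` is well defined on `ρ(A)`, and `T = A^{1/2} (I - B(0)) A^{1/2}`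
    (∀ z ∈ resSet A, IsB μ ψ b z (opB μ ψ b z)) ∧
    (∀ f w : H, (f, w) ∈ (opT μ ψ b).graph ↔
      ∃ (hf : f ∈ formDomain μ ψ)
        (hg : sqrtA μ ψ ⟨f, hf⟩ - opB μ ψ b 0 (sqrtA μ ψ ⟨f, hf⟩) ∈ formDomain μ ψ),
        sqrtA μ ψ ⟨_, hg⟩ = w) ∧
    ∃ (N : ℕ+) (h : ℝ), N₀ < N ∧ 0 < h ∧
      -- localization of the spectrum; the contour integrals below make sense
      (spec (opT μ ψ b) ⊆ boxZero μ γ κ N h ∪ ⋃ n > N, box μ γ κ n) ∧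
      (∀ n > N, frontier (box μ γ κ n) ⊆ resSet A ∩ resSet (opT μ ψ b) ∧
        ContinuousOn (resolv (opT μ ψ b)) (frontier (box μ γ κ n)) ∧
        ∀ k, 1 ≤ k → ContinuousOn (opKBK μ ψ b k) (frontier (box μ γ κ n)) ∧
          IsTraceClass (evOp μ ψ b γ κ k n)) ∧
      ∃ ev : ℕ+ → ℂ,
        -- `ev n` is the only point of the spectrum in `Π_n`, and a simple eigenvalue
        (∀ n > N, spec (opT μ ψ b) ∩ box μ γ κ n = {ev n} ∧
          (∃ f, IsEigenvector (opT μ ψ b) (ev n) f) ∧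
          Module.finrank ℂ (LinearMap.range (riesz μ ψ b γ κ n).toLinearMap) = 1) ∧
        -- expansion of the eigenvalues
        (∀ k, 1 ≤ k → (fun n => evCorr μ ψ b γ κ k n) =O[atTop]
          fun n : ℕ+ => (n : ℝ) ^ (γ - 1) * sigma (2 * α) γ n ^ k) ∧
        (∀ j, 1 ≤ j → ∃ r : ℕ+ → ℂ,
          (∀ n > N, ev n = μ n + ∑ k ∈ Finset.Icc 1 j, evCorr μ ψ b γ κ k n + r n) ∧
          r =O[atTop] fun n : ℕ+ => (n : ℝ) ^ (γ - 1) * sigma (2 * α) γ n ^ (j + 1)) ∧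
        -- expansion of the eigenvectors
        (∀ k, 1 ≤ k → (fun n => vecCorr μ ψ b γ κ k n) =O[atTop]
          fun n : ℕ+ => sigma (2 * α) γ n ^ k) ∧
        (∀ j, 1 ≤ j → ∃ ρ : ℕ+ → H,
          (∀ n > N, phi μ ψ b γ κ n
            = ψ n + ∑ k ∈ Finset.Icc 1 j, vecCorr μ ψ b γ κ k n + ρ n) ∧
          ρ =O[atTop] fun n : ℕ+ => sigma (2 * α) γ n ^ (j + 1)) ∧
        (∃ N₁ : ℕ+, N ≤ N₁ ∧ ∀ n > N₁, IsEigenvector (opT μ ψ b) (ev n) (phi μ ψ b γ κ n)) := by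
  obtain ⟨hS, hμ_tendsto⟩ := isSubordinate_powWeight hμ hγ hκ hgap hb hα hM hsub
  refine ⟨fun z hz => hS.isB_opB (hS.comparable_sub (exists_le_norm_sub_of_mem_resSet hψ hz)),
    hS.mem_graph_opT_iff_opB, ?_⟩
  obtain ⟨c, hc, C, hC, N, hN, hbox, hmono, hout⟩ := exists_isolatedBox (α := α) hγ hκ hM hα hgap
  set R := μ N + κ / 2 * (N : ℝ) ^ (γ - 1) with hR
  have hRN : μ N < R := lt_add_of_pos_right _ (mul_pos (half_pos hκ) (rpow_pnat_pos N _))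
  obtain ⟨h, hh, hleft⟩ := hS.exists_bound_spec (R := R) ((hμ N).le.trans hRN.le)
  have hex := fun n (hn : N ≤ n) => (hbox n hn).exists_eigenvalue hS
  choose! ev hev hspec hres hcont heig hrank htr hint using hex
  have hlen : ∀ n, N ≤ n → boxLength γ κ n / (c * gapModel γ n n) ≤
      κ / 2 * (2 ^ |γ - 1| + 3) / c := by
    intro n hn
    rw [gapModel_self, div_le_div_iff₀ (mul_pos hc (rpow_pnat_pos n _)) hc]
    have := mul_le_mul_of_nonneg_right (boxLength_le (γ := γ) hκ (hbox n hn).one_lt) hc.le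
    linarith
  -- `C₁ n^{γ-1}` bounds the length of the contour, and `c n^{γ-1}` is the distance `l_n`
  set C₁ := κ / 2 * (2 ^ |γ - 1| + 3) with hC₁
  have hC₁0 : 0 < C₁ := by positivity
  have hlen2 : ∀ n, N ≤ n → boxLength γ κ n ^ 2 / (c * gapModel γ n n) ≤
      C₁ * (C₁ / c) * (n : ℝ) ^ (γ - 1) := by
    intro n hn
    have h0 := boxLength_nonneg (γ := γ) hκ n
    calc boxLength γ κ n ^ 2 / (c * gapModel γ n n)
        = boxLength γ κ n * (boxLength γ κ n / (c * gapModel γ n n)) := by ring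
      _ ≤ (C₁ * (n : ℝ) ^ (γ - 1)) * (C₁ / c) := by
        exact mul_le_mul (boxLength_le hκ (hbox n hn).one_lt) (hlen n hn)
          (div_nonneg h0 (hbox n hn).pos.le)
          (mul_nonneg hC₁0.le (rpow_pnat_pos n _).le)
      _ = _ := by ring
  have hO_vec : ∀ {f : ℕ+ → H} {a : ℝ} (k : ℕ), 0 ≤ a →
      (∀ n, N ≤ n → ‖f n‖ ≤ boxLength γ κ n / (c * gapModel γ n n) *
        (a * (C * sigma (2 * α) γ n) ^ k)) →
      f =O[atTop] fun n : ℕ+ => sigma (2 * α) γ n ^ k := by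
    intro f a k ha hf
    refine IsBigO.of_bound (C₁ / c * (a * C ^ k)) ?_
    filter_upwards [eventually_ge_atTop N] with n hn
    have hσ := sigma_pos (2 * α) γ n
    rw [Real.norm_of_nonneg (by positivity)]
    calc ‖f n‖ ≤ _ := hf n hn
      _ ≤ C₁ / c * (a * (C * sigma (2 * α) γ n) ^ k) := by
        exact mul_le_mul_of_nonneg_right (hlen n hn) (by positivity)
      _ = _ := by rw [mul_pow]; ring
  have hO_ev : ∀ {f : ℕ+ → ℂ} {a : ℝ} (k : ℕ), 0 ≤ a →
      (∀ n, N ≤ n → ‖f n‖ ≤ boxLength γ κ n ^ 2 / (c * gapModel γ n n) *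
        (a * (C * sigma (2 * α) γ n) ^ k)) →
      f =O[atTop] fun n : ℕ+ => (n : ℝ) ^ (γ - 1) * sigma (2 * α) γ n ^ k := by
    intro f a k ha hf
    refine IsBigO.of_bound (C₁ * (C₁ / c) * (a * C ^ k)) ?_
    filter_upwards [eventually_ge_atTop N] with n hn
    have hσ := sigma_pos (2 * α) γ n
    have hp := rpow_pnat_pos n (γ - 1)
    rw [Real.norm_of_nonneg (by positivity)]
    calc ‖f n‖ ≤ _ := hf n hn
      _ ≤ C₁ * (C₁ / c) * (n : ℝ) ^ (γ - 1) * (a * (C * sigma (2 * α) γ n) ^ k) := by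
        exact mul_le_mul_of_nonneg_right (hlen2 n hn) (by positivity)
      _ = _ := by rw [mul_pow]; ring
  refine ⟨N, h, hN, hh, ?_, fun n hn => ⟨?_, ?_, fun k _ => ⟨?_, ?_⟩⟩, ev,
    fun n hn => ⟨hspec n hn.le, ⟨_, heig n hn.le⟩, hrank n hn.le⟩, fun k hk => ?_, fun j hj => ?_,
    fun k _ => ?_, fun j _ => ?_, N, le_rfl, fun n hn => heig n hn.le⟩
  · intro z hz
    by_contra hnot
    rw [Set.mem_union, not_or] at hnot
    obtain ⟨hnot0, hnotU⟩ := hnot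
    refine hz ?_
    -- the line through the right side of `Π_N` belongs to the second case
    rcases lt_or_ge z.re R with hlt | hge
    · refine hleft z hlt ?_
      by_contra! hcon
      exact hnot0 ⟨hcon.1, hlt, hcon.2⟩
    -- to the right of the line, compare with the eigenvalue closest to the real part of `z`
    · have htend : Tendsto (fun k => |z.re - μ k|) cofinite atTop :=
        tendsto_abs_atBot_atTop.comp (tendsto_const_nhds.add_atBot
          (tendsto_neg_atTop_atBot.comp hμ_tendsto))
      obtain ⟨n, hmin⟩ := htend.exists_forall_le
      have hn : N ≤ n := by
        by_contra! hlt
        have h1 := hmono N le_rfl n hlt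
        have h2 := hmin N
        rw [abs_of_pos (by linarith), abs_of_pos (by linarith)] at h2
        linarith
      have hzn : z ∉ box μ γ κ n := by
        rcases hn.eq_or_lt with rfl | hlt
        · exact fun hz' => absurd hz'.2.1 (not_lt.2 hge)
        · exact fun hz' => hnotU (Set.mem_biUnion (by exact hlt) hz')
      have hB := hbox n hn
      exact hS.mem_resSet_of_le hB.pos hB.le (hout n hn z hzn hmin) hB.summable
        (hB.small.trans_lt (by linarith [hB.theta_le]))
  · intro z hz
    have hz' := frontier_box_subset _ _ _ _ hz
    have hB := hbox n hn.le
    exact ⟨mem_resSet_of_le_norm_sub hA hψ hB.pos fun k => (hB.le k).trans (hB.le_norm_sub hz' k),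
      hres n hn.le hz'⟩
  · exact (hcont n hn.le).mono (frontier_box_subset _ _ _ _)
  · exact ((hbox n hn.le).continuousOn_opKBK hS k).mono (frontier_box_subset _ _ _ _)
  · exact (hbox n hn.le).isTraceClass_evOp hS k
  · refine hO_ev k zero_le_one fun n hn => ?_
    rw [one_mul]
    exact ((hbox n hn).hasSum_evCorr hS hk).2
  · refine ⟨fun n => ev n - (μ n + ∑ k ∈ Finset.Icc 1 j, evCorr μ ψ b γ κ k n),
      fun n _ => (add_sub_cancel _ _).symm, hO_ev (j + 1) zero_le_two fun n hn => ?_⟩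
    exact (hbox n hn).norm_eigenvalue_sub_le hS (hcont n hn) (htr n hn) (hint n hn) hj
  · refine hO_vec k zero_le_one fun n hn => ?_
    rw [one_mul]
    exact (hbox n hn).norm_vecCorr_le hS k
  · refine ⟨fun n => phi μ ψ b γ κ n - (ψ n + ∑ k ∈ Finset.Icc 1 j, vecCorr μ ψ b γ κ k n),
      fun n _ => (add_sub_cancel _ _).symm, hO_vec (j + 1) zero_le_two fun n hn => ?_⟩
    exact (hbox n hn).norm_phi_sub_le hS (hcont n hn) j
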